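/- **Setting.** Let $U$ be holomorphic in a complex neighbourhood of $[0,1]$, real on $[0,1]$, with $U'(0)>0$ and $U(z)\neq U(0)$ for $0<z\le 1$. For $\alpha>0$, $R>0$ and $z_c\in\mathbb C$ near $0$ put $$c=U(z_c),\quad U_c'=U'(z_c),\quad \varepsilon=\frac1{i\alpha R},\quad \delta=\Big(\frac{\varepsilon}{U_c'}\Big)^{1/3}=e^{-i\pi/6}(\alpha R\,U_c')^{-1/3},$$ $$\mathrm{Airy}(\phi)=\varepsilon\,\partial_z^4\phi-(U-c+2\varepsilon\alpha^2)\,\partial_z^2\phi .$$ Let $X_0$ be the space of continuous functions $f:[0,1]\to\mathbb C$ with $\|f\|_{X_0}=\sup_{[0,1]}|f|$. **Approximate Green function.** Let $Ai$ be the Airy function and $Ci(z)=2\pi e^{i\pi/6}Ai(e^{2\pi i/3}z)=i\pi(Ai-iBi)(z)$, so that $Ai\,Ci'-Ai'\,Ci=1$ and $Ci(e^{i\pi/6}x)\to0$ as $x\to-\infty$. Let $\eta(z)=\big[\tfrac32\int_{z_c}^z\big(\tfrac{U-c}{U_c'}\big)^{1/2}\big]^{2/3}$ be Langer's variable (the analytic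 branch with $\eta(z)\sim z-z_c$ at $z_c$), $\dot z=1/\eta'(z)$, $\dot x=1/\eta'(x)$, and $$\widetilde{Ai}(1,z)=\delta^{-1}\!\int_1^z\dot y^{1/2}Ai(\delta^{-1}\eta(y))\,dy,\quad \widetilde{Ai}(2,z)=\delta^{-1}\!\int_1^z\widetilde{Ai}(1,y)\,dy,$$ $$\widetilde{Ci}(1,z)=\delta^{-1}\!\int_0^z\dot y^{1/2}Ci(\delta^{-1}\eta(y))\,dy,\quad \widetilde{Ci}(2,z)=\delta^{-1}\!\int_0^z\widetilde{Ci}(1,y)\,dy.$$ Writing $X=\delta^{-1}\eta(x)$ and $Z=\delta^{-1}\eta(z)$, set $$G(x,z)=-\delta^3\varepsilon^{-1}\dot x^{1/2}\begin{cases}Ai(X)\,\widetilde{Ci}(2,z)+a_1(x)(z-z_c)/\delta,& z<x,\\ Ci(X)\,\widetilde{Ai}(2,z)+a_2(x)+a_1(x)(x-z_c)/\delta,& z>x,\end{cases}$$ with $a_1(x)=Ci(X)\widetilde{Ai}(1,x)-Ai(X)\widetilde{Ci}(1,x)$ and $a_2(x)=Ai(X)\widetilde{Ci}(2,x)-Ci(X)\widetilde{Ai}(2,x)$;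 thus $G,\partial_zG,\partial_z^2G$ are continuous across $z=x$ and $\varepsilon\,\partial_z^3G$ jumps by $1$. Explicitly, $\partial_z^2G(x,z)=-\delta\varepsilon^{-1}\dot x^{1/2}\dot z^{1/2}\,Ai(X)Ci(Z)$ for $z<x$, and $-\delta\varepsilon^{-1}\dot x^{1/2}\dot z^{1/2}\,Ci(X)Ai(Z)$ for $z>x$. Let $$Err_A(x,z)=\varepsilon\big(\dot z^{-1/2}\partial_z^2\dot z^{1/2}-2\alpha^2\big)\partial_z^2G(x,z),$$ $$AirySolver(f)(z)=\int_0^1G(x,z)f(x)\,dx,\qquad AiryErr(f)(z)=\int_0^1Err_A(x,z)f(x)\,dx .$$ **Proposition 4.1.** There is $r>0$ depending only on $U$, and for every $M$ there are $\delta_0,C>0$ depending only on $U$ and $M$, such that the following holds whenever $$0<\alpha\le M,\quad R>0,\quad |z_c|<r,\quad |\delta|\le\delta_0,\quad \mathrm{Im}\,z_c\ge -M|\delta|,\quad |z_c|\log\frac{1}{|\delta|+\mathrm{dist}(z_c,[0,1])}\le M .$$ 1. $AirySolver$ and $AiryErr$ are bounded linear operators from $X_0$ to $X_0$, and for all $f\in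 X_0$ $$\mathrm{Airy}(AirySolver(f))=f+AiryErr(f)\ \text{ on }[0,1],\quad \|AirySolver(f)\|_{X_0}\le C\|f\|_{X_0},\quad \|AiryErr(f)\|_{X_0}\le C|\delta|^2\|f\|_{X_0}.$$ 2. For every $f\in X_0$ the series $$AirySolver_\infty(f)=\sum_{n\ge0}AirySolver\big((-AiryErr)^n f\big)$$ converges in $X_0$ and defines a bounded linear operator from $X_0$ to $X_0$, which is an exact solver: $$\mathrm{Airy}(AirySolver_\infty(f))=f\ \text{ on }[0,1],\qquad \|AirySolver_\infty(f)\|_{X_0}\le C\|f\|_{X_0}.$$ Here $AirySolver(f)$ and $AirySolver_\infty(f)$ are four times continuously differentiable on $[0,1]$ and the equations hold at every point of $[0,1]$. -/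

import Mathlib

noncomputable section

namespace OrrSommerfeld

open Complex Set

/-- The Airy function `Ai` on `ℂ`: the contour integral
`(2πi)⁻¹ ∫ exp (t³/3 - z t) dt` from `∞ e^{-iπ/3}` to `∞ e^{iπ/3}`, taken along the two rays
`t = s e^{∓iπ/3}`, `s > 0` (on which `t³ = -s³`). -/
def Ai (z : ℂ) : ℂ :=
  (2 * (Real.pi : ℂ) * I)⁻¹ * ∫ s in Ioi (0 : ℝ), exp (-((s : ℂ) ^ 3) / 3) *
    (exp (Real.pi * I / 3) * exp (-(exp (Real.pi * I / 3) * s * z)) -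
      exp (-(Real.pi * I / 3)) * exp (-(exp (-(Real.pi * I / 3)) * s * z)))

/-- The second Airy solution `Ci (z) = 2π e^{iπ/6} Ai (e^{2πi/3} z) = iπ (Ai - i Bi) (z)`: the
solution of `φ'' = z φ` with `Ai Ci' - Ai' Ci = 1` for which `Ci (e^{iπ/6} x) → 0`
as `x → -∞`. -/
def Ci (z : ℂ) : ℂ :=
  2 * (Real.pi : ℂ) * exp (Real.pi * I / 6) * Ai (exp (2 * Real.pi * I / 3) * z)

/-- `X₀`: continuous complex functions on `[0,1]` with the norm `sup |f|`. -/
abbrev X0 := C(Icc (0 : ℝ) 1, ℂ)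

/-- An element of `X₀` as a function on `ℝ`; only its values on `[0,1]` are ever used. -/
def X0.toFun (f : X0) : ℝ → ℂ := IccExtend zero_le_one f

/-- The data of the problem: the (complexified) profile `U`, the wave number `α`, the Reynolds
number `R` and the complex critical point `z_c`. The wave speed is `c = U (z_c)`. -/
structure Data where
  U : ℂ → ℂ
  α : ℝ
  R : ℝ
  zc : ℂ

namespace Data

variable (P : Data)

/-- `c = U (z_c)`. -/
def c : ℂ := P.U P.zc

/-- `ε = 1 / (i α R)`. -/
def eps : ℂ := 1 / (I * P.α * P.R)

/-- `U_c' = U' (z_c)`. -/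
def dUc : ℂ := deriv P.U P.zc

/-- The critical layer size `δ = (ε / U_c')^{1/3} = e^{-iπ/6} (α R U_c')^{-1/3}`. -/
def delta : ℂ := exp (-(Real.pi * I / 6)) * ((P.α : ℂ) * P.R * P.dUc) ^ (-(1 / 3) : ℂ)

/-- The modified Airy operator `ε ∂⁴φ - (U - c + 2 ε α²) ∂²φ` at a point of `[0,1]`
(one-sided derivatives at the end points). -/
def airyOp (φ : ℝ → ℂ) (z : ℝ) : ℂ :=
  P.eps * iteratedDerivWithin 4 φ (Icc 0 1) z -
    (P.U z - P.c + 2 * P.eps * (P.α : ℂ) ^ 2) * iteratedDerivWithin 2 φ (Icc 0 1) z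

/-- `φ` is a classical solution of `Airy (φ) = g` on `[0,1]`. -/
def AirySolves (φ g : X0) : Prop :=
  ContDiffOn ℝ 4 φ.toFun (Icc 0 1) ∧ ∀ z : Icc (0 : ℝ) 1, P.airyOp φ.toFun z = g z

/-- The quotient `(U (w) - c) / (U_c' (w - z_c))`, with the value `1` at `w = z_c`. -/
def quot (w : ℂ) : ℂ := dslope P.U P.zc w / P.dUc

/-- Langer's variable `η (z) = [3/2 ∫_{z_c}^z ((U - c) / U_c')^{1/2}]^{2/3}`, the branch with
`η (z) ∼ z - z_c` at `z_c`. The path is the segment `w = z_c + s (z - z_c)`, and the factors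
`(z - z_c)^{3/2}`, `z - z_c` are taken out of the integral and of the outer power, so that the
remaining powers are principal ones of quantities close to the positive real axis. -/
def eta (z : ℂ) : ℂ :=
  (z - P.zc) * (3 / 2 * ∫ s in (0 : ℝ)..1,
    (Real.sqrt s : ℂ) * P.quot (P.zc + s * (z - P.zc)) ^ (1 / 2 : ℂ)) ^ (2 / 3 : ℂ)

/-- `ż^{1/2}`, where `ż = 1 / η' (z)`. -/
def sqrtDot (z : ℂ) : ℂ := (1 / deriv P.eta z) ^ (1 / 2 : ℂ)

/-- `Ai (δ⁻¹ η (z))`. -/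
def AiL (z : ℝ) : ℂ := Ai (P.eta z / P.delta)

/-- `Ci (δ⁻¹ η (z))`. -/
def CiL (z : ℝ) : ℂ := Ci (P.eta z / P.delta)

/-- First primitive of `ż^{1/2} Ai (δ⁻¹ η)` (scaled by `δ⁻¹`), vanishing at `z = 1`. -/
def Ai1 (z : ℝ) : ℂ := P.delta⁻¹ * ∫ y in (1 : ℝ)..z, P.sqrtDot y * P.AiL y

/-- Second primitive of `ż^{1/2} Ai (δ⁻¹ η)`. -/
def Ai2 (z : ℝ) : ℂ := P.delta⁻¹ * ∫ y in (1 : ℝ)..z, P.Ai1 y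

/-- First primitive of `ż^{1/2} Ci (δ⁻¹ η)` (scaled by `δ⁻¹`), vanishing at `z = 0`. -/
def Ci1 (z : ℝ) : ℂ := P.delta⁻¹ * ∫ y in (0 : ℝ)..z, P.sqrtDot y * P.CiL y

/-- Second primitive of `ż^{1/2} Ci (δ⁻¹ η)`. -/
def Ci2 (z : ℝ) : ℂ := P.delta⁻¹ * ∫ y in (0 : ℝ)..z, P.Ci1 y

/-- The coefficient `a₁`, which makes `∂_z G` continuous across `z = x`. -/
def a1 (x : ℝ) : ℂ := P.CiL x * P.Ai1 x - P.AiL x * P.Ci1 x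

/-- The coefficient `a₂`, which makes `G` continuous across `z = x`. -/
def a2 (x : ℝ) : ℂ := P.AiL x * P.Ci2 x - P.CiL x * P.Ai2 x

/-- The approximate Green function `G (x, z)`. Its normalization `-δ³ ε⁻¹ ẋ^{1/2}` is the one for
which `ε ∂_z³ G` has jump `1` across `z = x`, while `G`, `∂_z G`, `∂_z² G` are continuous. -/
def G (x z : ℝ) : ℂ :=
  -(P.delta ^ 3 / P.eps) * P.sqrtDot x *
    (if z < x then P.AiL x * P.Ci2 z + P.a1 x * ((z - P.zc) / P.delta)
      else P.CiL x * P.Ai2 z + P.a2 x + P.a1 x * ((x - P.zc) / P.delta))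

/-- The second derivative `∂_z² G (x, z)`. -/
def ddG (x z : ℝ) : ℂ :=
  -(P.delta / P.eps) * P.sqrtDot x * P.sqrtDot z *
    (if z < x then P.AiL x * P.CiL z else P.CiL x * P.AiL z)

/-- The error kernel `Err_A = ε ((∂_z² ż^{1/2}) ż^{-1/2} - 2 α²) ∂_z² G`. -/
def errA (x z : ℝ) : ℂ :=
  P.eps * (iteratedDeriv 2 P.sqrtDot z / P.sqrtDot z - 2 * (P.α : ℂ) ^ 2) * P.ddG x z

/-- `AirySolver (f) (z) = ∫₀¹ G (x, z) f (x) dx`. -/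
def airySolver (f : X0) (z : ℝ) : ℂ := ∫ x in (0 : ℝ)..1, P.G x z * f.toFun x

/-- `AiryErr (f) (z) = ∫₀¹ Err_A (x, z) f (x) dx`. -/
def airyErr (f : X0) (z : ℝ) : ℂ := ∫ x in (0 : ℝ)..1, P.errA x z * f.toFun x

end Data

end OrrSommerfeld

end

/-! The Green function `G` is built from `u = ż^{1/2} Ai (δ⁻¹ η)` and `v = ż^{1/2} Ci (δ⁻¹ η)`.
By Langer's transformation `u` and `v` solve `w'' = ((U - c) / ε + h) w` with
`h = (ż^{1/2})'' / ż^{1/2}` (`Regular.hasDerivAt_dLift`), and their Wronskian is `1 / δ`. Hence the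
second derivative of `AirySolver (f)`, which is a combination of `v ∫_z^1 u f` and `u ∫_0^z v f`,
satisfies the Airy equation with right hand side `f` up to the terms with `h` and `α²`; these are
`AiryErr (f)` (`Regular.airySolves`). As `h` is bounded by Cauchy's estimate, the error is small.

The substance lies in the bounds of the two operators. They rest on the saddle point bound
`|Ai (p²)| ≤ exp (-2/3 Re p³) / (Re p)^{1/2}`, `Re p > 0` (`norm_Ai_sq_le`), obtained by moving the
contour of `Ai` to the vertical line through the saddle `p`. For a regular profile all quotients
such as `(U - c) / (U_c' (w - z_c))` and `η (w) / (w - z_c)` have arguments close to zero, so that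
away from a core of size `O(|δ|)` around `Re z_c` the branches of the fractional powers are under
control, and `Ai (δ⁻¹ η)`, `Ci (δ⁻¹ η)` are bounded by `D^{-1/4} e^{∓Φ}`. Here `D` is the bracket
`(1 + |x - z_c|² / |δ|²)^{1/2}` and `Φ` a primitive of the real part of `((U - c) / ε)^{1/2}`. When
`Im z_c < 0` the branch cut meets the core, but `Im z_c ≥ -M |δ|` makes everything there `O(1)`. A
bounded correction of `Φ` gives `Φ' ≥ (c D^{1/2} + 2 / D) / |δ|` (`exists_weight`), and then each
integration of `D^{-κ} e^{±Φ}` gains `|δ| D^{-1/2}` by a differential inequality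
(`Weight.norm_integral_growing_le`, `Weight.norm_integral_decaying_le`).

These bounds show that the exponentials cancel in `G`, and that `a₁ = O(1 / D)`. So `G` is bounded
except for the term `a₁ (x) (z - z_c) / δ`, of size `1 + |z_c| / (|δ| D (x))`
(`Regular.norm_G_le`). Its integral in `x` is of order `1 + |z_c| log (1 / (|δ| + dist))`, which is
what the logarithmic condition on `z_c` bounds. The same bounds give `|δ|²` for the error operator.
For small `δ` its norm is at most `1/2`, and a Neumann series yields the exact solver
(`exists_hasSum_neumann`). -/

noncomputable section

namespace OrrSommerfeld

open Complex Set MeasureTheory Filter Topology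

/-! ### The Airy equation and the Wronskian -/

lemma integrable_exp_linear_sub_sq (A : ℝ) {c : ℝ} (hc : 0 < c) :
    Integrable (fun s : ℝ => Real.exp (A * s - c * s ^ 2)) := by
  have h := (integrable_cexp_quadratic (b := (c : ℂ)) (by simpa using hc) (A : ℂ) 0).norm
  refine h.congr (Eventually.of_forall fun s => ?_)
  simp only [norm_exp]
  congr 1
  have : (-(c : ℂ) * (s : ℂ) ^ 2 + A * s + 0) = ((A * s - c * s ^ 2 : ℝ) : ℂ) := by
    push_cast; ring
  rw [this, ofReal_re]

/-- The moments `∫₀^∞ sᵏ e^{-s³/3 - ω s z} ds` of the exponential kernel along the ray of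
direction `ω`; `Ai` is a combination of two of them. -/
def rayMoment (k : ℕ) (ω z : ℂ) : ℂ :=
  ∫ s in Ioi (0 : ℝ), (s : ℂ) ^ k * exp (-((s : ℂ) ^ 3) / 3 - ω * s * z)

lemma norm_rayMoment_kernel_le (k : ℕ) {ω z : ℂ} (hω : ‖ω‖ ≤ 1) {B : ℝ} (hz : ‖z‖ ≤ B) {s : ℝ}
    (hs : 0 < s) : ‖(s : ℂ) ^ k * exp (-((s : ℂ) ^ 3) / 3 - ω * s * z)‖ ≤
      k.factorial * Real.exp (1 / 3) * Real.exp ((B + 1) * s - 1 / 3 * s ^ 2) := by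
  rw [norm_mul, norm_pow, norm_exp, norm_real, Real.norm_of_nonneg hs.le]
  have h1 : s ^ k ≤ k.factorial * Real.exp s := by
    have := Real.pow_div_factorial_le_exp s hs.le k
    rw [div_le_iff₀ (by positivity)] at this
    linarith
  have h2 : (-((s : ℂ) ^ 3) / 3 - ω * s * z).re ≤ 1 / 3 + (B * s - 1 / 3 * s ^ 2) := by
    have e1 : (-((s : ℂ) ^ 3) / 3).re = - s ^ 3 / 3 := by
      rw [show (-((s : ℂ) ^ 3) / 3) = ((- s ^ 3 / 3 : ℝ) : ℂ) by push_cast; ring, ofReal_re]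
    have e2 : -(ω * s * z).re ≤ B * s := by
      refine (neg_le_abs _).trans ((abs_re_le_norm _).trans ?_)
      rw [norm_mul, norm_mul, norm_real, Real.norm_of_nonneg hs.le]
      have hB : 0 ≤ ‖z‖ := norm_nonneg z
      calc ‖ω‖ * s * ‖z‖ ≤ 1 * s * B := by gcongr
        _ = B * s := by ring
    have e3 : s ^ 2 - 1 ≤ s ^ 3 := by
      nlinarith [mul_nonneg hs.le (sq_nonneg (s - 1)), sq_nonneg (s - 1), sq_nonneg s]
    rw [sub_re, e1]
    linarith
  calc s ^ k * Real.exp (-((s : ℂ) ^ 3) / 3 - ω * s * z).re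
      ≤ (k.factorial * Real.exp s) * Real.exp (1 / 3 + (B * s - 1 / 3 * s ^ 2)) := by gcongr
    _ = _ := by
      rw [mul_assoc, mul_assoc, ← Real.exp_add, ← Real.exp_add]
      ring_nf

lemma integrableOn_rayMoment_kernel (k : ℕ) {ω : ℂ} (hω : ‖ω‖ ≤ 1) (z : ℂ) :
    IntegrableOn (fun s : ℝ => (s : ℂ) ^ k * exp (-((s : ℂ) ^ 3) / 3 - ω * s * z)) (Ioi 0) := by
  refine Integrable.mono' (((integrable_exp_linear_sub_sq (‖z‖ + 1)
    (by norm_num : (0 : ℝ) < 1 / 3)).const_mul (k.factorial * Real.exp (1 / 3))).integrableOn)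
    (by fun_prop) ?_
  filter_upwards [ae_restrict_mem measurableSet_Ioi] with s hs
  exact norm_rayMoment_kernel_le k hω le_rfl hs

lemma hasDerivAt_rayMoment (k : ℕ) {ω : ℂ} (hω : ‖ω‖ ≤ 1) (z : ℂ) :
    HasDerivAt (rayMoment k ω) (-ω * rayMoment (k + 1) ω z) z := by
  have key := (hasDerivAt_integral_of_dominated_loc_of_deriv_le
    (μ := volume.restrict (Ioi (0 : ℝ))) (s := Metric.ball z 1) (x₀ := z)
    (F := fun z (s : ℝ) => (s : ℂ) ^ k * exp (-((s : ℂ) ^ 3) / 3 - ω * s * z))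
    (F' := fun z (s : ℝ) => -ω * ((s : ℂ) ^ (k + 1) * exp (-((s : ℂ) ^ 3) / 3 - ω * s * z)))
    (bound := fun s => ((k + 1).factorial * Real.exp (1 / 3)) *
      Real.exp ((‖z‖ + 1 + 1) * s - 1 / 3 * s ^ 2))
    (Metric.ball_mem_nhds z one_pos)
    (Eventually.of_forall fun w => (integrableOn_rayMoment_kernel k hω w).aestronglyMeasurable)
    (integrableOn_rayMoment_kernel k hω z) ?_ ?_ ?_ ?_).2
  · refine key.congr_deriv ?_
    rw [rayMoment, ← integral_const_mul]
  · exact (by fun_prop : Continuous _).aestronglyMeasurable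
  · filter_upwards [ae_restrict_mem measurableSet_Ioi] with s hs w hw
    have hw' : ‖w‖ ≤ ‖z‖ + 1 := by
      have := norm_le_norm_add_norm_sub' w z
      rw [Metric.mem_ball, dist_eq_norm] at hw
      linarith
    rw [norm_mul, norm_neg]
    calc ‖ω‖ * _ ≤ 1 * _ := by gcongr
      _ ≤ _ := by rw [one_mul]; exact norm_rayMoment_kernel_le (k + 1) hω hw' hs
  · exact ((integrable_exp_linear_sub_sq _ (by norm_num : (0 : ℝ) < 1 / 3)).const_mul _).integrableOn
  · filter_upwards with s w _
    have h1 : HasDerivAt (fun w : ℂ => -((s : ℂ) ^ 3) / 3 - ω * s * w) (-(ω * s)) w := by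
      simpa using ((hasDerivAt_id w).const_mul (ω * (s : ℂ))).const_sub (-((s : ℂ) ^ 3) / 3)
    refine (h1.cexp.const_mul ((s : ℂ) ^ k)).congr_deriv ?_
    ring

/-- Integration of the total derivative of the kernel along the ray. -/
lemma rayMoment_two {ω : ℂ} (hω : ‖ω‖ ≤ 1) (z : ℂ) :
    rayMoment 2 ω z + ω * z * rayMoment 0 ω z = 1 := by
  have hd : ∀ s ∈ Ici (0 : ℝ), HasDerivAt (fun s : ℝ => -exp (-((s : ℂ) ^ 3) / 3 - ω * s * z))
      ((s : ℂ) ^ 2 * exp (-((s : ℂ) ^ 3) / 3 - ω * s * z) +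
        ω * z * ((s : ℂ) ^ 0 * exp (-((s : ℂ) ^ 3) / 3 - ω * s * z))) s := by
    intro s _
    have h0 : HasDerivAt (fun s : ℂ => -(s ^ 3) / 3 - ω * s * z) (-(s : ℂ) ^ 2 - ω * z) (s : ℂ) := by
      have h1 := (((hasDerivAt_id (s : ℂ)).pow 3).neg.div_const 3).sub
        (((hasDerivAt_id (s : ℂ)).const_mul ω).mul_const z)
      refine (h1.congr_deriv ?_)
      simp; ring
    refine (h0.cexp.neg.comp_ofReal).congr_deriv ?_
    ring
  have hi0 := integrableOn_rayMoment_kernel 0 hω z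
  have hi2 := integrableOn_rayMoment_kernel 2 hω z
  have ht : Tendsto (fun s : ℝ => -exp (-((s : ℂ) ^ 3) / 3 - ω * s * z)) atTop (𝓝 0) := by
    rw [← neg_zero]
    refine Tendsto.neg (squeeze_zero_norm' (a := fun s : ℝ => Real.exp (1 / 3) *
      Real.exp (((‖z‖ + 2) ^ 2 * 3) - s)) ?_ ?_)
    · filter_upwards [eventually_gt_atTop 0] with s hs
      have h := norm_rayMoment_kernel_le 0 hω le_rfl hs (z := z)
      simp only [pow_zero, one_mul, Nat.factorial_zero, Nat.cast_one] at h
      refine h.trans ?_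
      refine mul_le_mul_of_nonneg_left (Real.exp_le_exp.2 ?_) (Real.exp_pos _).le
      nlinarith [sq_nonneg (s - 3 / 2 * (‖z‖ + 2)), sq_nonneg (‖z‖), norm_nonneg z]
    · rw [← mul_zero (Real.exp (1 / 3))]
      refine Tendsto.const_mul _ (Real.tendsto_exp_atBot.comp ?_)
      exact tendsto_atBot_add_const_left _ _ tendsto_neg_atTop_atBot
  have h := integral_Ioi_of_hasDerivAt_of_tendsto' hd (hi2.add (hi0.const_mul (ω * z))) ht
  rw [integral_add hi2 (hi0.const_mul _), integral_const_mul] at h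
  simpa [rayMoment] using h

/-- The direction `e^{iπ/3}` of the upper half of the contour of `Ai`. -/
def airyDir : ℂ := exp (Real.pi * I / 3)

/-- The direction `e^{-iπ/3}` of the lower half of the contour of `Ai`. -/
def airyDir' : ℂ := exp (-(Real.pi * I / 3))

lemma airyDir_eq : airyDir = 1 / 2 + Real.sqrt 3 / 2 * I := by
  rw [airyDir, show (Real.pi * I / 3 : ℂ) = ((Real.pi / 3 : ℝ) : ℂ) * I by push_cast; ring,
    exp_mul_I, ← ofReal_cos, ← ofReal_sin, Real.cos_pi_div_three, Real.sin_pi_div_three]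
  push_cast; ring

lemma airyDir'_eq : airyDir' = 1 / 2 - Real.sqrt 3 / 2 * I := by
  rw [airyDir', show (-(Real.pi * I / 3) : ℂ) = ((-(Real.pi / 3) : ℝ) : ℂ) * I by push_cast; ring,
    exp_mul_I, ← ofReal_cos, ← ofReal_sin, Real.cos_neg, Real.sin_neg, Real.cos_pi_div_three,
    Real.sin_pi_div_three]
  push_cast; ring

lemma sqrt_three_sq : ((Real.sqrt 3 : ℝ) : ℂ) ^ 2 = 3 := by
  rw [← ofReal_pow, Real.sq_sqrt (by norm_num)]; norm_num

lemma norm_airyDir : ‖airyDir‖ = 1 := by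
  rw [airyDir, show (Real.pi * I / 3 : ℂ) = ((Real.pi / 3 : ℝ) : ℂ) * I by push_cast; ring,
    norm_exp_ofReal_mul_I]

lemma norm_airyDir' : ‖airyDir'‖ = 1 := by
  rw [airyDir', show (-(Real.pi * I / 3) : ℂ) = ((-(Real.pi / 3) : ℝ) : ℂ) * I by push_cast; ring,
    norm_exp_ofReal_mul_I]

lemma airyDir_pow_three : airyDir ^ 3 = -1 := by
  rw [airyDir, ← exp_nat_mul, ← exp_pi_mul_I]; congr 1; push_cast; ring

lemma airyDir'_pow_three : airyDir' ^ 3 = -1 := by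
  rw [airyDir', ← exp_nat_mul, show ((3 : ℕ) : ℂ) * -(Real.pi * I / 3) = -(Real.pi * I) by
    push_cast; ring, exp_neg, exp_pi_mul_I]
  norm_num

lemma Ai_eq_rayMoment (z : ℂ) : Ai z = (2 * (Real.pi : ℂ) * I)⁻¹ *
    (airyDir * rayMoment 0 airyDir z - airyDir' * rayMoment 0 airyDir' z) := by
  rw [Ai, rayMoment, rayMoment, ← integral_const_mul airyDir, ← integral_const_mul airyDir',
    ← integral_sub]
  · congr 1
    refine integral_congr_ae (Eventually.of_forall fun s => ?_)
    change exp (-((s : ℂ) ^ 3) / 3) * (airyDir * exp (-(airyDir * s * z)) -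
      airyDir' * exp (-(airyDir' * s * z))) = _
    simp only [sub_eq_add_neg _ (airyDir * (s : ℂ) * z),
      sub_eq_add_neg _ (airyDir' * (s : ℂ) * z), exp_add]
    ring
  · exact (integrableOn_rayMoment_kernel 0 norm_airyDir.le z).const_mul _
  · exact (integrableOn_rayMoment_kernel 0 norm_airyDir'.le z).const_mul _

/-- The derivative of the Airy function. -/
def dAi (z : ℂ) : ℂ := (2 * (Real.pi : ℂ) * I)⁻¹ *
    (airyDir' ^ 2 * rayMoment 1 airyDir' z - airyDir ^ 2 * rayMoment 1 airyDir z)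

lemma hasDerivAt_Ai (z : ℂ) : HasDerivAt Ai (dAi z) z := by
  rw [funext Ai_eq_rayMoment]
  refine ((((hasDerivAt_rayMoment 0 norm_airyDir.le z).const_mul airyDir).sub
    ((hasDerivAt_rayMoment 0 norm_airyDir'.le z).const_mul airyDir')).const_mul _).congr_deriv ?_
  rw [dAi]; ring

/-- The Airy equation `Ai'' = z Ai`. -/
lemma hasDerivAt_dAi (z : ℂ) : HasDerivAt dAi (z * Ai z) z := by
  refine ((((hasDerivAt_rayMoment 1 norm_airyDir'.le z).const_mul (airyDir' ^ 2)).sub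
    ((hasDerivAt_rayMoment 1 norm_airyDir.le z).const_mul (airyDir ^ 2))).const_mul
    ((2 * (Real.pi : ℂ) * I)⁻¹)).congr_deriv ?_
  have h1 := rayMoment_two norm_airyDir.le z
  have h2 := rayMoment_two norm_airyDir'.le z
  have e1 : rayMoment (1 + 1) airyDir z = 1 - airyDir * z * rayMoment 0 airyDir z := by
    linear_combination h1
  have e2 : rayMoment (1 + 1) airyDir' z = 1 - airyDir' * z * rayMoment 0 airyDir' z := by
    linear_combination h2
  rw [e1, e2, Ai_eq_rayMoment]
  linear_combination (2 * (Real.pi : ℂ) * I)⁻¹ * (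
    (1 - airyDir * z * rayMoment 0 airyDir z) * airyDir_pow_three -
    (1 - airyDir' * z * rayMoment 0 airyDir' z) * airyDir'_pow_three)

lemma continuous_Ai : Continuous Ai :=
  continuous_iff_continuousAt.2 fun z => (hasDerivAt_Ai z).continuousAt

/-- At `z = 0` the moments are values of `Γ`, independent of the direction. -/
lemma rayMoment_at_zero (k : ℕ) (ω : ℂ) :
    rayMoment k ω 0 = ((1 / 3 : ℝ) ^ (-(k + 1 : ℝ) / 3) * (1 / 3) *
      Real.Gamma ((k + 1 : ℝ) / 3) : ℝ) := by
  have h := _root_.integral_rpow_mul_exp_neg_mul_rpow (p := 3) (q := k) (b := 1 / 3) (by norm_num)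
    (by have : (0 : ℝ) ≤ k := k.cast_nonneg
        linarith) (by norm_num)
  rw [← h, rayMoment, ← integral_complex_ofReal]
  refine setIntegral_congr_fun measurableSet_Ioi fun s hs => ?_
  simp only [mul_zero, sub_zero]
  push_cast [ofReal_exp]
  rw [show ((s ^ (k : ℝ) : ℝ) : ℂ) = (s : ℂ) ^ k by rw [Real.rpow_natCast, ofReal_pow],
    show ((s ^ (3 : ℝ) : ℝ) : ℂ) = (s : ℂ) ^ 3 by
      rw [show (3 : ℝ) = ((3 : ℕ) : ℝ) by norm_num, Real.rpow_natCast, ofReal_pow]]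
  congr 2
  ring

/-- Euler's reflection formula for `Γ (1/3) Γ (2/3)`. -/
lemma rayMoment_zero_mul_one (ω : ℂ) :
    rayMoment 0 ω 0 * rayMoment 1 ω 0 = 2 * Real.pi / (3 * Real.sqrt 3) := by
  rw [rayMoment_at_zero, rayMoment_at_zero, ← ofReal_mul]
  have hG := Real.Gamma_mul_Gamma_one_sub (1 / 3)
  rw [show Real.pi * (1 / 3) = Real.pi / 3 by ring, Real.sin_pi_div_three] at hG
  have hp : (1 / 3 : ℝ) ^ (-((0 : ℕ) + 1 : ℝ) / 3) * (1 / 3 : ℝ) ^ (-((1 : ℕ) + 1 : ℝ) / 3) = 3 := by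
    rw [← Real.rpow_add (by norm_num)]
    norm_num [Real.rpow_neg_one]
  have e : (1 / 3 : ℝ) ^ (-((0 : ℕ) + 1 : ℝ) / 3) * (1 / 3) * Real.Gamma (((0 : ℕ) + 1 : ℝ) / 3) *
      ((1 / 3 : ℝ) ^ (-((1 : ℕ) + 1 : ℝ) / 3) * (1 / 3) * Real.Gamma (((1 : ℕ) + 1 : ℝ) / 3)) =
      2 * Real.pi / (3 * Real.sqrt 3) := by
    have : Real.Gamma (((0 : ℕ) + 1 : ℝ) / 3) * Real.Gamma (((1 : ℕ) + 1 : ℝ) / 3) =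
        Real.pi / (Real.sqrt 3 / 2) := by
      rw [← hG]; norm_num
    calc _ = ((1 / 3 : ℝ) ^ (-((0 : ℕ) + 1 : ℝ) / 3) * (1 / 3 : ℝ) ^ (-((1 : ℕ) + 1 : ℝ) / 3)) *
          (1 / 9) * (Real.Gamma (((0 : ℕ) + 1 : ℝ) / 3) * Real.Gamma (((1 : ℕ) + 1 : ℝ) / 3)) := by
          ring
      _ = _ := by
        rw [hp, this]
        have : Real.sqrt 3 ≠ 0 := by positivity
        field_simp
        norm_num
  rw [e]; push_cast; ring

/-- The derivative of `Ci`. -/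
def dCi (z : ℂ) : ℂ := 2 * (Real.pi : ℂ) * exp (Real.pi * I / 6) *
  (exp (2 * Real.pi * I / 3) * dAi (exp (2 * Real.pi * I / 3) * z))

lemma hasDerivAt_Ci (z : ℂ) : HasDerivAt Ci (dCi z) z := by
  have h := ((hasDerivAt_Ai (exp (2 * Real.pi * I / 3) * z)).comp z
    ((hasDerivAt_id z).const_mul (exp (2 * Real.pi * I / 3)))).const_mul
      (2 * (Real.pi : ℂ) * exp (Real.pi * I / 6))
  refine h.congr_deriv ?_
  rw [dCi]; simp; ring

lemma exp_two_pi_div_three_pow : exp (2 * Real.pi * I / 3) ^ 3 = 1 := by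
  rw [← exp_nat_mul, ← exp_two_pi_mul_I]; congr 1; push_cast; ring

lemma hasDerivAt_dCi (z : ℂ) : HasDerivAt dCi (z * Ci z) z := by
  have h := (((hasDerivAt_dAi (exp (2 * Real.pi * I / 3) * z)).comp z
    ((hasDerivAt_id z).const_mul (exp (2 * Real.pi * I / 3)))).const_mul
      (exp (2 * Real.pi * I / 3))).const_mul (2 * (Real.pi : ℂ) * exp (Real.pi * I / 6))
  refine h.congr_deriv ?_
  rw [Ci, mul_one]
  linear_combination (2 * (Real.pi : ℂ) * exp (Real.pi * I / 6)) * z *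
    Ai (exp (2 * Real.pi * I / 3) * z) * exp_two_pi_div_three_pow

lemma continuous_Ci : Continuous Ci :=
  continuous_iff_continuousAt.2 fun z => (hasDerivAt_Ci z).continuousAt

/-- The Wronskian of `Ai` and `Ci` at the origin, computed from Euler's reflection formula. -/
lemma wronskian_at_zero : Ai 0 * dCi 0 - dAi 0 * Ci 0 = 1 := by
  have hindep : ∀ k, rayMoment k airyDir' 0 = rayMoment k airyDir 0 := fun k => by
    simp [rayMoment]
  have hA : Ai 0 = (2 * (Real.pi : ℂ) * I)⁻¹ * (Real.sqrt 3 * I) * rayMoment 0 airyDir 0 := by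
    rw [Ai_eq_rayMoment, hindep, airyDir_eq, airyDir'_eq]; ring
  have hdA : dAi 0 = -((2 * (Real.pi : ℂ) * I)⁻¹ * (Real.sqrt 3 * I) * rayMoment 1 airyDir 0) := by
    rw [dAi, hindep, airyDir_eq, airyDir'_eq]; ring
  have hm := rayMoment_zero_mul_one airyDir
  have hphase : exp (Real.pi * I / 6) * (exp (2 * Real.pi * I / 3) - 1) = -Real.sqrt 3 := by
    have h1 : exp (2 * Real.pi * I / 3) = airyDir ^ 2 := by
      rw [airyDir, ← exp_nat_mul]; congr 1; push_cast; ring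
    have h2 : exp (Real.pi * I / 6) = Real.sqrt 3 / 2 + 1 / 2 * I := by
      rw [show (Real.pi * I / 6 : ℂ) = ((Real.pi / 6 : ℝ) : ℂ) * I by push_cast; ring,
        exp_mul_I, ← ofReal_cos, ← ofReal_sin, Real.cos_pi_div_six, Real.sin_pi_div_six]
      push_cast; ring
    rw [h1, h2, airyDir_eq]
    have hI : I ^ 2 = -1 := I_sq
    linear_combination (1 / 8 * I ^ 3 + 1 / 8 * Real.sqrt 3 * I ^ 2 + 1 / 4 * I) * sqrt_three_sq
      + (3 / 8 * I + 5 / 8 * Real.sqrt 3) * hI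
  have h3 : ((Real.sqrt 3 : ℝ) : ℂ) ≠ 0 := by
    intro h; have := sqrt_three_sq; rw [h] at this; norm_num at this
  have hpi : (Real.pi : ℂ) ≠ 0 := by exact_mod_cast Real.pi_ne_zero
  calc Ai 0 * dCi 0 - dAi 0 * Ci 0
      = 2 * Real.pi * (exp (Real.pi * I / 6) * (exp (2 * Real.pi * I / 3) - 1)) *
          (Ai 0 * dAi 0) := by
        rw [dCi, Ci, mul_zero]; ring
    _ = 2 * Real.pi * Real.sqrt 3 * ((2 * (Real.pi : ℂ) * I)⁻¹ * (Real.sqrt 3 * I)) ^ 2 *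
          (rayMoment 0 airyDir 0 * rayMoment 1 airyDir 0) := by
        rw [hphase, hA, hdA]; ring
    _ = 1 := by
        rw [hm]
        field_simp
        linear_combination sqrt_three_sq

lemma wronskian_eq_one (z : ℂ) : Ai z * dCi z - dAi z * Ci z = 1 := by
  have hd : ∀ w, HasDerivAt (fun z => Ai z * dCi z - dAi z * Ci z) 0 w := fun w => by
    refine (((hasDerivAt_Ai w).mul (hasDerivAt_dCi w)).sub
      ((hasDerivAt_dAi w).mul (hasDerivAt_Ci w))).congr_deriv ?_
    ring
  have := is_const_of_deriv_eq_zero (fun w => (hd w).differentiableAt) (fun w => (hd w).deriv) z 0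
  rw [← wronskian_at_zero]
  exact this

/-! ### The saddle point bound for the Airy function -/

/-- The interpolated direction `(1 - τ) v₀ + τ v₁`. -/
def interpDir (v₀ v₁ : ℂ) (τ : ℝ) : ℂ := (1 - τ) * v₀ + τ * v₁

/-- The point `τ a + s ((1 - τ) v₀ + τ v₁)` of the ray which moves, for `τ` from `0` to `1`, from
the ray of direction `v₀` from the origin to the ray of direction `v₁` from `a`. -/
def contourPt (a : ℝ) (v₀ v₁ : ℂ) (τ s : ℝ) : ℂ := τ * a + s * interpDir v₀ v₁ τ

/-- Directions `v₀`, `v₁` for which `exp (t³/3 - z t)` decays along all interpolated rays,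
because of the cubic term for `τ < 1` and because of the quadratic one for `τ > 0`. -/
structure DecayingDirs (v₀ v₁ : ℂ) : Prop where
  norm_le : ∀ τ ∈ Icc (0 : ℝ) 1, ‖interpDir v₀ v₁ τ‖ ≤ 1
  sq_re_le : ∀ τ ∈ Icc (0 : ℝ) 1, (interpDir v₀ v₁ τ ^ 2).re ≤ -1 / 2
  cube_re_le : ∀ τ ∈ Icc (0 : ℝ) 1, (interpDir v₀ v₁ τ ^ 3).re ≤ -(1 - τ) / 4

lemma decayingDirs_of_re_im {v₀ v₁ : ℂ} (σ : ℝ) (hσ : σ ^ 2 = 1)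
    (h₀ : v₀ = 1 / 2 + (σ * Real.sqrt 3 / 2 : ℝ) * I) (h₁ : v₁ = (σ : ℝ) * I) :
    DecayingDirs v₀ v₁ := by
  have h3 : Real.sqrt 3 ^ 2 = 3 := Real.sq_sqrt (by norm_num)
  have h3' : 1 ≤ Real.sqrt 3 := by
    rw [Real.one_le_sqrt]; norm_num
  have h3'' : Real.sqrt 3 ≤ 2 := by
    rw [Real.sqrt_le_left (by norm_num)]; norm_num
  have hv : ∀ τ : ℝ, interpDir v₀ v₁ τ =
      ⟨(1 - τ) / 2, σ * ((1 - τ) * Real.sqrt 3 / 2 + τ)⟩ := by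
    intro τ
    apply Complex.ext
    · simp [interpDir, h₀, h₁]; ring
    · simp [interpDir, h₀, h₁]; ring
  have key : ∀ τ ∈ Icc (0 : ℝ) 1,
      ((1 - τ) / 2) ^ 2 + 1 / 2 ≤ ((1 - τ) * Real.sqrt 3 / 2 + τ) ^ 2 := by
    intro τ hτ
    have : 0 ≤ τ * (1 - τ) := mul_nonneg hτ.1 (by linarith [hτ.2])
    nlinarith [mul_le_mul_of_nonneg_left h3' this, sq_nonneg τ]
  refine ⟨fun τ hτ => ?_, fun τ hτ => ?_, fun τ hτ => ?_⟩
  · rw [hv, ← sq_le_one_iff₀ (norm_nonneg _), ← normSq_eq_norm_sq, normSq_mk]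
    have : 0 ≤ τ * (1 - τ) := mul_nonneg hτ.1 (by linarith [hτ.2])
    have e : (1 - τ) / 2 * ((1 - τ) / 2) + σ * ((1 - τ) * Real.sqrt 3 / 2 + τ) *
        (σ * ((1 - τ) * Real.sqrt 3 / 2 + τ)) = 1 - τ * (1 - τ) * (2 - Real.sqrt 3) := by
      linear_combination ((1 - τ) * Real.sqrt 3 / 2 + τ) ^ 2 * hσ + (1 - τ) ^ 2 / 4 * h3
    rw [e]
    nlinarith [mul_le_mul_of_nonneg_left h3'' this]
  · rw [hv]
    have := key τ hτ
    simp only [sq, mul_re]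
    nlinarith
  · rw [hv]
    have h := key τ hτ
    have ht : 0 ≤ 1 - τ := by linarith [hτ.2]
    set y := (1 - τ) * Real.sqrt 3 / 2 + τ
    set x := (1 - τ) / 2
    have e : ((⟨x, σ * y⟩ : ℂ) ^ 3).re = x * (x ^ 2 - 3 * y ^ 2) := by
      simp [pow_succ]
      linear_combination (-3 * x * y ^ 2) * hσ
    rw [e]
    have hx : 0 ≤ x := by positivity
    have hx4 : -(1 - τ) / 4 = -x / 2 := by ring
    rw [hx4]
    nlinarith [mul_le_mul_of_nonneg_left h hx, mul_nonneg hx (sq_nonneg x)]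

lemma decayingDirs_upper : DecayingDirs airyDir I := by
  refine decayingDirs_of_re_im 1 (by norm_num) ?_ (by simp)
  rw [airyDir_eq]; push_cast; ring

lemma decayingDirs_lower : DecayingDirs airyDir' (-I) := by
  refine decayingDirs_of_re_im (-1) (by norm_num) ?_ (by simp)
  rw [airyDir'_eq]; push_cast; ring

section Contour

variable {v₀ v₁ : ℂ} {a : ℝ}

lemma norm_contourPt_le (hv : DecayingDirs v₀ v₁) (ha : 0 < a) {τ s : ℝ} (hτ : τ ∈ Icc (0 : ℝ) 1)
    (hs : 0 ≤ s) : ‖contourPt a v₀ v₁ τ s‖ ≤ a + s := by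
  rw [contourPt]
  refine (norm_add_le _ _).trans ?_
  rw [norm_mul, norm_mul, norm_real, norm_real, norm_real, Real.norm_of_nonneg hτ.1,
    Real.norm_of_nonneg ha.le, Real.norm_of_nonneg hs]
  have := hv.norm_le τ hτ
  nlinarith [hτ.2, hτ.1]

/-- Gaussian decay of `exp (t³/3 - z t)` along the moving ray, uniformly in `τ`. -/
lemma norm_exp_contourPt_le (hv : DecayingDirs v₀ v₁) (ha : 0 < a) (z : ℂ) {τ s : ℝ}
    (hτ : τ ∈ Icc (0 : ℝ) 1) (hs : 0 ≤ s) :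
    ‖exp (contourPt a v₀ v₁ τ s ^ 3 / 3 - z * contourPt a v₀ v₁ τ s)‖ ≤
      Real.exp (a ^ 3 / 3 + ‖z‖ * a + 1) *
        Real.exp ((a ^ 2 + ‖z‖) * s - min (a / 2) (1 / 12) * s ^ 2) := by
  rw [norm_exp, ← Real.exp_add]
  refine Real.exp_le_exp.2 ?_
  set v := interpDir v₀ v₁ τ with hvdef
  have h1 : (contourPt a v₀ v₁ τ s ^ 3 / 3).re = τ ^ 3 * a ^ 3 / 3 + τ ^ 2 * a ^ 2 * s * v.re
      + τ * a * s ^ 2 * (v ^ 2).re + s ^ 3 / 3 * (v ^ 3).re := by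
    have : contourPt a v₀ v₁ τ s ^ 3 / 3 = ((τ ^ 3 * a ^ 3 / 3 : ℝ) : ℂ) +
        ((τ ^ 2 * a ^ 2 * s : ℝ) : ℂ) * v + ((τ * a * s ^ 2 : ℝ) : ℂ) * v ^ 2 +
        ((s ^ 3 / 3 : ℝ) : ℂ) * v ^ 3 := by
      rw [contourPt]; push_cast; ring
    rw [this]
    simp only [add_re, re_ofReal_mul, ofReal_re]
  have h2 : -(z * contourPt a v₀ v₁ τ s).re ≤ ‖z‖ * (a + s) := by
    refine (neg_le_abs _).trans ((abs_re_le_norm _).trans ?_)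
    rw [norm_mul]
    exact mul_le_mul_of_nonneg_left (norm_contourPt_le hv ha hτ hs) (norm_nonneg _)
  have h3 : v.re ≤ 1 := (re_le_norm v).trans (hv.norm_le τ hτ)
  have h4 : (v ^ 2).re ≤ -1 / 2 := hv.sq_re_le τ hτ
  have h5 : (v ^ 3).re ≤ -(1 - τ) / 4 := hv.cube_re_le τ hτ
  have hτ0 := hτ.1
  have hτ1 : 0 ≤ 1 - τ := by linarith [hτ.2]
  have e1 : τ ^ 3 * a ^ 3 / 3 ≤ a ^ 3 / 3 := by
    have : τ ^ 3 ≤ 1 := pow_le_one₀ hτ0 hτ.2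
    nlinarith [pow_pos ha 3]
  have e2 : τ ^ 2 * a ^ 2 * s * v.re ≤ a ^ 2 * s := by
    have h6 : τ ^ 2 * a ^ 2 * s * v.re ≤ τ ^ 2 * a ^ 2 * s * 1 :=
      mul_le_mul_of_nonneg_left h3 (by positivity)
    have h7 : τ ^ 2 * (a ^ 2 * s) ≤ 1 * (a ^ 2 * s) :=
      mul_le_mul_of_nonneg_right (pow_le_one₀ hτ0 hτ.2) (by positivity)
    linarith
  have e3 : τ * a * s ^ 2 * (v ^ 2).re ≤ τ * (-(a / 2) * s ^ 2) := by
    have := mul_le_mul_of_nonneg_left h4 (by positivity : 0 ≤ τ * a * s ^ 2)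
    linarith
  have e4 : s ^ 3 / 3 * (v ^ 3).re ≤ (1 - τ) * (-(1 / 12) * s ^ 3) := by
    have := mul_le_mul_of_nonneg_left h5 (by positivity : 0 ≤ s ^ 3 / 3)
    linarith
  have e5 : s ^ 2 - 1 ≤ s ^ 3 := by
    nlinarith [mul_nonneg hs (sq_nonneg (s - 1)), sq_nonneg (s - 1), sq_nonneg s]
  have m1 := min_le_left (a / 2) (1 / 12 : ℝ)
  have m2 := min_le_right (a / 2) (1 / 12 : ℝ)
  set c := min (a / 2) (1 / 12 : ℝ)
  have e6 : -(a / 2) * s ^ 2 ≤ -(c * s ^ 2) := by nlinarith [sq_nonneg s]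
  have e7 : -(1 / 12) * s ^ 3 ≤ -(c * s ^ 2) + 1 := by nlinarith [sq_nonneg s]
  have e8 := mul_le_mul_of_nonneg_left e6 hτ0
  have e9 := mul_le_mul_of_nonneg_left e7 hτ1
  rw [sub_re, h1]
  nlinarith

lemma contour_rate_pos (ha : 0 < a) : 0 < min (a / 2) (1 / 12 : ℝ) := by
  apply lt_min <;> positivity

/-- The integral of `exp (t³/3 - z t)` along the moving ray. -/
def contourInt (a : ℝ) (v₀ v₁ z : ℂ) (τ : ℝ) : ℂ :=
  ∫ s in Ioi (0 : ℝ), exp (contourPt a v₀ v₁ τ s ^ 3 / 3 - z * contourPt a v₀ v₁ τ s) *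
    interpDir v₀ v₁ τ

@[fun_prop]
lemma continuous_contourPt_right (τ : ℝ) : Continuous fun s => contourPt a v₀ v₁ τ s := by
  unfold contourPt; fun_prop

@[fun_prop]
lemma continuous_contourPt_left (s : ℝ) : Continuous fun τ => contourPt a v₀ v₁ τ s := by
  unfold contourPt interpDir; fun_prop

@[fun_prop]
lemma continuous_interpDir : Continuous fun τ => interpDir v₀ v₁ τ := by
  unfold interpDir; fun_prop

lemma contourInt_integrand_le (hv : DecayingDirs v₀ v₁) (ha : 0 < a) (z : ℂ) {τ s : ℝ}
    (hτ : τ ∈ Icc (0 : ℝ) 1) (hs : 0 ≤ s) :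
    ‖exp (contourPt a v₀ v₁ τ s ^ 3 / 3 - z * contourPt a v₀ v₁ τ s) * interpDir v₀ v₁ τ‖ ≤
      Real.exp (a ^ 3 / 3 + ‖z‖ * a + 1) *
        Real.exp ((a ^ 2 + ‖z‖) * s - min (a / 2) (1 / 12) * s ^ 2) := by
  rw [norm_mul, ← mul_one (Real.exp (a ^ 3 / 3 + ‖z‖ * a + 1) * _)]
  exact mul_le_mul (norm_exp_contourPt_le hv ha z hτ hs) (hv.norm_le τ hτ) (norm_nonneg _)
    (by positivity)

lemma continuousOn_contourInt (hv : DecayingDirs v₀ v₁) (ha : 0 < a) (z : ℂ) :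
    ContinuousOn (contourInt a v₀ v₁ z) (Icc 0 1) := by
  refine continuousOn_of_dominated (bound := fun s => Real.exp (a ^ 3 / 3 + ‖z‖ * a + 1) *
    Real.exp ((a ^ 2 + ‖z‖) * s - min (a / 2) (1 / 12) * s ^ 2))
    (fun τ _ => (by fun_prop : Continuous _).aestronglyMeasurable) (fun τ hτ => ?_) ?_ ?_
  · filter_upwards [ae_restrict_mem measurableSet_Ioi] with s hs
    exact contourInt_integrand_le hv ha z hτ (le_of_lt hs)
  · exact ((integrable_exp_linear_sub_sq _ (contour_rate_pos ha)).const_mul _).integrableOn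
  · exact Eventually.of_forall fun s => (by fun_prop : Continuous _).continuousOn

lemma tendsto_exp_linear_sub_sq (A : ℝ) {c : ℝ} (hc : 0 < c) :
    Tendsto (fun s : ℝ => Real.exp (A * s - c * s ^ 2)) atTop (𝓝 0) := by
  refine Real.tendsto_exp_atBot.comp ?_
  have h1 : Tendsto (fun s : ℝ => s * (c * s - A)) atTop atTop :=
    tendsto_id.atTop_mul_atTop₀ (tendsto_atTop_add_const_right _ (-A) (tendsto_id.const_mul_atTop hc))
  refine (tendsto_neg_atTop_atBot.comp h1).congr fun s => ?_
  simp; ring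

/-- The `τ`-derivative of the integral along the moving ray is a boundary term, since the
`τ`-derivative of the integrand is a total derivative in `s`. -/
lemma hasDerivAt_contourInt (hv : DecayingDirs v₀ v₁) (ha : 0 < a) (z : ℂ) {τ : ℝ}
    (hτ : τ ∈ Ioo (0 : ℝ) 1) :
    HasDerivAt (contourInt a v₀ v₁ z) (-(exp ((τ * a : ℂ) ^ 3 / 3 - z * (τ * a)) * a)) τ := by
  have hn0 : ‖v₀‖ ≤ 1 := by simpa [interpDir] using hv.norm_le 0 (by simp)
  have hn1 : ‖v₁‖ ≤ 1 := by simpa [interpDir] using hv.norm_le 1 (by simp)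
  have hn : ‖v₁ - v₀‖ ≤ 2 := (norm_sub_le _ _).trans (by linarith)
  have hc := contour_rate_pos ha
  set c := min (a / 2) (1 / 12 : ℝ)
  set A := Real.exp (a ^ 3 / 3 + ‖z‖ * a + 1)
  set T : ℝ → ℝ → ℂ := contourPt a v₀ v₁ with hT
  set v : ℝ → ℂ := interpDir v₀ v₁ with hvd
  set F' : ℝ → ℝ → ℂ := fun τ s => exp (T τ s ^ 3 / 3 - z * T τ s) *
    ((T τ s ^ 2 - z) * (a + s * (v₁ - v₀))) * v τ + exp (T τ s ^ 3 / 3 - z * T τ s) * (v₁ - v₀)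
    with hF'
  set B := A * ((Real.exp (2 * a) + ‖z‖ + 2) * Real.exp a)
  have hB : ∀ τ ∈ Icc (0 : ℝ) 1, ∀ s, 0 ≤ s → ‖F' τ s‖ ≤
      B * Real.exp ((a ^ 2 + ‖z‖ + 4) * s - c * s ^ 2) := by
    intro τ hτ s hs
    have h1 := norm_exp_contourPt_le hv ha z hτ hs
    have h2 := norm_contourPt_le hv ha hτ hs
    have h3 : ‖(a : ℂ) + s * (v₁ - v₀)‖ ≤ a + 2 * s := by
      refine (norm_add_le _ _).trans ?_
      rw [norm_mul, norm_real, norm_real, Real.norm_of_nonneg ha.le, Real.norm_of_nonneg hs]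
      nlinarith
    have h4 : ‖T τ s ^ 2 - z‖ ≤ (a + s) ^ 2 + ‖z‖ := by
      refine (norm_sub_le _ _).trans ?_
      rw [norm_pow]
      gcongr
    have h5 : ‖F' τ s‖ ≤ (A * Real.exp ((a ^ 2 + ‖z‖) * s - c * s ^ 2)) *
        (((a + s) ^ 2 + ‖z‖) * (a + 2 * s) + 2) := by
      rw [hF']
      calc _ ≤ ‖exp (T τ s ^ 3 / 3 - z * T τ s)‖ * (‖T τ s ^ 2 - z‖ * ‖(a : ℂ) + s * (v₁ - v₀)‖) *
            ‖v τ‖ + ‖exp (T τ s ^ 3 / 3 - z * T τ s)‖ * ‖v₁ - v₀‖ := by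
            refine (norm_add_le _ _).trans ?_
            simp only [norm_mul, le_refl]
        _ ≤ (A * Real.exp ((a ^ 2 + ‖z‖) * s - c * s ^ 2)) * (((a + s) ^ 2 + ‖z‖) *
            (a + 2 * s)) * 1 + (A * Real.exp ((a ^ 2 + ‖z‖) * s - c * s ^ 2)) * 2 := by
            have := hv.norm_le τ hτ
            gcongr
        _ = _ := by ring
    refine h5.trans ?_
    have h6 : ((a + s) ^ 2 + ‖z‖) * (a + 2 * s) + 2 ≤
        (Real.exp (2 * a) + ‖z‖ + 2) * Real.exp a * Real.exp (4 * s) := by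
      have g1 : a + s ≤ Real.exp (a + s) := by linarith [Real.add_one_le_exp (a + s)]
      have g2 : a + 2 * s ≤ Real.exp (a + 2 * s) := by linarith [Real.add_one_le_exp (a + 2 * s)]
      have g3 : 1 ≤ Real.exp (2 * s) := Real.one_le_exp (by linarith)
      have g4 : 1 ≤ Real.exp (a + 2 * s) := Real.one_le_exp (by linarith)
      have hz := norm_nonneg z
      calc ((a + s) ^ 2 + ‖z‖) * (a + 2 * s) + 2
          ≤ (Real.exp (a + s) ^ 2 + ‖z‖ * Real.exp (2 * s)) * Real.exp (a + 2 * s) +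
            2 * (Real.exp (2 * s) * Real.exp (a + 2 * s)) := by
            have : (1 : ℝ) ≤ Real.exp (2 * s) * Real.exp (a + 2 * s) := by nlinarith
            have q : ‖z‖ ≤ ‖z‖ * Real.exp (2 * s) := le_mul_of_one_le_right hz g3
            gcongr
            linarith
        _ = _ := by
            rw [show Real.exp (a + s) ^ 2 = Real.exp (2 * a) * Real.exp (2 * s) by
              rw [← Real.exp_nat_mul, ← Real.exp_add]; congr 1; push_cast; ring,
              show Real.exp (4 * s) = Real.exp (2 * s) * Real.exp (2 * s) by
                rw [← Real.exp_add]; congr 1; ring, Real.exp_add a]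
            ring
    calc _ ≤ (A * Real.exp ((a ^ 2 + ‖z‖) * s - c * s ^ 2)) *
          ((Real.exp (2 * a) + ‖z‖ + 2) * Real.exp a * Real.exp (4 * s)) := by gcongr
      _ = _ := by
        rw [show (a ^ 2 + ‖z‖ + 4) * s - c * s ^ 2 = ((a ^ 2 + ‖z‖) * s - c * s ^ 2) + 4 * s by
          ring, Real.exp_add]
        ring
  have hTτ : ∀ τ s : ℝ, HasDerivAt (fun τ => T τ s) (a + s * (v₁ - v₀)) τ := by
    intro τ s
    have : HasDerivAt (fun τ : ℂ => τ * a + s * ((1 - τ) * v₀ + τ * v₁)) (a + s * (v₁ - v₀)) (τ : ℂ) := by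
      refine (((hasDerivAt_id (τ : ℂ)).mul_const (a : ℂ)).add
        (((((hasDerivAt_id (τ : ℂ)).const_sub 1).mul_const v₀).add
          ((hasDerivAt_id (τ : ℂ)).mul_const v₁)).const_mul (s : ℂ))).congr_deriv ?_
      ring
    exact this.comp_ofReal
  have hvτ : ∀ τ : ℝ, HasDerivAt v (v₁ - v₀) τ := by
    intro τ
    have : HasDerivAt (fun τ : ℂ => (1 - τ) * v₀ + τ * v₁) (v₁ - v₀) (τ : ℂ) := by
      refine ((((hasDerivAt_id (τ : ℂ)).const_sub 1).mul_const v₀).add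
          ((hasDerivAt_id (τ : ℂ)).mul_const v₁)).congr_deriv ?_
      ring
    exact this.comp_ofReal
  have hTs : ∀ τ s : ℝ, HasDerivAt (fun s => T τ s) (v τ) s := by
    intro τ s
    have : HasDerivAt (fun s : ℂ => τ * a + s * v τ) (v τ) (s : ℂ) := by
      refine (((hasDerivAt_id (s : ℂ)).mul_const (v τ)).const_add _).congr_deriv ?_
      ring
    exact this.comp_ofReal
  have hg : ∀ (f : ℝ → ℂ) (f' : ℂ) (x : ℝ), HasDerivAt f f' x →
      HasDerivAt (fun x => exp (f x ^ 3 / 3 - z * f x))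
        (exp (f x ^ 3 / 3 - z * f x) * ((f x ^ 2 - z) * f')) x := by
    intro f f' x hf
    refine (((hf.pow 3).div_const 3).sub (hf.const_mul z)).cexp.congr_deriv ?_
    simp; ring
  have hint : ∀ τ ∈ Icc (0 : ℝ) 1, IntegrableOn (fun s => exp (T τ s ^ 3 / 3 - z * T τ s) * v τ)
      (Ioi 0) := by
    intro τ hτ
    refine Integrable.mono' ((integrable_exp_linear_sub_sq (a ^ 2 + ‖z‖) hc).const_mul
      A).integrableOn (by fun_prop) ?_
    filter_upwards [ae_restrict_mem measurableSet_Ioi] with s hs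
    exact contourInt_integrand_le hv ha z hτ (le_of_lt hs)
  have hmeas : ∀ τ, AEStronglyMeasurable (F' τ) (volume.restrict (Ioi 0)) := fun τ =>
    (by rw [hF']; fun_prop : Continuous (F' τ)).aestronglyMeasurable
  have key := hasDerivAt_integral_of_dominated_loc_of_deriv_le
    (μ := volume.restrict (Ioi (0 : ℝ))) (s := Ioo (0 : ℝ) 1) (x₀ := τ)
    (F := fun τ s => exp (T τ s ^ 3 / 3 - z * T τ s) * v τ) (F' := F')
    (bound := fun s => B * Real.exp ((a ^ 2 + ‖z‖ + 4) * s - c * s ^ 2))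
    (Ioo_mem_nhds hτ.1 hτ.2)
    (Eventually.of_forall fun w => (by fun_prop : Continuous _).aestronglyMeasurable)
    (hint τ ⟨hτ.1.le, hτ.2.le⟩) (hmeas τ) ?_ ?_ ?_
  · refine key.2.congr_deriv ?_
    have hG : ∀ s ∈ Ici (0 : ℝ), HasDerivAt (fun s => exp (T τ s ^ 3 / 3 - z * T τ s) *
        (a + s * (v₁ - v₀))) (F' τ s) s := by
      intro s _
      have h1 : HasDerivAt (fun s : ℝ => (a : ℂ) + s * (v₁ - v₀)) (v₁ - v₀) s := by
        have : HasDerivAt (fun s : ℂ => (a : ℂ) + s * (v₁ - v₀)) (v₁ - v₀) (s : ℂ) := by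
          refine (((hasDerivAt_id (s : ℂ)).mul_const (v₁ - v₀)).const_add _).congr_deriv ?_
          ring
        exact this.comp_ofReal
      refine ((hg _ _ s (hTs τ s)).mul h1).congr_deriv ?_
      rw [hF']; ring
    have hlim : Tendsto (fun s : ℝ => exp (T τ s ^ 3 / 3 - z * T τ s) *
        (a + s * (v₁ - v₀))) atTop (𝓝 0) := by
      refine squeeze_zero_norm' (a := fun s => A * Real.exp a *
        Real.exp ((a ^ 2 + ‖z‖ + 2) * s - c * s ^ 2)) ?_ ?_
      · filter_upwards [eventually_ge_atTop 0] with s hs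
        have h1 := norm_exp_contourPt_le hv ha z ⟨hτ.1.le, hτ.2.le⟩ hs
        have h3 : ‖(a : ℂ) + s * (v₁ - v₀)‖ ≤ Real.exp (a + 2 * s) := by
          refine (norm_add_le _ _).trans ?_
          rw [norm_mul, norm_real, norm_real, Real.norm_of_nonneg ha.le, Real.norm_of_nonneg hs]
          nlinarith [Real.add_one_le_exp (a + 2 * s)]
        rw [norm_mul]
        refine (mul_le_mul h1 h3 (norm_nonneg _) (by positivity)).trans (le_of_eq ?_)
        rw [show (a ^ 2 + ‖z‖ + 2) * s - c * s ^ 2 = ((a ^ 2 + ‖z‖) * s - c * s ^ 2) + 2 * s by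
          ring, Real.exp_add ((a ^ 2 + ‖z‖) * s - c * s ^ 2), Real.exp_add a]
        ring
      · rw [← mul_zero (A * Real.exp a)]
        exact (tendsto_exp_linear_sub_sq _ hc).const_mul _
    rw [integral_Ioi_of_hasDerivAt_of_tendsto' hG key.1 hlim]
    simp [hT, contourPt]
  · filter_upwards [ae_restrict_mem measurableSet_Ioi] with s hs w hw
    exact hB w ⟨hw.1.le, hw.2.le⟩ s (le_of_lt hs)
  · exact ((integrable_exp_linear_sub_sq _ hc).const_mul _).integrableOn
  · filter_upwards with s w _
    refine ((hg _ _ w (hTτ w s)).mul (hvτ w)).congr_deriv ?_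
    rw [hF']

/-- `Ai` as an integral over the two halves of the vertical line through `a > 0`. -/
lemma Ai_eq_vertical (ha : 0 < a) (z : ℂ) : Ai z = (2 * (Real.pi : ℂ) * I)⁻¹ *
    ((∫ s in Ioi (0 : ℝ), exp ((a + s * I) ^ 3 / 3 - z * (a + s * I)) * I) +
      ∫ s in Ioi (0 : ℝ), exp ((a - s * I) ^ 3 / 3 - z * (a - s * I)) * I) := by
  set f : ℝ → ℂ := fun τ => contourInt a airyDir I z τ - contourInt a airyDir' (-I) z τ with hf
  have hcont : ContinuousOn f (Icc 0 1) := (continuousOn_contourInt decayingDirs_upper ha z).sub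
    (continuousOn_contourInt decayingDirs_lower ha z)
  have hd : ∀ τ ∈ Ioo (0 : ℝ) 1, HasDerivAt f 0 τ := fun τ hτ => by
    refine ((hasDerivAt_contourInt decayingDirs_upper ha z hτ).sub
      (hasDerivAt_contourInt decayingDirs_lower ha z hτ)).congr_deriv ?_
    ring
  obtain ⟨c, hc⟩ := isOpen_Ioo.exists_is_const_of_deriv_eq_zero isPreconnected_Ioo
    (fun τ hτ => (hd τ hτ).differentiableAt.differentiableWithinAt) (fun τ hτ => (hd τ hτ).deriv)
  have heq : EqOn f (fun _ => c) (Icc 0 1) := by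
    have : EqOn f (fun _ => c) (Ioo 0 1) := hc
    refine this.of_subset_closure hcont continuousOn_const Ioo_subset_Icc_self ?_
    rw [closure_Ioo zero_ne_one]
  have h01 : f 0 = f 1 := (heq (by simp)).trans (heq (by simp)).symm
  have h0 : f 0 = airyDir * rayMoment 0 airyDir z - airyDir' * rayMoment 0 airyDir' z := by
    have aux : ∀ v w : ℂ, v ^ 3 = -1 → contourInt a v w z 0 = v * rayMoment 0 v z := by
      intro v w hv
      rw [contourInt, rayMoment, ← integral_const_mul]
      congr 1
      ext s
      simp only [contourPt, interpDir]
      rw [mul_comm v]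
      simp only [ofReal_zero, zero_mul, sub_zero, one_mul, add_zero, zero_add, pow_zero]
      congr 2
      rw [mul_pow, hv]; ring
    rw [hf]
    simp only
    rw [aux _ _ airyDir_pow_three, aux _ _ airyDir'_pow_three]
  rw [Ai_eq_rayMoment, ← h0, h01, hf]
  simp only [contourInt, contourPt, interpDir]
  rw [sub_eq_add_neg, ← integral_neg]
  congr 2
  · congr 1; ext s; simp
  · congr 1; ext s; simp [sub_eq_add_neg]

/-- The saddle point bound for `Ai`, along the vertical line through the saddle `t = p` of
`t³/3 - p² t`, on which the modulus of the integrand is Gaussian. -/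
lemma norm_Ai_sq_le {p : ℂ} (hp : 0 < p.re) :
    ‖Ai (p ^ 2)‖ ≤ Real.exp (-(2 / 3 * (p ^ 3).re)) / Real.sqrt p.re := by
  set h : ℝ → ℝ := fun s => Real.exp (-(2 / 3 * (p ^ 3).re)) * Real.exp (-p.re * s ^ 2) with hh
  have hint : Integrable h := (integrable_exp_neg_mul_sq hp).const_mul _
  have hval : ∫ s, h s = Real.exp (-(2 / 3 * (p ^ 3).re)) * Real.sqrt (Real.pi / p.re) := by
    rw [hh, integral_const_mul, integral_gaussian]
  have hg : ∀ s : ℝ, ‖exp ((p.re + s * I) ^ 3 / 3 - p ^ 2 * (p.re + s * I)) * I‖ =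
      h (s - p.im) := by
    intro s
    rw [norm_mul, norm_I, mul_one, norm_exp, hh]
    simp only
    rw [← Real.exp_add]
    congr 1
    set u := s - p.im with hu
    have h1 : (p.re : ℂ) + s * I = p + u * I := by
      apply Complex.ext <;> simp [hu]
    have h2 : (p + u * I) ^ 3 / 3 - p ^ 2 * (p + u * I) =
        ((-(2 / 3) : ℝ) : ℂ) * p ^ 3 - ((u ^ 2 : ℝ) : ℂ) * p + ((-(u ^ 3 / 3) : ℝ) : ℂ) * I := by
      have : I ^ 3 = -I := I_pow_three
      push_cast
      linear_combination (u ^ 3 / 3 : ℂ) * this + p * u ^ 2 * I_sq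
    rw [h1, h2, add_re, sub_re, re_ofReal_mul, re_ofReal_mul, re_ofReal_mul]
    simp; ring
  have hint' : Integrable fun s => h (s - p.im) := hint.comp_sub_right _
  have e1 : ‖∫ s in Ioi (0 : ℝ), exp ((p.re + s * I) ^ 3 / 3 - p ^ 2 * (p.re + s * I)) * I‖ ≤
      ∫ s in Ioi (0 : ℝ), h (s - p.im) := by
    refine norm_integral_le_of_norm_le hint'.integrableOn (Eventually.of_forall fun s => ?_)
    exact (hg s).le
  have e2 : ‖∫ s in Ioi (0 : ℝ), exp ((p.re - s * I) ^ 3 / 3 - p ^ 2 * (p.re - s * I)) * I‖ ≤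
      ∫ s in Iio (0 : ℝ), h (s - p.im) := by
    have := integral_comp_neg_Iic (0 : ℝ) (fun s => h (-s - p.im))
    simp only [neg_neg, neg_zero] at this
    rw [← integral_Iic_eq_integral_Iio, this]
    refine norm_integral_le_of_norm_le ?_ (Eventually.of_forall fun s => ?_)
    · have h3 : Integrable fun s => h (-s - p.im) := by
        simpa using hint'.comp_neg
      exact h3.integrableOn
    · have := hg (-s)
      rw [← this]
      push_cast
      rw [neg_mul, ← sub_eq_add_neg]
  have e3 : (∫ s in Ioi (0 : ℝ), h (s - p.im)) + ∫ s in Iio (0 : ℝ), h (s - p.im) = ∫ s, h s := by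
    rw [← integral_Iic_eq_integral_Iio, add_comm, intervalIntegral.integral_Iic_add_Ioi
      hint'.integrableOn hint'.integrableOn, integral_sub_right_eq_self]
  have e4 : ‖(2 * (Real.pi : ℂ) * I)⁻¹‖ = (2 * Real.pi)⁻¹ := by
    simp [abs_of_pos Real.pi_pos]
  rw [Ai_eq_vertical hp, norm_mul, e4]
  calc _ ≤ (2 * Real.pi)⁻¹ * (Real.exp (-(2 / 3 * (p ^ 3).re)) * Real.sqrt (Real.pi / p.re)) := by
        gcongr
        exact (norm_add_le _ _).trans ((add_le_add e1 e2).trans (by rw [e3, hval]))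
    _ ≤ 1 * (Real.exp (-(2 / 3 * (p ^ 3).re)) / Real.sqrt p.re) := by
        rw [Real.sqrt_div Real.pi_pos.le]
        have : (2 * Real.pi)⁻¹ * Real.sqrt Real.pi ≤ 1 := by
          have h1 : Real.sqrt Real.pi ≤ Real.pi := by
            rw [Real.sqrt_le_left Real.pi_pos.le]
            nlinarith [Real.pi_gt_three]
          rw [inv_mul_le_iff₀ (by positivity)]
          nlinarith [Real.pi_pos]
        calc _ = ((2 * Real.pi)⁻¹ * Real.sqrt Real.pi) *
              (Real.exp (-(2 / 3 * (p ^ 3).re)) / Real.sqrt p.re) := by ring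
          _ ≤ _ := by gcongr
    _ = _ := one_mul _

end Contour

/-! ### Sectors and regular profiles -/

/-- `n ≠ 0` has an argument in `[-k, k]`. The argument is existentially quantified, so that
sectors multiply without any condition on the branch. -/
def Sec (k : ℝ) (n : ℂ) : Prop := ∃ θ : ℝ, |θ| ≤ k ∧ n = ‖n‖ * exp (θ * I) ∧ n ≠ 0

namespace Sec

variable {k l : ℝ} {n m : ℂ}

lemma ne_zero (h : Sec k n) : n ≠ 0 := h.choose_spec.2.2

lemma norm_pos (h : Sec k n) : 0 < ‖n‖ := norm_pos_iff.2 h.ne_zero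

lemma mono (h : Sec k n) (hkl : k ≤ l) : Sec l n := by
  obtain ⟨θ, h1, h2⟩ := h
  exact ⟨θ, h1.trans hkl, h2⟩

lemma mul (hn : Sec k n) (hm : Sec l m) : Sec (k + l) (n * m) := by
  obtain ⟨θ, h1, h2, h3⟩ := hn
  obtain ⟨η, g1, g2, g3⟩ := hm
  refine ⟨θ + η, (abs_add_le _ _).trans (add_le_add h1 g1), ?_, mul_ne_zero h3 g3⟩
  rw [norm_mul]
  push_cast
  rw [add_mul, exp_add]
  linear_combination m * h2 + ‖n‖ * exp (θ * I) * g2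

lemma inv (hn : Sec k n) : Sec k n⁻¹ := by
  obtain ⟨θ, h1, h2, h3⟩ := hn
  refine ⟨-θ, by rwa [abs_neg], ?_, inv_ne_zero h3⟩
  rw [norm_inv]
  push_cast
  rw [neg_mul, exp_neg, ← mul_inv, ← h2]

lemma div (hn : Sec k n) (hm : Sec l m) : Sec (k + l) (n / m) := by
  rw [div_eq_mul_inv]; exact hn.mul hm.inv

lemma ofReal {r : ℝ} (hr : 0 < r) : Sec 0 (r : ℂ) :=
  ⟨0, by simp, by simp [abs_of_pos hr], by exact_mod_cast hr.ne'⟩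

lemma exp_mul_I (θ : ℝ) : Sec |θ| (exp (θ * I)) :=
  ⟨θ, le_rfl, by rw [norm_exp_ofReal_mul_I]; simp, exp_ne_zero _⟩

lemma cpow (hn : Sec k n) (hk : k < Real.pi) (a : ℝ) : Sec (|a| * k) (n ^ (a : ℂ)) := by
  obtain ⟨θ, h1, h2, h3⟩ := hn
  have hθ := abs_lt.1 (h1.trans_lt hk)
  have hpos : 0 < ‖n‖ := norm_pos_iff.2 h3
  have harg : arg n = θ := by
    rw [h2, Complex.exp_mul_I]
    exact arg_mul_cos_add_sin_mul_I hpos ⟨hθ.1, hθ.2.le⟩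
  refine ⟨a * θ, ?_, ?_, ?_⟩
  · rw [abs_mul]; gcongr
  · rw [norm_cpow_real, cpow_def_of_ne_zero h3, log, harg]
    rw [add_mul, exp_add]
    congr 1
    · rw [Real.rpow_def_of_pos hpos]; push_cast; rfl
    · congr 1; push_cast; ring
  · simp [cpow_eq_zero_iff, h3]

lemma mem_slitPlane (hn : Sec k n) (hk : k < Real.pi) : n ∈ slitPlane := by
  obtain ⟨θ, h1, h2, h3⟩ := hn
  have hθ := abs_lt.1 (h1.trans_lt hk)
  have hpos : 0 < ‖n‖ := norm_pos_iff.2 h3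
  rw [mem_slitPlane_iff_arg]
  refine ⟨?_, h3⟩
  rw [h2, Complex.exp_mul_I, arg_mul_cos_add_sin_mul_I hpos ⟨hθ.1, hθ.2.le⟩]
  exact hθ.2.ne

lemma re_ge (hn : Sec k n) (hk : k ≤ Real.pi) : ‖n‖ * Real.cos k ≤ n.re := by
  obtain ⟨θ, h1, h2, h3⟩ := hn
  have : n.re = ‖n‖ * Real.cos θ := by
    conv_lhs => rw [h2]
    rw [re_ofReal_mul, exp_ofReal_mul_I_re]
  rw [this, ← Real.cos_abs θ]
  exact mul_le_mul_of_nonneg_left (Real.cos_le_cos_of_nonneg_of_le_pi (abs_nonneg _) hk h1)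
    (norm_nonneg _)

lemma abs_im_le (hn : Sec k n) : |n.im| ≤ ‖n‖ * k := by
  obtain ⟨θ, h1, h2, h3⟩ := hn
  have : n.im = ‖n‖ * Real.sin θ := by
    conv_lhs => rw [h2]
    rw [im_ofReal_mul, exp_ofReal_mul_I_im]
  rw [this, abs_mul, abs_norm]
  exact mul_le_mul_of_nonneg_left ((Real.abs_sin_le_abs).trans h1) (norm_nonneg _)

lemma re_ge_half (hn : Sec k n) (hk : k ≤ 1) : ‖n‖ / 2 ≤ n.re := by
  have h1 : Sec 1 n := hn.mono hk
  refine le_trans ?_ (h1.re_ge (by linarith [Real.pi_gt_three]))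
  have := Real.cos_one_pos
  have h2 : (1 : ℝ) / 2 ≤ Real.cos 1 := by
    have := Real.one_sub_sq_div_two_le_cos (x := 1)
    norm_num at this ⊢; linarith
  rw [div_eq_mul_one_div]
  exact mul_le_mul_of_nonneg_left h2 (norm_nonneg _)

lemma abs_im_le_re (hn : Sec k n) (hk : k ≤ 1) : |n.im| ≤ 2 * k * n.re := by
  have h1 := hn.abs_im_le
  have h2 := hn.re_ge_half hk
  have hk0 : 0 ≤ k := (abs_nonneg _).trans hn.choose_spec.1
  nlinarith

end Sec

lemma sec_of_abs_sin {k s : ℝ} {n : ℂ} (hn : n ≠ 0) (hre : 0 ≤ n.re) (him : |n.im| ≤ s * ‖n‖)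
    (hk : 2 * s ≤ k) : Sec k n := by
  have harg := (abs_arg_le_pi_div_two_iff).2 hre
  refine ⟨arg n, ?_, (norm_mul_exp_arg_mul_I n).symm, hn⟩
  have hpos : 0 < ‖n‖ := norm_pos_iff.2 hn
  have h1 : Real.sin |arg n| ≤ s := by
    have h2 : |Real.sin (arg n)| ≤ s := by
      rw [sin_arg, abs_div, abs_norm, div_le_iff₀ hpos]; exact him
    rcases abs_cases (arg n) with h | h
    · rw [h.1]; exact (le_abs_self _).trans h2
    · rw [h.1, Real.sin_neg]; exact (neg_le_abs _).trans h2
  have h3 := Real.mul_le_sin (abs_nonneg (arg n)) harg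
  have h4 : |arg n| / 2 ≤ 2 / Real.pi * |arg n| := by
    rw [div_eq_mul_one_div, mul_comm]
    refine mul_le_mul_of_nonneg_right ?_ (abs_nonneg _)
    rw [div_le_div_iff₀ (by norm_num) Real.pi_pos]
    linarith [Real.pi_le_four]
  linarith

/-- A point whose real part is not much below the imaginary axis. -/
lemma sec_of_re_ge {s : ℝ} {n : ℂ} (hn : n ≠ 0) (hs : 0 ≤ s)
    (hre : -s * ‖n‖ ≤ n.re) : Sec (Real.pi / 2 + 2 * s) n := by
  have hpos : 0 < ‖n‖ := norm_pos_iff.2 hn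
  refine ⟨arg n, ?_, (norm_mul_exp_arg_mul_I n).symm, hn⟩
  by_contra! hcon
  have hcos : -s ≤ Real.cos (arg n) := by
    rw [cos_arg hn, le_div_iff₀ hpos]; exact hre
  rw [← Real.cos_abs] at hcos
  set t := |arg n|
  have ht : t ≤ Real.pi := abs_arg_le_pi n
  have h1 : s ≤ Real.sin (t - Real.pi / 2) ∨ Real.sin (t - Real.pi / 2) ≤ s := le_total _ _
  have h2 := Real.mul_le_sin (x := t - Real.pi / 2) (by linarith) (by linarith)
  rw [Real.sin_sub_pi_div_two] at h2
  have h4 : (t - Real.pi / 2) / 2 ≤ 2 / Real.pi * (t - Real.pi / 2) := by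
    rw [div_eq_mul_one_div, mul_comm]
    refine mul_le_mul_of_nonneg_right ?_ (by linarith)
    rw [div_le_div_iff₀ (by norm_num) Real.pi_pos]
    linarith [Real.pi_le_four]
  linarith

/-- The segment `[0, 1]` in `ℂ`. -/
def unitSeg : Set ℂ := (fun x : ℝ => (x : ℂ)) '' Icc (0 : ℝ) 1

lemma isCompact_unitSeg : IsCompact unitSeg := isCompact_Icc.image continuous_ofReal

lemma convex_unitSeg : Convex ℝ unitSeg := by
  have : unitSeg = (ofRealCLM.toLinearMap : ℝ →ₗ[ℝ] ℂ) '' Icc (0 : ℝ) 1 := rfl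
  rw [this]
  exact (convex_Icc 0 1).linear_image _

lemma dslope_eq_integral {U : ℂ → ℂ} {N : Set ℂ} (hN : Convex ℝ N) (hNo : IsOpen N)
    (hU : DifferentiableOn ℂ U N) {a w : ℂ} (ha : a ∈ N) (hw : w ∈ N) :
    dslope U a w = ∫ s in (0 : ℝ)..1, deriv U (a + s * (w - a)) := by
  rcases eq_or_ne w a with rfl | hne
  · simp
  have hmem : ∀ t ∈ Icc (0 : ℝ) 1, a + t • (w - a) ∈ N := fun t ht =>
    hN.add_smul_sub_mem ha hw ht
  have hcont : ContinuousOn (fun t : ℝ => deriv U (a + t • (w - a))) (Icc 0 1) :=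
    (hU.deriv hNo).continuousOn.comp (by fun_prop) hmem
  have h := intervalIntegral.integral_unitInterval_deriv_eq_sub (f := U) (f' := deriv U) (z₀ := a) (z₁ := w - a)
    hcont (fun t ht => ((hU _ (hmem t ht)).differentiableAt (hNo.mem_nhds (hmem t ht))).hasDerivAt)
  rw [add_sub_cancel, smul_eq_mul] at h
  rw [dslope_of_ne _ hne, slope_def_field, ← h, mul_div_cancel_left₀ _ (sub_ne_zero.2 hne)]
  rfl

/-- Aperture of the sectors containing the difference quotients of `U`. -/
def aperture : ℝ := 1 / 1000

/-- The data are regular with radius `ρ` and constant `m`: on the `ρ`-neighbourhood of `[0, 1]`,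
which contains `z_c`, the profile is holomorphic and its difference quotients based at `z_c` are
bounded above and below and have arguments close to zero. -/
structure Regular (P : Data) (ρ m : ℝ) : Prop where
  rho_pos : 0 < ρ
  m_pos : 0 < m
  m_le : m ≤ 1
  diff : DifferentiableOn ℂ P.U (Metric.thickening ρ unitSeg)
  zc_lt : ‖P.zc‖ < ρ
  α_pos : 0 < P.α
  R_pos : 0 < P.R
  sec : ∀ w ∈ Metric.thickening ρ unitSeg, Sec aperture (dslope P.U P.zc w)
  le_norm : ∀ w ∈ Metric.thickening ρ unitSeg, m ≤ ‖dslope P.U P.zc w‖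
  norm_le : ∀ w ∈ Metric.thickening ρ unitSeg, ‖dslope P.U P.zc w‖ ≤ m⁻¹

/-- The difference quotients of `U` based at `0` are real and positive on `[0, 1]`. -/
lemma dslope_zero_pos (U : ℂ → ℂ) (hU : AnalyticOnNhd ℂ U unitSeg)
    (hreal : ∀ x ∈ Icc (0 : ℝ) 1, (U x).im = 0) (hU' : 0 < (deriv U 0).re)
    (hcrit : ∀ x ∈ Ioc (0 : ℝ) 1, U x ≠ U 0) :
    ContinuousOn (fun x : ℝ => dslope U 0 x) (Icc 0 1) ∧
      ∀ x ∈ Icc (0 : ℝ) 1, (dslope U 0 x).im = 0 ∧ 0 < (dslope U 0 x).re := by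
  have hmem : ∀ x ∈ Icc (0 : ℝ) 1, (x : ℂ) ∈ unitSeg := fun x hx => ⟨x, hx, rfl⟩
  have hcont : ContinuousOn (fun x : ℝ => dslope U 0 x) (Icc 0 1) := by
    intro x hx
    have hd : DifferentiableAt ℂ U x := (hU x (hmem x hx)).differentiableAt
    have : ContinuousAt (dslope U 0) (x : ℂ) := by
      rcases eq_or_ne (x : ℂ) 0 with h0 | h0
      · rw [h0] at hd ⊢; exact continuousAt_dslope_same.2 hd
      · exact (continuousAt_dslope_of_ne h0).2 hd.continuousAt
    exact (this.comp continuous_ofReal.continuousAt).continuousWithinAt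
  have hval : ∀ x ∈ Ioc (0 : ℝ) 1, dslope U 0 x = (((U x).re - (U 0).re) / x : ℝ) := by
    intro x hx
    have hx0 : (x : ℂ) ≠ 0 := by exact_mod_cast hx.1.ne'
    rw [dslope_of_ne _ hx0, slope_def_field]
    have h1 : U x = ((U x).re : ℂ) := by
      apply Complex.ext <;> simp [hreal x ⟨hx.1.le, hx.2⟩]
    have h2 : U 0 = ((U 0).re : ℂ) := by
      have := hreal 0 (by simp)
      apply Complex.ext <;> simp_all
    rw [h1, h2]; simp
  have him : ∀ x ∈ Icc (0 : ℝ) 1, (dslope U 0 x).im = 0 := by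
    have : EqOn (fun x : ℝ => (dslope U 0 x).im) (fun _ => 0) (Icc 0 1) := by
      refine EqOn.of_subset_closure (s := Ioc 0 1) (fun x hx => ?_)
        (continuous_im.comp_continuousOn hcont) continuousOn_const Ioc_subset_Icc_self ?_
      · simp only [hval x hx, ofReal_im]
      · rw [closure_Ioc zero_ne_one]
    exact this
  refine ⟨hcont, fun x hx => ⟨him x hx, ?_⟩⟩
  have hne : ∀ y ∈ Icc (0 : ℝ) 1, (dslope U 0 y).re ≠ 0 := by
    intro y hy h
    rcases hy.1.eq_or_lt with rfl | hy0
    · simp at h; linarith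
    · have hz : dslope U 0 y = 0 := Complex.ext h (him y hy)
      have hy0' : (y : ℂ) ≠ 0 := by exact_mod_cast hy0.ne'
      rw [dslope_of_ne _ hy0', slope_def_field, div_eq_zero_iff] at hz
      rcases hz with hz | hz
      · exact hcrit y ⟨hy0, hy.2⟩ (sub_eq_zero.1 hz)
      · exact hy0' (by simpa using hz)
  by_contra! hcon
  have hc' : ContinuousOn (fun x : ℝ => (dslope U 0 x).re) (Icc 0 x) :=
    (continuous_re.comp_continuousOn hcont).mono (Icc_subset_Icc_right hx.2)
  obtain ⟨y, hy, hy0⟩ := intermediate_value_Icc' hx.1 hc' (show (0 : ℝ) ∈ _ from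
    ⟨hcon, by simpa using hU'.le⟩)
  exact hne y ⟨hy.1, hy.2.trans hx.2⟩ hy0

/-- Near the critical point `0` the difference quotients based at `z_c` are, by uniform continuity
of `U'`, close to those based at `0`, which are real and bounded below on `[0, 1]`. -/
lemma exists_regular (U : ℂ → ℂ) (hU : AnalyticOnNhd ℂ U unitSeg)
    (hreal : ∀ x ∈ Icc (0 : ℝ) 1, (U x).im = 0) (hU' : 0 < (deriv U 0).re)
    (hcrit : ∀ x ∈ Ioc (0 : ℝ) 1, U x ≠ U 0) :
    ∃ ρ m : ℝ, 0 < ρ ∧ ρ ≤ 1 ∧ 0 < m ∧ ∀ P : Data, P.U = U → 0 < P.α → 0 < P.R → ‖P.zc‖ < ρ →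
      Regular P ρ m := by
  obtain ⟨hpc, hpp⟩ := dslope_zero_pos U hU hreal hU' hcrit
  obtain ⟨ρ₀, hρ₀, hsub⟩ := isCompact_unitSeg.exists_cthickening_subset_open
    (isOpen_analyticAt ℂ U) hU
  have hcomp : IsCompact (Metric.cthickening ρ₀ unitSeg) := isCompact_unitSeg.cthickening
  have hdc : ContinuousOn (deriv U) (Metric.cthickening ρ₀ unitSeg) := fun w hw =>
    (hsub hw).deriv.continuousAt.continuousWithinAt
  have huc := hcomp.uniformContinuousOn_of_continuous hdc
  obtain ⟨x₁, hx₁, hmin⟩ := isCompact_Icc.exists_isMinOn (nonempty_Icc.2 zero_le_one)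
    (continuous_re.comp_continuousOn hpc)
  obtain ⟨x₂, hx₂, hmax⟩ := isCompact_Icc.exists_isMaxOn (nonempty_Icc.2 zero_le_one)
    (continuous_re.comp_continuousOn hpc)
  set m₀ := (dslope U 0 x₁).re with hm₀
  set m₁ := (dslope U 0 x₂).re with hm₁
  have hm₀pos : 0 < m₀ := (hpp x₁ hx₁).2
  have hle : ∀ x ∈ Icc (0 : ℝ) 1, m₀ ≤ (dslope U 0 x).re ∧ (dslope U 0 x).re ≤ m₁ :=
    fun x hx => ⟨hmin hx, hmax hx⟩
  set ε := m₀ * (aperture / 8) with hε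
  have hap : aperture = 1 / 1000 := rfl
  have hεpos : 0 < ε := by rw [hε, hap]; positivity
  obtain ⟨d, hd, hdist⟩ := Metric.uniformContinuousOn_iff_le.1 huc ε hεpos
  have hm₁pos : 0 < m₁ := hm₀pos.trans_le (hle x₁ hx₁).2
  refine ⟨min (min ρ₀ (d / 2)) 1, min (min (m₀ / 2) 1) (m₁ + m₀)⁻¹, ?_, min_le_right _ _, ?_, ?_⟩
  · positivity
  · positivity
  intro P hPU hα hR hzc
  set ρ := min (min ρ₀ (d / 2)) 1 with hρ
  have hρpos : 0 < ρ := by positivity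
  have hρ₀' : ρ ≤ ρ₀ := (min_le_left _ _).trans (min_le_left _ _)
  have hρd : ρ ≤ d / 2 := (min_le_left _ _).trans (min_le_right _ _)
  set N := Metric.thickening ρ unitSeg with hN
  have hNsub : N ⊆ Metric.cthickening ρ₀ unitSeg :=
    (Metric.thickening_mono hρ₀' _).trans (Metric.thickening_subset_cthickening _ _)
  have hNconv : Convex ℝ N := convex_unitSeg.thickening ρ
  have hNopen : IsOpen N := Metric.isOpen_thickening
  have hdiff : DifferentiableOn ℂ U N := fun w hw =>
    (hsub (hNsub hw)).differentiableAt.differentiableWithinAt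
  have hsegN : ∀ x ∈ Icc (0 : ℝ) 1, (x : ℂ) ∈ N := fun x hx =>
    Metric.self_subset_thickening hρpos _ ⟨x, hx, rfl⟩
  have h0N : (0 : ℂ) ∈ N := by simpa using hsegN 0 (by simp)
  have hzcN : P.zc ∈ N := by
    rw [hN, Metric.mem_thickening_iff]
    exact ⟨0, ⟨0, by simp, by simp⟩, by simpa using hzc⟩
  -- comparison of the difference quotients based at `z_c` and at `0`
  have key : ∀ w ∈ N, ∃ x ∈ Icc (0 : ℝ) 1, ‖dslope U P.zc w - dslope U 0 x‖ ≤ ε := by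
    intro w hw
    obtain ⟨_, ⟨x, hx, rfl⟩, hxw⟩ := Metric.mem_thickening_iff.1 hw
    refine ⟨x, hx, ?_⟩
    have hm1 : ∀ t ∈ Icc (0 : ℝ) 1, P.zc + t * (w - P.zc) ∈ N := fun t ht => by
      simpa using hNconv.add_smul_sub_mem hzcN hw ht
    have hm2 : ∀ t ∈ Icc (0 : ℝ) 1, (0 : ℂ) + t * (x - 0) ∈ N := fun t ht => by
      simpa using hNconv.add_smul_sub_mem h0N (hsegN x hx) ht
    have hdN := (hdiff.deriv hNopen).continuousOn
    have hi : ∀ a b : ℂ, (∀ t ∈ Icc (0 : ℝ) 1, a + t * (b - a) ∈ N) →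
        IntervalIntegrable (fun t : ℝ => deriv U (a + t * (b - a))) volume 0 1 := by
      intro a b hab
      refine ContinuousOn.intervalIntegrable ?_
      rw [uIcc_of_le zero_le_one]
      exact hdN.comp (by fun_prop) hab
    rw [dslope_eq_integral hNconv hNopen hdiff hzcN hw,
      dslope_eq_integral hNconv hNopen hdiff h0N (hsegN x hx),
      ← intervalIntegral.integral_sub (hi _ _ hm1) (hi _ _ hm2)]
    refine (intervalIntegral.norm_integral_le_of_norm_le_const (C := ε) fun t ht => ?_).trans
      (by simp)
    rw [uIoc_of_le zero_le_one] at ht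
    have ht' : t ∈ Icc (0 : ℝ) 1 := ⟨ht.1.le, ht.2⟩
    rw [← dist_eq_norm]
    refine hdist _ (hNsub (hm1 t ht')) _ (hNsub (hm2 t ht')) ?_
    rw [dist_eq_norm] at hxw ⊢
    have : P.zc + t * (w - P.zc) - (0 + t * ((x : ℂ) - 0)) =
        ((1 - t : ℝ) : ℂ) * P.zc + (t : ℂ) * (w - x) := by push_cast; ring
    rw [this]
    refine (norm_add_le _ _).trans ?_
    rw [norm_mul, norm_mul, norm_real, norm_real, Real.norm_of_nonneg ht'.1,
      Real.norm_of_nonneg (by linarith [ht'.2])]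
    nlinarith [norm_nonneg P.zc, norm_nonneg (w - x), ht'.1, ht'.2]
  have key2 : ∀ w ∈ N, Sec aperture (dslope U P.zc w) ∧ m₀ / 2 ≤ ‖dslope U P.zc w‖ ∧
      ‖dslope U P.zc w‖ ≤ m₁ + m₀ := by
    intro w hw
    obtain ⟨x, hx, hxw⟩ := key w hw
    set p := dslope U P.zc w
    set p₀ := dslope U 0 x
    have hp₀ := hle x hx
    have h1 : |p.re - p₀.re| ≤ ε := by rw [← sub_re]; exact (abs_re_le_norm _).trans hxw
    have h2 : |p.im - p₀.im| ≤ ε := by rw [← sub_im]; exact (abs_im_le_norm _).trans hxw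
    rw [(hpp x hx).1, sub_zero] at h2
    have h3 := abs_le.1 h1
    have hε' : ε ≤ m₀ / 2 := by rw [hε, hap]; linarith
    have hre : m₀ / 2 ≤ p.re := by linarith [h3.1]
    have hnorm : m₀ / 2 ≤ ‖p‖ := hre.trans (re_le_norm p)
    have hpne : p ≠ 0 := by
      rw [← norm_pos_iff]; linarith
    refine ⟨sec_of_abs_sin hpne (by linarith) (s := aperture / 2) ?_ (by linarith), hnorm, ?_⟩
    · refine h2.trans ?_
      rw [hε]
      have : 0 < aperture := by rw [hap]; norm_num
      nlinarith
    · have h5 : ‖p₀‖ ≤ m₁ := by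
        have : p₀ = ((p₀.re : ℝ) : ℂ) := Complex.ext (by simp) (by simp [p₀, (hpp x hx).1])
        rw [this, norm_real, Real.norm_of_nonneg (by linarith)]
        exact hp₀.2
      have := norm_le_norm_add_norm_sub' p p₀
      linarith
  have hm : min (min (m₀ / 2) 1) (m₁ + m₀)⁻¹ ≤ m₀ / 2 := (min_le_left _ _).trans (min_le_left _ _)
  have hmp : 0 < min (min (m₀ / 2) 1) (m₁ + m₀)⁻¹ := by positivity
  exact {
    rho_pos := hρpos
    m_pos := hmp
    m_le := (min_le_left _ _).trans (min_le_right _ _)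
    diff := by rw [hPU]; exact hdiff
    zc_lt := hzc
    α_pos := hα
    R_pos := hR
    sec := fun w hw => by rw [hPU]; exact (key2 w hw).1
    le_norm := fun w hw => by rw [hPU]; exact hm.trans (key2 w hw).2.1
    norm_le := fun w hw => by
      rw [hPU]
      refine (key2 w hw).2.2.trans ?_
      rw [le_inv_comm₀ (by positivity) hmp]
      exact min_le_right _ _ }

/-! ### Langer's variable -/

/-- The weighted mean `3/2 ∫₀¹ √s Q (a + s (z - a)) ds`. -/
def sqrtMean (Q : ℂ → ℂ) (a z : ℂ) : ℂ :=
  3 / 2 * ∫ s in (0 : ℝ)..1, (Real.sqrt s : ℂ) * Q (a + s * (z - a))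

section SqrtMean

variable {Q : ℂ → ℂ} {N : Set ℂ} {a z : ℂ}

lemma segment_mem (hN : Convex ℝ N) (ha : a ∈ N) (hz : z ∈ N) {t : ℝ} (ht : t ∈ Icc (0 : ℝ) 1) :
    a + t * (z - a) ∈ N := by
  simpa using hN.add_smul_sub_mem ha hz ht

lemma continuous_sqrt_ofReal : Continuous fun s : ℝ => (Real.sqrt s : ℂ) :=
  continuous_ofReal.comp Real.continuous_sqrt

/-- The relation between the mean and its derivative comes from integrating the `s`-derivative of
`s^{3/2} Q (a + s (z - a))` over `[0, 1]`. -/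
lemma exists_hasDerivAt_sqrtMean (hN : Convex ℝ N) (hNo : IsOpen N) (hQ : DifferentiableOn ℂ Q N)
    (ha : a ∈ N) (hz : z ∈ N) :
    ∃ J' : ℂ, HasDerivAt (sqrtMean Q a) J' z ∧ Q z = sqrtMean Q a z + 2 / 3 * (z - a) * J' := by
  have hdQ : ContinuousOn (deriv Q) N := (hQ.deriv hNo).continuousOn
  have hQat : ∀ w ∈ N, HasDerivAt Q (deriv Q w) w := fun w hw =>
    ((hQ w hw).differentiableAt (hNo.mem_nhds hw)).hasDerivAt
  obtain ⟨r, hr, hball⟩ := Metric.isOpen_iff.1 hNo z hz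
  have hsub : ∀ w ∈ Metric.closedBall z (r / 2), w ∈ N := fun w hw =>
    hball (Metric.closedBall_subset_ball (by linarith) hw)
  -- a bound of `Q'` on the compact cone over a small disc
  have hcomp : IsCompact ((fun p : ℝ × ℂ => a + p.1 * (p.2 - a)) ''
      (Icc (0 : ℝ) 1 ×ˢ Metric.closedBall z (r / 2))) :=
    (isCompact_Icc.prod (isCompact_closedBall z (r / 2))).image (by fun_prop)
  obtain ⟨B, hB⟩ := hcomp.exists_bound_of_continuousOn (f := deriv Q) (hdQ.mono (by
    rintro _ ⟨⟨t, w⟩, ⟨ht, hw⟩, rfl⟩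
    exact segment_mem hN ha (hsub w hw) ht))
  have hcontQ : ∀ w ∈ N, ContinuousOn (fun s : ℝ => (Real.sqrt s : ℂ) * Q (a + s * (w - a)))
      (Icc 0 1) := fun w hw => continuous_sqrt_ofReal.continuousOn.mul
    (hQ.continuousOn.comp (by fun_prop) fun t ht => segment_mem hN ha hw ht)
  have hcontQ' : ContinuousOn (fun s : ℝ => (Real.sqrt s : ℂ) * (s * deriv Q (a + s * (z - a))))
      (Icc 0 1) := continuous_sqrt_ofReal.continuousOn.mul (continuous_ofReal.continuousOn.mul
    (hdQ.comp (by fun_prop) fun t ht => segment_mem hN ha hz ht))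
  have huIoc : uIoc (0 : ℝ) 1 ⊆ Icc 0 1 := by
    rw [uIoc_of_le zero_le_one]; exact Ioc_subset_Icc_self
  have hd := intervalIntegral.hasDerivAt_integral_of_dominated_loc_of_deriv_le (μ := volume)
    (a := 0) (b := 1) (s := Metric.ball z (r / 2)) (x₀ := z)
    (F := fun w (s : ℝ) => (Real.sqrt s : ℂ) * Q (a + s * (w - a)))
    (F' := fun w (s : ℝ) => (Real.sqrt s : ℂ) * (s * deriv Q (a + s * (w - a))))
    (bound := fun _ => 1 * (1 * B))
    (Metric.ball_mem_nhds z (by linarith)) ?_ ?_ ?_ ?_ ?_ ?_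
  · refine ⟨_, hd.2.const_mul (3 / 2 : ℂ), ?_⟩
    have hparts : ∫ s in (0 : ℝ)..1, (3 / 2 * ((Real.sqrt s : ℂ) * Q (a + s * (z - a))) +
        (z - a) * ((Real.sqrt s : ℂ) * (s * deriv Q (a + s * (z - a))))) =
        ((1 : ℝ) * Real.sqrt 1 : ℝ) * Q (a + (1 : ℝ) * (z - a)) -
        ((0 : ℝ) * Real.sqrt 0 : ℝ) * Q (a + (0 : ℝ) * (z - a)) := by
      refine intervalIntegral.integral_eq_sub_of_hasDerivAt_of_le zero_le_one
        (f := fun s : ℝ => ((s * Real.sqrt s : ℝ) : ℂ) * Q (a + s * (z - a))) ?_ ?_ ?_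
      · refine ContinuousOn.mul ?_ (hQ.continuousOn.comp (by fun_prop)
          fun t ht => segment_mem hN ha hz ht)
        exact (continuous_ofReal.comp (continuous_id.mul Real.continuous_sqrt)).continuousOn
      · intro s hs
        have h1 : HasDerivAt (fun s : ℝ => s * Real.sqrt s) (3 / 2 * Real.sqrt s) s := by
          refine ((hasDerivAt_id s).mul (Real.hasDerivAt_sqrt hs.1.ne')).congr_deriv ?_
          have h2 : Real.sqrt s ≠ 0 := (Real.sqrt_pos.2 hs.1).ne'
          have h3 : Real.sqrt s ^ 2 = s := Real.sq_sqrt hs.1.le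
          simp only [id]
          field_simp
          linear_combination -h3
        have h4 : HasDerivAt (fun s : ℝ => Q (a + s * (z - a)))
            (deriv Q (a + s * (z - a)) * (z - a)) s := by
          have h5 : HasDerivAt (fun s : ℂ => a + s * (z - a)) (z - a) (s : ℂ) := by
            simpa using ((hasDerivAt_id (s : ℂ)).mul_const (z - a)).const_add a
          exact ((hQat _ (segment_mem hN ha hz ⟨hs.1.le, hs.2.le⟩)).comp (s : ℂ) h5).comp_ofReal
        refine (h1.ofReal_comp.mul h4).congr_deriv ?_
        push_cast; ring
      · refine ContinuousOn.intervalIntegrable ?_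
        rw [uIcc_of_le zero_le_one]
        exact (continuousOn_const.mul (hcontQ z hz)).add (continuousOn_const.mul hcontQ')
    have hi1 : IntervalIntegrable (fun s : ℝ => (Real.sqrt s : ℂ) * Q (a + s * (z - a)))
        volume 0 1 := by
      refine ContinuousOn.intervalIntegrable ?_
      rw [uIcc_of_le zero_le_one]; exact hcontQ z hz
    rw [intervalIntegral.integral_add (hi1.const_mul _) (hd.1.const_mul _),
      intervalIntegral.integral_const_mul, intervalIntegral.integral_const_mul] at hparts
    simp only [Real.sqrt_one, mul_one, ofReal_one, one_mul, zero_mul, ofReal_zero, sub_zero,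
      add_sub_cancel] at hparts
    rw [sqrtMean, ← hparts]
    ring
  · filter_upwards [hNo.mem_nhds hz] with w hw
    exact ((hcontQ w hw).mono huIoc).aestronglyMeasurable measurableSet_uIoc
  · refine ContinuousOn.intervalIntegrable ?_
    rw [uIcc_of_le zero_le_one]; exact hcontQ z hz
  · exact (hcontQ'.mono huIoc).aestronglyMeasurable measurableSet_uIoc
  · refine Eventually.of_forall fun t ht w hw => ?_
    have ht' := huIoc ht
    have h1 : ‖(Real.sqrt t : ℂ)‖ ≤ 1 := by
      rw [norm_real, Real.norm_of_nonneg (Real.sqrt_nonneg _)]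
      exact Real.sqrt_le_iff.2 ⟨zero_le_one, by simpa using ht'.2⟩
    have h2 : ‖(t : ℂ)‖ ≤ 1 := by
      rw [norm_real, Real.norm_of_nonneg ht'.1]; exact ht'.2
    have h3 := hB (a + t * (w - a)) ⟨(t, w), ⟨ht', Metric.ball_subset_closedBall hw⟩, rfl⟩
    rw [norm_mul, norm_mul]
    gcongr
  · exact intervalIntegrable_const
  · refine Eventually.of_forall fun t ht w hw => ?_
    have h5 : HasDerivAt (fun w : ℂ => a + t * (w - a)) (t : ℂ) w := by
      simpa using (((hasDerivAt_id w).sub_const a).const_mul (t : ℂ)).const_add a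
    have h6 := ((hQat _ (segment_mem hN ha (hsub w (Metric.ball_subset_closedBall hw))
      (huIoc ht))).comp w h5).const_mul (Real.sqrt t : ℂ)
    refine h6.congr_deriv ?_
    ring

/-- Weighted means stay in a sector, which is a convex cone. -/
lemma sqrtMean_sec (hN : Convex ℝ N) (hQ : ContinuousOn Q N) (ha : a ∈ N) (hz : z ∈ N)
    {k m M : ℝ} (hk : k ≤ 1) (hm : 0 < m) (hsec : ∀ w ∈ N, Sec k (Q w)) (hlow : ∀ w ∈ N, m ≤ ‖Q w‖)
    (hup : ∀ w ∈ N, ‖Q w‖ ≤ M) :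
    Sec (4 * k) (sqrtMean Q a z) ∧ m / 2 ≤ ‖sqrtMean Q a z‖ ∧ ‖sqrtMean Q a z‖ ≤ M := by
  have hmem : ∀ t ∈ Icc (0 : ℝ) 1, a + t * (z - a) ∈ N := fun t ht => segment_mem hN ha hz ht
  have hQc : ContinuousOn (fun s : ℝ => Q (a + s * (z - a))) (Icc 0 1) :=
    hQ.comp (by fun_prop) hmem
  have hcont : ContinuousOn (fun s : ℝ => (Real.sqrt s : ℂ) * Q (a + s * (z - a))) (Icc 0 1) :=
    continuous_sqrt_ofReal.continuousOn.mul hQc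
  have hint : IntervalIntegrable (fun s : ℝ => (Real.sqrt s : ℂ) * Q (a + s * (z - a)))
      volume 0 1 := by
    refine ContinuousOn.intervalIntegrable ?_
    rw [uIcc_of_le zero_le_one]; exact hcont
  have hcre : ContinuousOn (fun s : ℝ => Real.sqrt s * (Q (a + s * (z - a))).re) (Icc 0 1) :=
    Real.continuous_sqrt.continuousOn.mul (continuous_re.comp_continuousOn hQc)
  have hcim : ContinuousOn (fun s : ℝ => Real.sqrt s * (Q (a + s * (z - a))).im) (Icc 0 1) :=
    Real.continuous_sqrt.continuousOn.mul (continuous_im.comp_continuousOn hQc)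
  have hii : ∀ f : ℝ → ℝ, ContinuousOn f (Icc 0 1) → IntervalIntegrable f volume 0 1 := by
    intro f hf
    refine ContinuousOn.intervalIntegrable ?_
    rw [uIcc_of_le zero_le_one]; exact hf
  have hre : (sqrtMean Q a z).re = 3 / 2 * ∫ s in (0 : ℝ)..1,
      Real.sqrt s * (Q (a + s * (z - a))).re := by
    rw [sqrtMean, show (3 / 2 : ℂ) = ((3 / 2 : ℝ) : ℂ) by norm_num, re_ofReal_mul]
    congr 1
    have := ContinuousLinearMap.intervalIntegral_comp_comm (𝕜 := ℝ) reCLM hint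
    simp only [reCLM_apply, re_ofReal_mul] at this
    exact this.symm
  have him : (sqrtMean Q a z).im = 3 / 2 * ∫ s in (0 : ℝ)..1,
      Real.sqrt s * (Q (a + s * (z - a))).im := by
    rw [sqrtMean, show (3 / 2 : ℂ) = ((3 / 2 : ℝ) : ℂ) by norm_num, im_ofReal_mul]
    congr 1
    have := ContinuousLinearMap.intervalIntegral_comp_comm (𝕜 := ℝ) imCLM hint
    simp only [imCLM_apply, im_ofReal_mul] at this
    exact this.symm
  have hsqrt : ∫ s in (0 : ℝ)..1, Real.sqrt s = 2 / 3 := by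
    have h := integral_rpow (a := 0) (b := 1) (r := 1 / 2) (Or.inl (by norm_num))
    simp only [Real.sqrt_eq_rpow]
    rw [h]
    norm_num
  have hk0 : 0 ≤ k := (abs_nonneg _).trans (hsec a ha).choose_spec.1
  have hrelow : m / 2 ≤ (sqrtMean Q a z).re := by
    have : ∫ s in (0 : ℝ)..1, Real.sqrt s * (m / 2) ≤
        ∫ s in (0 : ℝ)..1, Real.sqrt s * (Q (a + s * (z - a))).re := by
      refine intervalIntegral.integral_mono_on zero_le_one (hii _ (by fun_prop)) (hii _ hcre) ?_
      intro t ht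
      have h1 := (hsec _ (hmem t ht)).re_ge_half hk
      have h2 := hlow _ (hmem t ht)
      exact mul_le_mul_of_nonneg_left (by linarith) (Real.sqrt_nonneg _)
    rw [intervalIntegral.integral_mul_const, hsqrt] at this
    rw [hre]; linarith
  have himle : |(sqrtMean Q a z).im| ≤ 2 * k * (sqrtMean Q a z).re := by
    rw [hre, him, abs_mul, abs_of_pos (by norm_num : (0 : ℝ) < 3 / 2), mul_left_comm]
    refine mul_le_mul_of_nonneg_left ?_ (by norm_num)
    rw [← intervalIntegral.integral_const_mul, ← Real.norm_eq_abs]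
    refine intervalIntegral.norm_integral_le_of_norm_le zero_le_one ?_
      (hii _ (continuousOn_const.mul hcre))
    refine Eventually.of_forall fun t ht => ?_
    have ht' : t ∈ Icc (0 : ℝ) 1 := ⟨ht.1.le, ht.2⟩
    have h1 := (hsec _ (hmem t ht')).abs_im_le_re hk
    rw [Real.norm_eq_abs, abs_mul, abs_of_nonneg (Real.sqrt_nonneg _), mul_left_comm]
    exact mul_le_mul_of_nonneg_left h1 (Real.sqrt_nonneg _)
  have hlow' := hrelow.trans (re_le_norm _)
  refine ⟨sec_of_abs_sin (norm_pos_iff.1 (by linarith)) (by linarith) (s := 2 * k) ?_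
    (by linarith), hlow', ?_⟩
  · exact himle.trans (mul_le_mul_of_nonneg_left (re_le_norm _) (by positivity))
  · rw [sqrtMean, norm_mul]
    have h3 : ‖(3 / 2 : ℂ)‖ = 3 / 2 := by
      rw [show (3 / 2 : ℂ) = ((3 / 2 : ℝ) : ℂ) by norm_num, norm_real]; norm_num
    have : ‖∫ s in (0 : ℝ)..1, (Real.sqrt s : ℂ) * Q (a + s * (z - a))‖ ≤
        ∫ s in (0 : ℝ)..1, Real.sqrt s * M := by
      refine intervalIntegral.norm_integral_le_of_norm_le zero_le_one ?_ (hii _ (by fun_prop))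
      refine Eventually.of_forall fun t ht => ?_
      have ht' : t ∈ Icc (0 : ℝ) 1 := ⟨ht.1.le, ht.2⟩
      rw [norm_mul, norm_real, Real.norm_of_nonneg (Real.sqrt_nonneg _)]
      exact mul_le_mul_of_nonneg_left (hup _ (hmem t ht')) (Real.sqrt_nonneg _)
    rw [intervalIntegral.integral_mul_const, hsqrt] at this
    rw [h3]; linarith

end SqrtMean

namespace Regular

variable {P : Data} {ρ m : ℝ}

/-- The neighbourhood of `[0, 1]` on which Langer's variable is holomorphic. -/
abbrev nbhd (ρ : ℝ) : Set ℂ := Metric.thickening ρ unitSeg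

/-- The principal root `((U - c) / (U_c' (w - z_c)))^{1/2}`. -/
def rootQuot (P : Data) (w : ℂ) : ℂ := P.quot w ^ (1 / 2 : ℂ)

/-- The factor `3/2 ∫₀¹ √s (quot (z_c + s (z - z_c)))^{1/2} ds` whose power `2/3` is the
quotient `η (z) / (z - z_c)`. -/
def langerMean (P : Data) (z : ℂ) : ℂ := sqrtMean (rootQuot P) P.zc z

/-- The derivative of Langer's variable. -/
def dEta (P : Data) (z : ℂ) : ℂ := langerMean P z ^ (-(1 / 3) : ℂ) * rootQuot P z

lemma aperture_eq : aperture = 1 / 1000 := rfl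

lemma convex_nbhd : Convex ℝ (nbhd ρ) := convex_unitSeg.thickening ρ

lemma isOpen_nbhd : IsOpen (nbhd ρ) := Metric.isOpen_thickening

lemma sub_mul_quot (w : ℂ) : (w - P.zc) * P.quot w = (P.U w - P.c) / P.dUc := by
  have := sub_smul_dslope P.U P.zc w
  rw [smul_eq_mul] at this
  rw [Data.quot, Data.c, ← this, mul_div_assoc]

lemma rootQuot_sq (w : ℂ) : rootQuot P w ^ 2 = P.quot w := by
  rw [rootQuot, ← cpow_nat_mul]; simp

lemma eta_eq (z : ℂ) : P.eta z = (z - P.zc) * langerMean P z ^ (2 / 3 : ℂ) := rfl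

variable (h : Regular P ρ m)

include h

lemma zc_mem : P.zc ∈ nbhd ρ := by
  rw [Metric.mem_thickening_iff]
  exact ⟨0, ⟨0, by simp, by simp⟩, by simpa using h.zc_lt⟩

lemma ofReal_mem {x : ℝ} (hx : x ∈ Ioo (-ρ) (1 + ρ)) : (x : ℂ) ∈ nbhd ρ := by
  have hρ := h.rho_pos
  rw [Metric.mem_thickening_iff]
  refine ⟨((max 0 (min x 1) : ℝ) : ℂ), ⟨_, ⟨le_max_left _ _, by simp⟩, rfl⟩, ?_⟩
  rw [dist_eq_norm, ← ofReal_sub, norm_real, Real.norm_eq_abs, abs_lt]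
  rcases le_total x 1 with h1 | h1 <;> rcases le_total 0 x with h2 | h2
  · rw [min_eq_left h1, max_eq_right h2]; constructor <;> linarith
  · rw [min_eq_left h1, max_eq_left h2]; constructor <;> linarith [hx.1]
  · rw [min_eq_right h1, max_eq_right zero_le_one]; constructor <;> linarith [hx.2]
  · linarith

lemma unit_subset {x : ℝ} (hx : x ∈ Icc (0 : ℝ) 1) : x ∈ Ioo (-ρ) (1 + ρ) :=
  ⟨by linarith [hx.1, h.rho_pos], by linarith [hx.2, h.rho_pos]⟩

lemma sec_dUc : Sec aperture P.dUc := by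
  have := h.sec _ h.zc_mem; rwa [dslope_same] at this

lemma le_norm_dUc : m ≤ ‖P.dUc‖ := by
  have := h.le_norm _ h.zc_mem; rwa [dslope_same] at this

lemma norm_dUc_le : ‖P.dUc‖ ≤ m⁻¹ := by
  have := h.norm_le _ h.zc_mem; rwa [dslope_same] at this

lemma quot_sec {w : ℂ} (hw : w ∈ nbhd ρ) : Sec (2 * aperture) (P.quot w) := by
  rw [two_mul]; exact (h.sec w hw).div h.sec_dUc

lemma quot_norm {w : ℂ} (hw : w ∈ nbhd ρ) : m ^ 2 ≤ ‖P.quot w‖ ∧ ‖P.quot w‖ ≤ (m⁻¹) ^ 2 := by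
  have hm := h.m_pos
  have hU := h.le_norm_dUc
  have hU' := h.norm_dUc_le
  have h1 := h.le_norm w hw
  have h2 := h.norm_le w hw
  have hpos : 0 < ‖P.dUc‖ := hm.trans_le hU
  rw [Data.quot, norm_div]
  constructor
  · rw [le_div_iff₀ hpos]
    calc m ^ 2 * ‖P.dUc‖ ≤ m ^ 2 * m⁻¹ := by gcongr
      _ = m := by field_simp
      _ ≤ _ := h1
  · rw [div_le_iff₀ hpos]
    calc _ ≤ m⁻¹ := h2
      _ = (m⁻¹) ^ 2 * m := by field_simp
      _ ≤ _ := by gcongr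

lemma quot_diff : DifferentiableOn ℂ P.quot (nbhd ρ) :=
  ((differentiableOn_dslope (isOpen_nbhd.mem_nhds h.zc_mem)).2 h.diff).div_const _

lemma rootQuot_sec {w : ℂ} (hw : w ∈ nbhd ρ) : Sec aperture (rootQuot P w) := by
  have h1 := (h.quot_sec hw).cpow (by rw [aperture_eq]; linarith [Real.pi_gt_three]) (1 / 2)
  rw [show ((1 / 2 : ℝ) : ℂ) = 1 / 2 by norm_num] at h1
  exact h1.mono (by rw [abs_of_pos (by norm_num)]; linarith)

lemma rootQuot_norm {w : ℂ} (hw : w ∈ nbhd ρ) : m ≤ ‖rootQuot P w‖ ∧ ‖rootQuot P w‖ ≤ m⁻¹ := by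
  have h1 := h.quot_norm hw
  rw [← rootQuot_sq w, norm_pow] at h1
  exact ⟨(sq_le_sq₀ h.m_pos.le (norm_nonneg _)).1 h1.1,
    (sq_le_sq₀ (norm_nonneg _) (inv_nonneg.2 h.m_pos.le)).1 h1.2⟩

lemma rootQuot_diff : DifferentiableOn ℂ (rootQuot P) (nbhd ρ) := by
  intro w hw
  exact (h.quot_diff w hw).cpow_const
    ((h.quot_sec hw).mem_slitPlane (by rw [aperture_eq]; linarith [Real.pi_gt_three]))

lemma langerMean_spec {z : ℂ} (hz : z ∈ nbhd ρ) : Sec (4 * aperture) (langerMean P z) ∧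
    m / 2 ≤ ‖langerMean P z‖ ∧ ‖langerMean P z‖ ≤ m⁻¹ :=
  sqrtMean_sec convex_nbhd h.rootQuot_diff.continuousOn h.zc_mem hz
    (by rw [aperture_eq]; norm_num) h.m_pos (fun _ => h.rootQuot_sec) (fun _ hw => (h.rootQuot_norm hw).1)
    (fun _ hw => (h.rootQuot_norm hw).2)

lemma langerMean_slitPlane {z : ℂ} (hz : z ∈ nbhd ρ) : langerMean P z ∈ slitPlane :=
  (h.langerMean_spec hz).1.mem_slitPlane (by rw [aperture_eq]; linarith [Real.pi_gt_three])

lemma hasDerivAt_eta {z : ℂ} (hz : z ∈ nbhd ρ) : HasDerivAt P.eta (dEta P z) z := by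
  obtain ⟨J', hJ, hrel⟩ := exists_hasDerivAt_sqrtMean convex_nbhd isOpen_nbhd h.rootQuot_diff
    h.zc_mem hz
  have hslit := h.langerMean_slitPlane hz
  have h0 : langerMean P z ≠ 0 := slitPlane_ne_zero hslit
  have h1 : HasDerivAt (fun z => (z - P.zc) * langerMean P z ^ (2 / 3 : ℂ))
      (1 * langerMean P z ^ (2 / 3 : ℂ) +
        (z - P.zc) * (2 / 3 * langerMean P z ^ (2 / 3 - 1 : ℂ) * J')) z :=
    ((hasDerivAt_id z).sub_const P.zc).mul (HasDerivAt.cpow_const (c := (2 / 3 : ℂ)) hJ hslit)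
  refine h1.congr_deriv ?_
  have e1 : langerMean P z ^ (2 / 3 : ℂ) = langerMean P z ^ (-(1 / 3) : ℂ) * langerMean P z := by
    rw [show (2 / 3 : ℂ) = -(1 / 3) + 1 by norm_num, cpow_add _ _ h0, cpow_one]
  rw [dEta, hrel, e1, show (2 / 3 - 1 : ℂ) = -(1 / 3) by norm_num, langerMean]
  ring

lemma eta_diff : DifferentiableOn ℂ P.eta (nbhd ρ) := fun _ hz =>
  (h.hasDerivAt_eta hz).differentiableAt.differentiableWithinAt

lemma deriv_eta {z : ℂ} (hz : z ∈ nbhd ρ) : deriv P.eta z = dEta P z :=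
  (h.hasDerivAt_eta hz).deriv

/-- The defining differential equation of Langer's variable. -/
lemma eta_mul_dEta_sq {z : ℂ} (hz : z ∈ nbhd ρ) :
    P.eta z * dEta P z ^ 2 = (z - P.zc) * P.quot z := by
  have h0 : langerMean P z ≠ 0 := slitPlane_ne_zero (h.langerMean_slitPlane hz)
  rw [eta_eq, dEta, mul_pow, rootQuot_sq, ← cpow_nat_mul]
  have : langerMean P z ^ (2 / 3 : ℂ) * langerMean P z ^ (((2 : ℕ) : ℂ) * -(1 / 3)) = 1 := by
    rw [← cpow_add _ _ h0]; norm_num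
  linear_combination (z - P.zc) * P.quot z * this

/-- The quotient `η (z) / (z - z_c)` is close to the positive real axis and bounded both ways. -/
lemma ratio_spec {z : ℂ} (hz : z ∈ nbhd ρ) :
    Sec (3 * aperture) (langerMean P z ^ (2 / 3 : ℂ)) ∧
      m / 2 ≤ ‖langerMean P z ^ (2 / 3 : ℂ)‖ ∧ ‖langerMean P z ^ (2 / 3 : ℂ)‖ ≤ m⁻¹ := by
  obtain ⟨h1, h2, h3⟩ := h.langerMean_spec hz
  have hm := h.m_pos
  have hm1 := h.m_le
  have e : (2 / 3 : ℂ) = ((2 / 3 : ℝ) : ℂ) := by norm_num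
  rw [e, norm_cpow_real]
  refine ⟨(h1.cpow (by rw [aperture_eq]; linarith [Real.pi_gt_three]) _).mono ?_, ?_, ?_⟩
  · rw [abs_of_pos (by norm_num), aperture_eq]; norm_num
  · calc m / 2 = (m / 2) ^ (1 : ℝ) := (Real.rpow_one _).symm
      _ ≤ (m / 2) ^ (2 / 3 : ℝ) :=
        Real.rpow_le_rpow_of_exponent_ge (by linarith) (by linarith) (by norm_num)
      _ ≤ _ := Real.rpow_le_rpow (by linarith) h2 (by norm_num)
  · have hm' : 1 ≤ m⁻¹ := (one_le_inv₀ hm).2 hm1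
    calc _ ≤ (m⁻¹) ^ (2 / 3 : ℝ) := Real.rpow_le_rpow (norm_nonneg _) h3 (by norm_num)
      _ ≤ (m⁻¹) ^ (1 : ℝ) := Real.rpow_le_rpow_of_exponent_le hm' (by norm_num)
      _ = m⁻¹ := Real.rpow_one _

lemma dEta_spec {z : ℂ} (hz : z ∈ nbhd ρ) :
    Sec (3 * aperture) (dEta P z) ∧ m ^ 2 ≤ ‖dEta P z‖ ∧ ‖dEta P z‖ ≤ 2 * (m⁻¹) ^ 2 := by
  obtain ⟨h1, h2, h3⟩ := h.langerMean_spec hz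
  obtain ⟨h4, h5⟩ := h.rootQuot_norm hz
  have hm := h.m_pos
  have hm1 := h.m_le
  have hm' : 1 ≤ m⁻¹ := (one_le_inv₀ hm).2 hm1
  have e : (-(1 / 3) : ℂ) = ((-(1 / 3) : ℝ) : ℂ) := by norm_num
  have hpos := h1.norm_pos
  rw [dEta, e, norm_mul, norm_cpow_real]
  refine ⟨((h1.cpow (by rw [aperture_eq]; linarith [Real.pi_gt_three]) _).mul
    (h.rootQuot_sec hz)).mono ?_, ?_, ?_⟩
  · rw [abs_neg, abs_of_pos (by norm_num), aperture_eq]; norm_num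
  · rw [sq]
    refine mul_le_mul ?_ h4 hm.le (by positivity)
    calc m = (m⁻¹) ^ (-1 : ℝ) := by rw [Real.rpow_neg_one, inv_inv]
      _ ≤ (m⁻¹) ^ (-(1 / 3) : ℝ) := Real.rpow_le_rpow_of_exponent_le hm' (by norm_num)
      _ ≤ _ := Real.rpow_le_rpow_of_nonpos hpos h3 (by norm_num)
  · have : ‖langerMean P z‖ ^ (-(1 / 3) : ℝ) ≤ 2 * m⁻¹ := by
      calc _ ≤ (m / 2) ^ (-(1 / 3) : ℝ) := Real.rpow_le_rpow_of_nonpos (by positivity) h2 (by norm_num)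
        _ ≤ (m / 2) ^ (-1 : ℝ) :=
          Real.rpow_le_rpow_of_exponent_ge (by positivity) (by linarith) (by norm_num)
        _ = 2 * m⁻¹ := by rw [Real.rpow_neg_one]; field_simp
    calc _ ≤ (2 * m⁻¹) * m⁻¹ := by gcongr
      _ = _ := by ring

lemma dEta_diff : DifferentiableOn ℂ (dEta P) (nbhd ρ) :=
  (h.eta_diff.deriv isOpen_nbhd).congr fun _ hz => (h.deriv_eta hz).symm

lemma sqrtDot_eq {z : ℂ} (hz : z ∈ nbhd ρ) : P.sqrtDot z = (dEta P z)⁻¹ ^ (1 / 2 : ℂ) := by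
  rw [Data.sqrtDot, h.deriv_eta hz, one_div]

lemma sqrtDot_sq {z : ℂ} (hz : z ∈ nbhd ρ) : P.sqrtDot z ^ 2 * dEta P z = 1 := by
  rw [h.sqrtDot_eq hz, ← cpow_nat_mul]
  simp [inv_mul_cancel₀ (h.dEta_spec hz).1.ne_zero]

lemma sqrtDot_diff : DifferentiableOn ℂ P.sqrtDot (nbhd ρ) := by
  have : DifferentiableOn ℂ (fun z => (dEta P z)⁻¹ ^ (1 / 2 : ℂ)) (nbhd ρ) := by
    intro z hz
    refine ((h.dEta_diff z hz).inv (h.dEta_spec hz).1.ne_zero).cpow_const ?_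
    exact (h.dEta_spec hz).1.inv.mem_slitPlane (by rw [aperture_eq]; linarith [Real.pi_gt_three])
  exact this.congr fun z hz => h.sqrtDot_eq hz

lemma sqrtDot_norm {z : ℂ} (hz : z ∈ nbhd ρ) : m / 2 ≤ ‖P.sqrtDot z‖ ∧ ‖P.sqrtDot z‖ ≤ m⁻¹ := by
  have h1 := congrArg norm (h.sqrtDot_sq hz)
  rw [norm_mul, norm_pow, norm_one] at h1
  obtain ⟨-, h2, h3⟩ := h.dEta_spec hz
  have hm := h.m_pos
  have hpos : 0 < ‖dEta P z‖ := lt_of_lt_of_le (by positivity) h2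
  have h4 : ‖P.sqrtDot z‖ ^ 2 = ‖dEta P z‖⁻¹ := eq_inv_of_mul_eq_one_left h1
  constructor
  · refine (sq_le_sq₀ (by positivity) (norm_nonneg _)).1 ?_
    rw [h4, le_inv_comm₀ (by positivity) hpos]
    refine h3.trans ?_
    rw [div_pow, inv_div, inv_pow, div_eq_mul_inv]
    gcongr; norm_num
  · refine (sq_le_sq₀ (norm_nonneg _) (by positivity)).1 ?_
    rw [h4, inv_pow]
    exact inv_anti₀ (by positivity) h2

lemma ball_subset {x : ℝ} (hx : x ∈ Icc (0 : ℝ) 1) : Metric.closedBall (x : ℂ) (ρ / 2) ⊆ nbhd ρ := by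
  intro w hw
  rw [Metric.mem_thickening_iff]
  exact ⟨x, ⟨x, hx, rfl⟩, lt_of_le_of_lt hw (by linarith [h.rho_pos])⟩

/-- The bound of the potential in the equation for `ż^{1/2} Ai (δ⁻¹ η)`, by Cauchy's estimate. -/
lemma sqrtDot_potential_le {x : ℝ} (hx : x ∈ Icc (0 : ℝ) 1) :
    ‖iteratedDeriv 2 P.sqrtDot x / P.sqrtDot x‖ ≤ 16 / (ρ ^ 2 * m ^ 2) := by
  have hm := h.m_pos
  have hρ := h.rho_pos
  have h1 : ‖iteratedDeriv 2 P.sqrtDot x‖ ≤ (Nat.factorial 2 : ℝ) * m⁻¹ / (ρ / 2) ^ 2 := by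
    refine norm_iteratedDeriv_le_of_forall_mem_sphere_norm_le 2 (by positivity) ?_ ?_
    · exact (h.sqrtDot_diff.mono ((closure_ball (x : ℂ) (by positivity : ρ / 2 ≠ 0)).symm ▸
        h.ball_subset hx)).diffContOnCl
    · intro z hz
      exact (h.sqrtDot_norm (h.ball_subset hx (Metric.sphere_subset_closedBall hz))).2
  have h2 := (h.sqrtDot_norm (h.ofReal_mem (h.unit_subset hx))).1
  rw [norm_div, div_le_iff₀ (lt_of_lt_of_le (by positivity) h2)]
  refine h1.trans ?_
  calc _ = 16 / (ρ ^ 2 * m ^ 2) * (m / 2) := by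
        norm_num [Nat.factorial]; field_simp; norm_num
    _ ≤ _ := by gcongr

end Regular

/-! ### The growth rate of the lifted Airy functions -/

/-- The critical layer size without its phase, `τ = (α R U_c')^{-1/3}`, so that `δ = e^{-iπ/6} τ`;
its argument is close to zero. -/
def tau (P : Data) : ℂ := ((P.α : ℂ) * P.R * P.dUc) ^ (-(1 / 3) : ℂ)

/-- The rotated Langer variable `e^{iπ/3} δ⁻¹ η = i τ⁻¹ η`, which symmetrizes the roles of `Ai`
and `Ci`. -/
def rotVar (P : Data) (z : ℂ) : ℂ := I * P.eta z / tau P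

/-- The logarithmic growth rate `2/3 Im V^{3/2}` of `Ci (δ⁻¹ η)` in terms of the rotated Langer
variable `V`. -/
def growth (P : Data) (x : ℝ) : ℝ := 2 / 3 * (rotVar P x ^ (3 / 2 : ℂ)).im

/-- The potential `(U - c) / ε = i (x - z_c) quot / τ³` of the equation for `ż^{1/2} Ai (δ⁻¹ η)`. -/
def potential (P : Data) (x : ℝ) : ℂ := I * ((x - P.zc) * P.quot x) / tau P ^ 3

/-- The real part of the principal square root of the potential. -/
def growthRate (P : Data) (x : ℝ) : ℝ :=
  Real.sqrt ((‖potential P x‖ + (potential P x).re) / 2)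

/-- The distance to the critical point in units of `|δ|`. -/
def scaledDist (P : Data) (x : ℝ) : ℝ := ‖(x : ℂ) - P.zc‖ / ‖P.delta‖

/-- The smooth substitute `(1 + |x - z_c|² / |δ|²)^{1/2}` for `1 + |δ⁻¹ η (x)|`. -/
def bracket (P : Data) (x : ℝ) : ℝ := Real.sqrt (1 + scaledDist P x ^ 2)

lemma one_le_bracket (P : Data) (x : ℝ) : 1 ≤ bracket P x := by
  rw [bracket, Real.one_le_sqrt]; nlinarith [sq_nonneg (scaledDist P x)]

lemma bracket_pos (P : Data) (x : ℝ) : 0 < bracket P x := one_pos.trans_le (one_le_bracket P x)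

lemma bracket_sq (P : Data) (x : ℝ) : bracket P x ^ 2 = 1 + scaledDist P x ^ 2 :=
  Real.sq_sqrt (by positivity)

lemma scaledDist_nonneg (P : Data) (x : ℝ) : 0 ≤ scaledDist P x := by
  rw [scaledDist]; positivity

lemma scaledDist_le_bracket (P : Data) (x : ℝ) : scaledDist P x ≤ bracket P x :=
  Real.le_sqrt_of_sq_le (by linarith)

lemma bracket_le (P : Data) (x : ℝ) : bracket P x ≤ 1 + scaledDist P x := by
  have := scaledDist_nonneg P x
  rw [bracket, Real.sqrt_le_left (by linarith)]; nlinarith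

lemma delta_eq (P : Data) : P.delta = exp (-(Real.pi * I / 6)) * tau P := rfl

lemma norm_exp_neg_pi_div_six : ‖exp (-(Real.pi * I / 6))‖ = 1 := by
  rw [show (-(Real.pi * I / 6) : ℂ) = ((-(Real.pi / 6) : ℝ) : ℂ) * I by push_cast; ring,
    norm_exp_ofReal_mul_I]

lemma norm_tau (P : Data) : ‖tau P‖ = ‖P.delta‖ := by
  rw [delta_eq, norm_mul, norm_exp_neg_pi_div_six, one_mul]

lemma eta_div_delta (P : Data) (z : ℂ) : P.eta z / P.delta = airyDir' * rotVar P z := by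
  have h : (exp (-(Real.pi * I / 6)))⁻¹ = airyDir' * I := by
    calc _ = exp (-(Real.pi * I / 3) + Real.pi / 2 * I) := by rw [← exp_neg]; congr 1; ring
      _ = airyDir' * I := by rw [exp_add, exp_pi_div_two_mul_I, airyDir']
  rw [rotVar, delta_eq, div_eq_mul_inv, mul_inv, h]; ring

lemma AiL_eq (P : Data) (x : ℝ) : P.AiL x = Ai (airyDir' * rotVar P x) := by
  rw [Data.AiL, eta_div_delta]

lemma CiL_eq (P : Data) (x : ℝ) :
    P.CiL x = 2 * (Real.pi : ℂ) * exp (Real.pi * I / 6) * Ai (airyDir * rotVar P x) := by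
  rw [Data.CiL, eta_div_delta, Ci]
  congr 2
  rw [← mul_assoc]
  congr 1
  rw [airyDir, airyDir', ← exp_add]; congr 1; ring

/-- The derivative of `w^{3/2}` exists at the branch point too. -/
lemma hasDerivAt_cpow_three_halves {w : ℂ} (hw : w = 0 ∨ w ∈ slitPlane) :
    HasDerivAt (fun w : ℂ => w ^ (3 / 2 : ℂ)) (3 / 2 * w ^ (1 / 2 : ℂ)) w := by
  rcases hw with rfl | hw
  · have h0 : ((0 : ℂ)) ^ (3 / 2 : ℂ) = 0 := by rw [zero_cpow]; norm_num
    have h1 : ((0 : ℂ)) ^ (1 / 2 : ℂ) = 0 := by rw [zero_cpow]; norm_num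
    rw [h1, mul_zero, hasDerivAt_iff_isLittleO_nhds_zero]
    simp only [zero_add, h0, sub_zero, smul_zero]
    rw [Asymptotics.isLittleO_iff]
    intro c hc
    filter_upwards [Metric.ball_mem_nhds (0 : ℂ) (by positivity : 0 < c ^ 2)] with h hh
    rw [mem_ball_zero_iff] at hh
    rw [show (3 / 2 : ℂ) = ((3 / 2 : ℝ) : ℂ) by norm_num, norm_cpow_real,
      show (3 / 2 : ℝ) = 1 / 2 + 1 by norm_num, Real.rpow_add_one' (norm_nonneg _) (by norm_num),
      ← Real.sqrt_eq_rpow]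
    exact mul_le_mul_of_nonneg_right (Real.sqrt_le_iff.2 ⟨hc.le, hh.le⟩) (norm_nonneg _)
  · refine (((hasDerivAt_id w).cpow_const (c := (3 / 2 : ℂ)) hw)).congr_deriv ?_
    simp only [id]; norm_num

/-- The real part of a square root in the right half plane, in terms of its square only. -/
lemma re_eq_sqrt {y : ℂ} (hy : 0 ≤ y.re) : y.re = Real.sqrt ((‖y ^ 2‖ + (y ^ 2).re) / 2) := by
  rw [eq_comm, Real.sqrt_eq_iff_mul_self_eq (by
    have := neg_abs_le (y ^ 2).re
    have := abs_re_le_norm (y ^ 2)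
    linarith) hy, norm_pow, ← normSq_eq_norm_sq, normSq_apply]
  simp [sq]

namespace Regular

variable {P : Data} {ρ m : ℝ} (h : Regular P ρ m)

include h

lemma dUc_ne_zero : P.dUc ≠ 0 := h.sec_dUc.ne_zero

lemma sec_tau : Sec aperture (tau P) := by
  have h1 : Sec (0 + 0 + aperture) ((P.α : ℂ) * P.R * P.dUc) :=
    ((Sec.ofReal h.α_pos).mul (Sec.ofReal h.R_pos)).mul h.sec_dUc
  have h2 := h1.cpow (by rw [aperture_eq]; linarith [Real.pi_gt_three]) (-(1 / 3))
  rw [show ((-(1 / 3) : ℝ) : ℂ) = -(1 / 3) by norm_num] at h2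
  refine h2.mono ?_
  rw [abs_neg, abs_of_pos (by norm_num), aperture_eq]; norm_num

lemma tau_ne_zero : tau P ≠ 0 := h.sec_tau.ne_zero

lemma norm_delta_pos : 0 < ‖P.delta‖ := by rw [← norm_tau]; exact h.sec_tau.norm_pos

lemma delta_ne_zero : P.delta ≠ 0 := norm_pos_iff.1 h.norm_delta_pos

lemma base_ne_zero : (P.α : ℂ) * P.R * P.dUc ≠ 0 := by
  have h1 : (P.α : ℂ) ≠ 0 := by exact_mod_cast h.α_pos.ne'
  have h2 : (P.R : ℂ) ≠ 0 := by exact_mod_cast h.R_pos.ne'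
  exact mul_ne_zero (mul_ne_zero h1 h2) h.dUc_ne_zero

lemma tau_cube : tau P ^ 3 * ((P.α : ℂ) * P.R * P.dUc) = 1 := by
  rw [tau, ← cpow_nat_mul]
  rw [show ((3 : ℕ) : ℂ) * -(1 / 3) = -1 by norm_num, cpow_neg_one]
  exact inv_mul_cancel₀ h.base_ne_zero

lemma delta_cube : P.delta ^ 3 = P.eps / P.dUc := by
  have h1 : (P.α : ℂ) ≠ 0 := by exact_mod_cast h.α_pos.ne'
  have h2 : (P.R : ℂ) ≠ 0 := by exact_mod_cast h.R_pos.ne'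
  have h3 := h.dUc_ne_zero
  have h4 : exp (-(Real.pi * I / 6)) ^ 3 = -I := by
    calc _ = exp (-(Real.pi / 2 * I)) := by rw [← exp_nat_mul]; congr 1; push_cast; ring
      _ = -I := by rw [exp_neg, exp_pi_div_two_mul_I, inv_I]
  have h5 : tau P ^ 3 = 1 / ((P.α : ℂ) * P.R * P.dUc) :=
    eq_div_of_mul_eq h.base_ne_zero h.tau_cube
  rw [delta_eq, mul_pow, h4, h5, Data.eps]
  have hI : I ≠ 0 := I_ne_zero
  field_simp
  rw [I_sq]; ring

lemma eps_ne_zero : P.eps ≠ 0 := by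
  have h1 : (P.α : ℂ) ≠ 0 := by exact_mod_cast h.α_pos.ne'
  have h2 : (P.R : ℂ) ≠ 0 := by exact_mod_cast h.R_pos.ne'
  rw [Data.eps]
  exact one_div_ne_zero (mul_ne_zero (mul_ne_zero I_ne_zero h1) h2)

lemma norm_rotVar {x : ℝ} (hx : x ∈ Ioo (-ρ) (1 + ρ)) :
    m / 2 * scaledDist P x ≤ ‖rotVar P x‖ ∧ ‖rotVar P x‖ ≤ m⁻¹ * scaledDist P x := by
  have hd := h.norm_delta_pos
  obtain ⟨-, h1, h2⟩ := h.ratio_spec (h.ofReal_mem hx)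
  have : ‖rotVar P x‖ = ‖langerMean P x ^ (2 / 3 : ℂ)‖ * scaledDist P x := by
    rw [rotVar, eta_eq, norm_div, norm_mul, norm_mul, norm_I, norm_tau, scaledDist]; ring
  rw [this]
  have := scaledDist_nonneg P x
  constructor <;> gcongr

lemma norm_potential {x : ℝ} (hx : x ∈ Ioo (-ρ) (1 + ρ)) :
    (m / ‖P.delta‖) ^ 2 * scaledDist P x ≤ ‖potential P x‖ ∧
      ‖potential P x‖ ≤ (m⁻¹ / ‖P.delta‖) ^ 2 * scaledDist P x := by
  have hd := h.norm_delta_pos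
  obtain ⟨h1, h2⟩ := h.quot_norm (h.ofReal_mem hx)
  have : ‖potential P x‖ = ‖P.quot x‖ / ‖P.delta‖ ^ 2 * scaledDist P x := by
    rw [potential, norm_div, norm_mul, norm_mul, norm_I, norm_pow, norm_tau, scaledDist]
    field_simp
  rw [this, div_pow, div_pow]
  have := scaledDist_nonneg P x
  constructor <;> gcongr

omit h in
/-- On the favourable side of the critical layer, `i (x - z_c)` lies in a sector slightly larger
than a half plane. -/
lemma sec_I_mul {x : ℝ} (hne : (x : ℂ) - P.zc ≠ 0)
    (hgood : -P.zc.im ≤ aperture * ‖(x : ℂ) - P.zc‖) :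
    Sec (Real.pi / 2 + 2 * aperture) (I * ((x : ℂ) - P.zc)) := by
  refine sec_of_re_ge (mul_ne_zero I_ne_zero hne) (by rw [aperture_eq]; norm_num) ?_
  rw [norm_mul, norm_I, one_mul]
  simp
  linarith

lemma sec_rotVar {x : ℝ} (hx : x ∈ Ioo (-ρ) (1 + ρ)) (hne : (x : ℂ) - P.zc ≠ 0)
    (hgood : -P.zc.im ≤ aperture * ‖(x : ℂ) - P.zc‖) :
    Sec (Real.pi / 2 + 6 * aperture) (rotVar P x) := by
  have h1 := (((sec_I_mul hne hgood).mul (h.ratio_spec (h.ofReal_mem hx)).1).div h.sec_tau)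
  have e : rotVar P x = I * ((x : ℂ) - P.zc) * langerMean P x ^ (2 / 3 : ℂ) / tau P := by
    rw [rotVar, eta_eq]; ring
  rw [e]
  exact h1.mono (by linarith)

lemma sec_potential {x : ℝ} (hx : x ∈ Ioo (-ρ) (1 + ρ)) (hne : (x : ℂ) - P.zc ≠ 0)
    (hgood : -P.zc.im ≤ aperture * ‖(x : ℂ) - P.zc‖) :
    Sec (Real.pi / 2 + 7 * aperture) (potential P x) := by
  have h1 := (((sec_I_mul hne hgood).mul (h.quot_sec (h.ofReal_mem hx))).div
    ((h.sec_tau.mul h.sec_tau).mul h.sec_tau))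
  have e : potential P x = I * ((x : ℂ) - P.zc) * P.quot x / (tau P * tau P * tau P) := by
    rw [potential]; ring
  rw [e]
  exact h1.mono (by linarith)

omit h in
lemma growthRate_nonneg (x : ℝ) : 0 ≤ growthRate P x := Real.sqrt_nonneg _

lemma growthRate_le {x : ℝ} (hx : x ∈ Ioo (-ρ) (1 + ρ)) :
    growthRate P x ≤ m⁻¹ / ‖P.delta‖ * Real.sqrt (scaledDist P x) := by
  have hd := h.norm_delta_pos
  have hm := h.m_pos
  have h1 := (h.norm_potential hx).2
  have h2 := re_le_norm (potential P x)
  calc growthRate P x ≤ Real.sqrt ((m⁻¹ / ‖P.delta‖) ^ 2 * scaledDist P x) :=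
        Real.sqrt_le_sqrt (by linarith)
    _ = _ := by rw [Real.sqrt_mul (by positivity), Real.sqrt_sq (by positivity)]

/-- Off the negative real axis the principal square root has a real part comparable to its
modulus. -/
lemma le_growthRate {x : ℝ} (hx : x ∈ Ioo (-ρ) (1 + ρ))
    (hgood : -P.zc.im ≤ aperture * ‖(x : ℂ) - P.zc‖) :
    m / 2 / ‖P.delta‖ * Real.sqrt (scaledDist P x) ≤ growthRate P x := by
  have hd := h.norm_delta_pos
  have hm := h.m_pos
  by_cases hne : (x : ℂ) - P.zc = 0
  · have : scaledDist P x = 0 := by rw [scaledDist, hne]; simp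
    rw [this]; simpa using growthRate_nonneg x
  have h1 := (h.norm_potential hx).1
  have h2 := (h.sec_potential hx hne hgood).re_ge
    (by rw [aperture_eq]; linarith [Real.pi_gt_three])
  have h3 : -(1 / 2) ≤ Real.cos (Real.pi / 2 + 7 * aperture) := by
    rw [add_comm, Real.cos_add_pi_div_two, neg_le_neg_iff, aperture_eq]
    exact (Real.sin_le (by norm_num)).trans (by norm_num)
  have h4 := mul_le_mul_of_nonneg_left h3 (norm_nonneg (potential P x))
  calc _ = Real.sqrt ((m / 2 / ‖P.delta‖) ^ 2 * scaledDist P x) := by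
        rw [Real.sqrt_mul (by positivity), Real.sqrt_sq (by positivity)]
    _ ≤ growthRate P x := by
        refine Real.sqrt_le_sqrt ?_
        have : (m / 2 / ‖P.delta‖) ^ 2 * scaledDist P x =
          (m / ‖P.delta‖) ^ 2 * scaledDist P x / 4 := by ring
        rw [this]; linarith

lemma rotVar_zero_or_slitPlane {x : ℝ} (hx : x ∈ Ioo (-ρ) (1 + ρ))
    (hgood : -P.zc.im ≤ aperture * ‖(x : ℂ) - P.zc‖) :
    rotVar P x = 0 ∨ rotVar P x ∈ slitPlane := by
  by_cases hne : (x : ℂ) - P.zc = 0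
  · left; rw [rotVar, eta_eq, hne]; simp
  · right
    exact (h.sec_rotVar hx hne hgood).mem_slitPlane
      (by rw [aperture_eq]; linarith [Real.pi_gt_three])

/-- On the favourable side the growth is a primitive of the growth rate; this is the
differential equation of Langer's variable. -/
lemma hasDerivAt_growth {x : ℝ} (hx : x ∈ Ioo (-ρ) (1 + ρ))
    (hgood : -P.zc.im ≤ aperture * ‖(x : ℂ) - P.zc‖) :
    HasDerivAt (growth P) (growthRate P x) x := by
  have hN := h.ofReal_mem hx
  have hτ := h.tau_ne_zero
  have hV : HasDerivAt (rotVar P) (I * dEta P x / tau P) (x : ℂ) :=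
    ((h.hasDerivAt_eta hN).const_mul I).div_const _
  have h1 := (hasDerivAt_cpow_three_halves (h.rotVar_zero_or_slitPlane hx hgood)).comp (x : ℂ) hV
  have h2 : HasDerivAt (fun x : ℝ => rotVar P x ^ (3 / 2 : ℂ))
      (3 / 2 * rotVar P x ^ (1 / 2 : ℂ) * (I * dEta P x / tau P)) x := h1.comp_ofReal
  have h3 : HasDerivAt (growth P)
      (2 / 3 * (3 / 2 * rotVar P x ^ (1 / 2 : ℂ) * (I * dEta P x / tau P)).im) x :=
    (imCLM.hasFDerivAt.comp_hasDerivAt x h2).const_mul (2 / 3 : ℝ)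
  refine h3.congr_deriv ?_
  set y := rotVar P x ^ (1 / 2 : ℂ) * dEta P x / tau P with hy
  have e1 : 3 / 2 * rotVar P x ^ (1 / 2 : ℂ) * (I * dEta P x / tau P) =
      ((3 / 2 : ℝ) : ℂ) * (y * I) := by rw [hy]; push_cast; ring
  have hysq : y ^ 2 = potential P x := by
    have : (rotVar P x ^ (1 / 2 : ℂ)) ^ 2 = rotVar P x := by rw [← cpow_nat_mul]; simp
    rw [hy, div_pow, mul_pow, this, potential, ← h.eta_mul_dEta_sq hN, rotVar]
    field_simp
  have hyre : 0 ≤ y.re := by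
    by_cases hne : (x : ℂ) - P.zc = 0
    · have : rotVar P x = 0 := by rw [rotVar, eta_eq, hne]; simp
      have : y = 0 := by rw [hy, this, zero_cpow (by norm_num)]; simp
      rw [this]; simp
    · have g1 := (h.sec_rotVar hx hne hgood).cpow
        (by rw [aperture_eq]; linarith [Real.pi_gt_three]) (1 / 2)
      rw [show ((1 / 2 : ℝ) : ℂ) = 1 / 2 by norm_num] at g1
      have g2 : Sec (Real.pi / 2) y := ((g1.mul (h.dEta_spec hN).1).div h.sec_tau).mono (by
        rw [abs_of_pos (by norm_num), aperture_eq]; linarith [Real.pi_gt_three])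
      simpa using g2.re_ge (by linarith [Real.pi_gt_three])
  rw [e1, im_ofReal_mul, mul_I_im, re_eq_sqrt hyre, hysq, growthRate]
  ring

lemma continuousOn_growthRate : ContinuousOn (growthRate P) (Ioo (-ρ) (1 + ρ)) := by
  have h1 : ContinuousOn (fun x : ℝ => potential P x) (Ioo (-ρ) (1 + ρ)) := by
    refine ContinuousOn.div_const (continuousOn_const.mul (ContinuousOn.mul (by fun_prop) ?_)) _
    exact h.quot_diff.continuousOn.comp continuous_ofReal.continuousOn fun x hx => h.ofReal_mem hx
  exact Real.continuous_sqrt.comp_continuousOn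
    ((h1.norm.add (continuous_re.comp_continuousOn h1)).div_const 2)

lemma re_zc_mem : P.zc.re ∈ Ioo (-ρ) (1 + ρ) := by
  have h1 := abs_lt.1 ((abs_re_le_norm P.zc).trans_lt h.zc_lt)
  exact ⟨h1.1, by linarith [h1.2]⟩

omit h in
/-- The primitive of the growth rate that vanishes at `Re z_c`. -/
def growthInt (P : Data) (x : ℝ) : ℝ := ∫ t in P.zc.re..x, growthRate P t

lemma hasDerivAt_growthInt {x : ℝ} (hx : x ∈ Ioo (-ρ) (1 + ρ)) :
    HasDerivAt (growthInt P) (growthRate P x) x := by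
  have hsub : uIcc P.zc.re x ⊆ Ioo (-ρ) (1 + ρ) := ordConnected_Ioo.uIcc_subset h.re_zc_mem hx
  exact intervalIntegral.integral_hasDerivAt_right
    (h.continuousOn_growthRate.mono hsub).intervalIntegrable
    (h.continuousOn_growthRate.stronglyMeasurableAtFilter isOpen_Ioo x hx)
    (h.continuousOn_growthRate.continuousAt (isOpen_Ioo.mem_nhds hx))

/-- Both functions are primitives of the growth rate on an interval of favourable points. -/
lemma growth_sub_growthInt_eq {x y : ℝ} (hx : x ∈ Ioo (-ρ) (1 + ρ)) (hy : y ∈ Ioo (-ρ) (1 + ρ))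
    (hgood : ∀ t ∈ uIcc x y, -P.zc.im ≤ aperture * ‖(t : ℂ) - P.zc‖) :
    growth P x - growthInt P x = growth P y - growthInt P y := by
  have hsub : uIcc x y ⊆ Ioo (-ρ) (1 + ρ) := ordConnected_Ioo.uIcc_subset hx hy
  have hd : ∀ t ∈ uIcc x y, HasDerivWithinAt (fun t => growth P t - growthInt P t) 0 (uIcc x y) t :=
    fun t ht => (((h.hasDerivAt_growth (hsub ht) (hgood t ht)).sub
      (h.hasDerivAt_growthInt (hsub ht))).congr_deriv (sub_self _)).hasDerivWithinAt
  have := (convex_uIcc x y).norm_image_sub_le_of_norm_hasDerivWithin_le (C := 0) hd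
    (by simp) left_mem_uIcc right_mem_uIcc
  rw [zero_mul, norm_le_zero_iff] at this
  linarith

end Regular

/-! ### WKB bounds outside of the critical layer -/

/-- The saddle point bound for `Ai (e² V)`, where `e = e^{∓iπ/6}`. -/
lemma norm_Ai_rot_le {e V : ℂ} (he : Sec (Real.pi / 6) e) (hen : ‖e‖ = 1)
    (hV : Sec (Real.pi / 2 + 6 * aperture) V) :
    ‖Ai (e ^ 2 * V)‖ ≤ Real.exp (-(2 / 3 * (e ^ 3 * V ^ (3 / 2 : ℂ)).re)) /
      Real.sqrt (Real.sqrt ‖V‖ / 8) := by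
  have hap : aperture = 1 / 1000 := rfl
  have hpi := Real.pi_gt_three
  set p := e * V ^ (1 / 2 : ℂ) with hp
  have hs := hV.cpow (by rw [hap]; linarith) (1 / 2)
  rw [show ((1 / 2 : ℝ) : ℂ) = 1 / 2 by norm_num] at hs
  have hnorm : ‖p‖ = Real.sqrt ‖V‖ := by
    rw [hp, norm_mul, hen, one_mul, show (1 / 2 : ℂ) = ((1 / 2 : ℝ) : ℂ) by norm_num,
      norm_cpow_real, Real.sqrt_eq_rpow]
  have hpsec : Sec (5 * Real.pi / 12 + 3 * aperture) p := (he.mul hs).mono (by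
    rw [abs_of_pos (by norm_num)]; linarith)
  have hcos : 1 / 8 ≤ Real.cos (5 * Real.pi / 12 + 3 * aperture) := by
    rw [← Real.sin_pi_div_two_sub]
    refine le_trans ?_ (Real.mul_le_sin (by rw [hap]; linarith) (by rw [hap]; linarith))
    rw [hap, div_mul_eq_mul_div, le_div_iff₀ Real.pi_pos]
    linarith
  have hre : Real.sqrt ‖V‖ / 8 ≤ p.re := by
    have := hpsec.re_ge (by rw [hap]; linarith)
    rw [hnorm] at this
    nlinarith [Real.sqrt_nonneg ‖V‖]
  have hVpos : 0 < Real.sqrt ‖V‖ / 8 := by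
    have := Real.sqrt_pos.2 hV.norm_pos
    positivity
  have h2 : p ^ 2 = e ^ 2 * V := by
    rw [hp, mul_pow, ← cpow_nat_mul]; simp
  have h3 : p ^ 3 = e ^ 3 * V ^ (3 / 2 : ℂ) := by
    rw [hp, mul_pow, ← cpow_nat_mul]; congr 2; norm_num
  have := norm_Ai_sq_le (hVpos.trans_le hre)
  rw [h2, h3] at this
  refine this.trans ?_
  gcongr

lemma sec_exp_pi_div_six : Sec (Real.pi / 6) (exp (Real.pi * I / 6)) := by
  have := Sec.exp_mul_I (Real.pi / 6)
  rw [abs_of_pos (by positivity)] at this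
  convert this using 2; push_cast; ring

lemma sec_exp_neg_pi_div_six : Sec (Real.pi / 6) (exp (-(Real.pi * I / 6))) := by
  rw [exp_neg]; exact sec_exp_pi_div_six.inv

lemma norm_exp_pi_div_six : ‖exp (Real.pi * I / 6)‖ = 1 := by
  have := norm_exp_neg_pi_div_six
  rw [exp_neg, norm_inv, inv_eq_one] at this
  exact this

lemma exp_pi_div_six_sq : exp (Real.pi * I / 6) ^ 2 = airyDir := by
  rw [airyDir, ← exp_nat_mul]; congr 1; push_cast; ring

lemma exp_neg_pi_div_six_sq : exp (-(Real.pi * I / 6)) ^ 2 = airyDir' := by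
  rw [airyDir', ← exp_nat_mul]; congr 1; push_cast; ring

lemma exp_pi_div_six_cube : exp (Real.pi * I / 6) ^ 3 = I := by
  conv_rhs => rw [← exp_pi_div_two_mul_I]
  rw [← exp_nat_mul]; congr 1; push_cast; ring

lemma exp_neg_pi_div_six_cube : exp (-(Real.pi * I / 6)) ^ 3 = -I := by
  rw [exp_neg, inv_pow, exp_pi_div_six_cube, inv_I]

/-- Uniform bounds in the inner region `|x - z_c| ≤ K |δ|`. -/
lemma exists_inner_bound (m K : ℝ) : ∃ B > 0, ∀ (P : Data) (ρ : ℝ), Regular P ρ m →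
    ∀ x ∈ Ioo (-ρ) (1 + ρ), scaledDist P x ≤ K →
      ‖P.AiL x‖ ≤ B ∧ ‖P.CiL x‖ ≤ B ∧ |growth P x| ≤ B := by
  have hc1 : Continuous fun w : ℂ => Ai (airyDir' * w) := continuous_Ai.comp (by fun_prop)
  have hc2 : Continuous fun w : ℂ => 2 * (Real.pi : ℂ) * exp (Real.pi * I / 6) *
      Ai (airyDir * w) := continuous_const.mul (continuous_Ai.comp (by fun_prop))
  obtain ⟨B₁, hB₁⟩ := (isCompact_closedBall (0 : ℂ) (m⁻¹ * K)).exists_bound_of_continuousOn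
    hc1.continuousOn
  obtain ⟨B₂, hB₂⟩ := (isCompact_closedBall (0 : ℂ) (m⁻¹ * K)).exists_bound_of_continuousOn
    hc2.continuousOn
  refine ⟨max (max B₁ B₂) (max 1 ((m⁻¹ * K) ^ (3 / 2 : ℝ))), by positivity, ?_⟩
  intro P ρ h x hx hK
  have hm := h.m_pos
  have hV : ‖rotVar P x‖ ≤ m⁻¹ * K := (h.norm_rotVar hx).2.trans (by gcongr)
  have hmem : rotVar P x ∈ Metric.closedBall (0 : ℂ) (m⁻¹ * K) := by simpa using hV
  refine ⟨?_, ?_, ?_⟩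
  · rw [AiL_eq]; exact (hB₁ _ hmem).trans ((le_max_left _ _).trans (le_max_left _ _))
  · rw [CiL_eq]; exact (hB₂ _ hmem).trans ((le_max_right _ _).trans (le_max_left _ _))
  · refine le_trans ?_ ((le_max_right _ _).trans (le_max_right _ _))
    rw [growth, abs_mul, abs_of_pos (by norm_num : (0 : ℝ) < 2 / 3)]
    have h1 : |(rotVar P x ^ (3 / 2 : ℂ)).im| ≤ (m⁻¹ * K) ^ (3 / 2 : ℝ) := by
      refine (abs_im_le_norm _).trans ?_
      rw [show (3 / 2 : ℂ) = ((3 / 2 : ℝ) : ℂ) by norm_num, norm_cpow_real]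
      gcongr
    have := abs_nonneg (rotVar P x ^ (3 / 2 : ℂ)).im
    linarith

/-- WKB bounds in the outer region. -/
lemma exists_outer_bound {m : ℝ} (hm : 0 < m) : ∃ B > 0, ∀ (P : Data) (ρ : ℝ), Regular P ρ m →
    ∀ x ∈ Ioo (-ρ) (1 + ρ), 1 ≤ scaledDist P x → -P.zc.im ≤ aperture * ‖(x : ℂ) - P.zc‖ →
      ‖P.AiL x‖ ≤ B * bracket P x ^ (-(1 / 4) : ℝ) * Real.exp (-growth P x) ∧
      ‖P.CiL x‖ ≤ B * bracket P x ^ (-(1 / 4) : ℝ) * Real.exp (growth P x) := by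
  set B₀ := (Real.sqrt (Real.sqrt (m / 4) / 8))⁻¹ with hB₀
  have hB₀pos : 0 < B₀ := by positivity
  refine ⟨2 * Real.pi * B₀, by positivity, ?_⟩
  intro P ρ h x hx ht hgood
  have hd := h.norm_delta_pos
  have hne : (x : ℂ) - P.zc ≠ 0 := by
    intro h0
    rw [scaledDist, h0] at ht; simp at ht; linarith
  have hsec := h.sec_rotVar hx hne hgood
  have hVD : m / 4 * bracket P x ≤ ‖rotVar P x‖ := by
    refine le_trans ?_ (h.norm_rotVar hx).1
    have := bracket_le P x
    nlinarith
  have hDpos := bracket_pos P x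
  have hroot : (Real.sqrt (Real.sqrt ‖rotVar P x‖ / 8))⁻¹ ≤ B₀ * bracket P x ^ (-(1 / 4) : ℝ) := by
    have e1 : bracket P x ^ (-(1 / 4) : ℝ) = (Real.sqrt (Real.sqrt (bracket P x)))⁻¹ := by
      rw [Real.rpow_neg hDpos.le, Real.sqrt_eq_rpow, Real.sqrt_eq_rpow, ← Real.rpow_mul hDpos.le]
      norm_num
    rw [e1, hB₀, ← mul_inv, ← Real.sqrt_mul (by positivity)]
    refine inv_anti₀ (by positivity) (Real.sqrt_le_sqrt ?_)
    rw [div_mul_eq_mul_div, ← Real.sqrt_mul (by positivity)]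
    exact div_le_div_of_nonneg_right (Real.sqrt_le_sqrt hVD) (by norm_num)
  have hrp : 0 ≤ bracket P x ^ (-(1 / 4) : ℝ) := by positivity
  have hpi := Real.pi_gt_three
  constructor
  · have h1 := norm_Ai_rot_le sec_exp_neg_pi_div_six norm_exp_neg_pi_div_six hsec
    rw [exp_neg_pi_div_six_sq, exp_neg_pi_div_six_cube, ← AiL_eq] at h1
    have e2 : -(2 / 3 * (-I * rotVar P x ^ (3 / 2 : ℂ)).re) = -growth P x := by
      rw [growth]; simp
    rw [e2, div_eq_inv_mul] at h1
    refine h1.trans (mul_le_mul_of_nonneg_right (hroot.trans ?_) (Real.exp_pos _).le)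
    refine mul_le_mul_of_nonneg_right ?_ hrp
    nlinarith
  · have h1 := norm_Ai_rot_le sec_exp_pi_div_six norm_exp_pi_div_six hsec
    rw [exp_pi_div_six_sq, exp_pi_div_six_cube] at h1
    have e2 : -(2 / 3 * (I * rotVar P x ^ (3 / 2 : ℂ)).re) = growth P x := by
      rw [growth]; simp
    rw [e2, div_eq_inv_mul] at h1
    rw [CiL_eq, norm_mul, norm_mul, norm_exp_pi_div_six, mul_one]
    have e3 : ‖(2 * Real.pi : ℂ)‖ = 2 * Real.pi := by simp [abs_of_pos Real.pi_pos]
    rw [e3]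
    calc 2 * Real.pi * ‖Ai (airyDir * rotVar P x)‖ ≤ 2 * Real.pi *
          (B₀ * bracket P x ^ (-(1 / 4) : ℝ) * Real.exp (growth P x)) := by
          gcongr
          exact h1.trans (mul_le_mul_of_nonneg_right hroot (Real.exp_pos _).le)
      _ = _ := by ring

/-- Radius, in units of `|δ|`, outside of which `Im z_c ≥ -M |δ|` is a sectorial condition. -/
def coreRadius (M : ℝ) : ℝ := M / aperture + 1

lemma one_le_coreRadius {M : ℝ} (hM : 0 ≤ M) : 1 ≤ coreRadius M := by
  have : 0 ≤ M / aperture := div_nonneg hM (by norm_num [aperture])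
  rw [coreRadius]; linarith

lemma le_coreRadius {M : ℝ} (hM : 0 ≤ M) : M ≤ aperture * coreRadius M ∧ M ≤ coreRadius M := by
  rw [coreRadius, aperture]
  constructor <;> norm_num <;> linarith

lemma Regular.good_of_le {P : Data} {ρ m M : ℝ} (h : Regular P ρ m) (hM : 0 ≤ M)
    (him : -M * ‖P.delta‖ ≤ P.zc.im) {x : ℝ} (hx : coreRadius M ≤ scaledDist P x) :
    -P.zc.im ≤ aperture * ‖(x : ℂ) - P.zc‖ := by
  have hd := h.norm_delta_pos
  rw [scaledDist, le_div_iff₀ hd] at hx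
  have h1 := (le_coreRadius hM).1
  have hap : (0 : ℝ) < aperture := by norm_num [aperture]
  nlinarith [mul_le_mul_of_nonneg_left hx hap.le, mul_le_mul_of_nonneg_right h1 hd.le]

/-- Outside of a core of size `O(|δ|)` the growth is the primitive of the growth rate, up to a
constant common to both sides of the core and up to a bounded error. When `Im z_c < 0` the
branch of `V^{3/2}` is cut inside the core, where both functions vary by a bounded amount. -/
lemma exists_growth_comparison (m : ℝ) {M : ℝ} (hM : 0 ≤ M) : ∃ C > 0, ∀ (P : Data) (ρ : ℝ),
    Regular P ρ m → -M * ‖P.delta‖ ≤ P.zc.im → ∃ k : ℝ, ∀ x ∈ Ioo (-ρ) (1 + ρ),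
      (-P.zc.im ≤ aperture * ‖(x : ℂ) - P.zc‖ ∧ 1 ≤ scaledDist P x ∧
        |growth P x - (Regular.growthInt P x + k)| ≤ C) ∨
      (scaledDist P x ≤ 2 * coreRadius M ∧ |Regular.growthInt P x + k| ≤ C) := by
  set K := coreRadius M with hK
  have hK1 : 1 ≤ K := one_le_coreRadius hM
  obtain ⟨B, hB, hin⟩ := exists_inner_bound m (2 * K)
  set B' := K * (|m⁻¹| * Real.sqrt (2 * K)) with hB'
  have hB'0 : 0 ≤ B' := by positivity
  refine ⟨B + B', by positivity, ?_⟩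
  intro P ρ h him
  have hd := h.norm_delta_pos
  have hm := h.m_pos
  rcases le_or_gt 0 P.zc.im with h0 | h0
  · have hgood : ∀ t : ℝ, -P.zc.im ≤ aperture * ‖(t : ℂ) - P.zc‖ := fun t => by
      have : 0 ≤ aperture * ‖(t : ℂ) - P.zc‖ := mul_nonneg (by norm_num [aperture]) (norm_nonneg _)
      linarith
    refine ⟨growth P P.zc.re, fun x hx => ?_⟩
    have heq : growth P x = Regular.growthInt P x + growth P P.zc.re := by
      have h1 := h.growth_sub_growthInt_eq hx h.re_zc_mem fun t _ => hgood t
      have h2 : Regular.growthInt P P.zc.re = 0 := intervalIntegral.integral_same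
      linarith
    rcases le_or_gt 1 (scaledDist P x) with h1 | h1
    · left
      refine ⟨hgood x, h1, ?_⟩
      rw [heq, sub_self, abs_zero]; positivity
    · right
      have h2 : scaledDist P x ≤ 2 * K := by linarith
      refine ⟨h2, ?_⟩
      rw [← heq]
      linarith [(hin P ρ h x hx h2).2.2]
  · -- the core `|x - Re z_c| ≤ K |δ|`
    have hdist : ∀ t : ℝ, |t - P.zc.re| ≤ ‖(t : ℂ) - P.zc‖ := fun t => by
      have := abs_re_le_norm ((t : ℂ) - P.zc); simpa using this
    have hcore : ∀ t : ℝ, |t - P.zc.re| ≤ K * ‖P.delta‖ → scaledDist P t ≤ 2 * K := by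
      intro t ht
      rw [scaledDist, div_le_iff₀ hd]
      have h1 := norm_le_abs_re_add_abs_im ((t : ℂ) - P.zc)
      simp only [sub_re, ofReal_re, sub_im, ofReal_im, zero_sub, abs_neg] at h1
      rw [abs_of_neg h0] at h1
      have h2 := mul_le_mul_of_nonneg_right (le_coreRadius hM).2 hd.le
      linarith
    have hint : ∀ x ∈ Ioo (-ρ) (1 + ρ), |x - P.zc.re| ≤ K * ‖P.delta‖ →
        |Regular.growthInt P x| ≤ B' := by
      intro x hx hxc
      have h1 : ‖∫ t in P.zc.re..x, growthRate P t‖ ≤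
          (m⁻¹ / ‖P.delta‖ * Real.sqrt (2 * K)) * |x - P.zc.re| := by
        refine intervalIntegral.norm_integral_le_of_norm_le_const fun t ht => ?_
        have ht' := uIoc_subset_uIcc ht
        have h2 : |t - P.zc.re| ≤ |x - P.zc.re| := abs_sub_left_of_mem_uIcc ht'
        have h3 := ordConnected_Ioo.uIcc_subset h.re_zc_mem hx ht'
        rw [Real.norm_of_nonneg (Regular.growthRate_nonneg t)]
        refine (h.growthRate_le h3).trans ?_
        have := hcore t (h2.trans hxc)
        gcongr
      rw [Regular.growthInt, ← Real.norm_eq_abs]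
      refine h1.trans ?_
      calc _ ≤ (m⁻¹ / ‖P.delta‖ * Real.sqrt (2 * K)) * (K * ‖P.delta‖) := by gcongr
        _ = B' := by rw [hB', abs_of_pos (by positivity)]; field_simp
    refine ⟨0, fun x hx => ?_⟩
    rw [add_zero]
    rcases le_or_gt |x - P.zc.re| (K * ‖P.delta‖) with hxc | hxc
    · right
      exact ⟨hcore x hxc, by linarith [hint x hx hxc]⟩
    · left
      have hfar : ∀ t : ℝ, K * ‖P.delta‖ ≤ |t - P.zc.re| → K ≤ scaledDist P t := by
        intro t ht
        rw [scaledDist, le_div_iff₀ hd]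
        exact ht.trans (hdist t)
      have hxK := hfar x hxc.le
      refine ⟨h.good_of_le hM him hxK, hK1.trans hxK, ?_⟩
      have hKd : 0 < K * ‖P.delta‖ := by positivity
      obtain ⟨y, hy, hyc, hyx⟩ : ∃ y ∈ Ioo (-ρ) (1 + ρ), |y - P.zc.re| = K * ‖P.delta‖ ∧
          ∀ t ∈ uIcc x y, K * ‖P.delta‖ ≤ |t - P.zc.re| := by
        have hre := h.re_zc_mem
        rcases lt_abs.1 hxc with h1 | h1
        · refine ⟨P.zc.re + K * ‖P.delta‖, ⟨by linarith [hre.1], by linarith [hx.2]⟩, ?_, ?_⟩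
          · rw [add_sub_cancel_left, abs_of_pos hKd]
          · intro t ht
            rw [uIcc_of_ge (by linarith)] at ht
            exact le_abs.2 (Or.inl (by linarith [ht.1]))
        · refine ⟨P.zc.re - K * ‖P.delta‖, ⟨by linarith [hx.1], by linarith [hre.2]⟩, ?_, ?_⟩
          · rw [sub_sub_cancel_left, abs_neg, abs_of_pos hKd]
          · intro t ht
            rw [uIcc_of_le (by linarith)] at ht
            exact le_abs.2 (Or.inr (by linarith [ht.2]))
      rw [h.growth_sub_growthInt_eq hx hy fun t ht => h.good_of_le hM him (hfar t (hyx t ht))]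
      have h3 := (hin P ρ h y hy (hcore y hyc.le)).2.2
      have h4 := hint y hy hyc.le
      exact (abs_sub _ _).trans (by linarith)

/-! ### Exponential weights -/

/-- `Φ` is an admissible exponential weight for the data: `Ai (δ⁻¹ η)` decays like `e^{-Φ}`,
`Ci (δ⁻¹ η)` grows at most like `e^Φ`, and the derivative `φ` of `Φ` exceeds the WKB rate by enough
to absorb the logarithmic derivatives of the powers of the bracket that occur. -/
structure Weight (P : Data) (c C : ℝ) (Φ φ : ℝ → ℝ) : Prop where
  deriv : ∀ x ∈ Icc (0 : ℝ) 1, HasDerivAt Φ (φ x) x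
  le_rate : ∀ x ∈ Icc (0 : ℝ) 1,
    (c * Real.sqrt (bracket P x) + 2 / bracket P x) / ‖P.delta‖ ≤ φ x
  Ai_le : ∀ x ∈ Icc (0 : ℝ) 1,
    ‖P.AiL x‖ ≤ C * bracket P x ^ (-(1 / 4) : ℝ) * Real.exp (-Φ x)
  Ci_le : ∀ x ∈ Icc (0 : ℝ) 1,
    ‖P.CiL x‖ ≤ C * bracket P x ^ (-(1 / 4) : ℝ) * Real.exp (Φ x)

/-- The rate of growth, completed in the core by the derivative of a large multiple of a bounded
function, dominates the bracket. -/
lemma exists_rate_bound {m : ℝ} (hm : 0 < m) {K : ℝ} (hK : 1 ≤ K) : ∃ B > 0, ∀ t D g : ℝ,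
    0 ≤ t → 0 ≤ g → 1 ≤ D → D ≤ 1 + t → (K ≤ t → m / 2 * Real.sqrt t ≤ g) →
      m / 8 * Real.sqrt D + 2 / D ≤ g + B / D ^ 2 := by
  refine ⟨m / 8 * (1 + K) ^ 3 + 2 * (1 + K) + 32 / m, by positivity, ?_⟩
  intro t D g ht hg hD hDt hgt
  set B := m / 8 * (1 + K) ^ 3 + 2 * (1 + K) + 32 / m with hB
  have hDpos : 0 < D := by linarith
  have hsD : 1 ≤ Real.sqrt D := Real.one_le_sqrt.2 hD
  have hsD2 : Real.sqrt D ≤ D := by rw [Real.sqrt_le_left hDpos.le]; nlinarith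
  rcases le_or_gt K t with hKt | hKt
  · have h1 : Real.sqrt D / 2 ≤ Real.sqrt t := by
      refine Real.le_sqrt_of_sq_le ?_
      rw [div_pow, Real.sq_sqrt hDpos.le]; linarith
    have h2 : m / 4 * Real.sqrt D ≤ g := by
      have := hgt hKt
      nlinarith
    have h3 : 2 / D ≤ m / 8 * Real.sqrt D + B / D ^ 2 := by
      rcases le_or_gt (16 / m) D with h4 | h4
      · have h5 : 2 / D ≤ m / 8 := by
          rw [div_le_iff₀ hDpos]
          rw [div_le_iff₀ hm] at h4
          linarith
        have h6 : 0 ≤ B / D ^ 2 := by positivity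
        nlinarith
      · have h5 : 2 / D ≤ B / D ^ 2 := by
          rw [div_le_div_iff₀ hDpos (by positivity)]
          have : 2 * D ≤ B := by
            have : 0 ≤ m / 8 * (1 + K) ^ 3 + 2 * (1 + K) := by positivity
            have : 32 / m = 2 * (16 / m) := by ring
            linarith
          nlinarith
        have : 0 ≤ m / 8 * Real.sqrt D := by positivity
        linarith
    linarith
  · have hDK : D ≤ 1 + K := by linarith
    have h5 : m / 8 * Real.sqrt D + 2 / D ≤ B / D ^ 2 := by
      rw [le_div_iff₀ (by positivity), add_mul]
      have e1 : 2 / D * D ^ 2 = 2 * D := by field_simp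
      have e2 : m / 8 * Real.sqrt D * D ^ 2 ≤ m / 8 * (1 + K) ^ 3 := by
        calc m / 8 * Real.sqrt D * D ^ 2 ≤ m / 8 * (1 + K) * (1 + K) ^ 2 := by
              gcongr; linarith
          _ = _ := by ring
      have : 0 < 32 / m := by positivity
      rw [e1]; linarith
    linarith

/-- The weight is the primitive of the growth rate plus a large multiple of
`arctan ((x - Re z_c) / |δ|)`. The latter is bounded, so that it changes the exponentials by a
constant factor only, and its derivative is large in the core, where the growth rate may vanish. -/
lemma exists_weight {m : ℝ} (hm : 0 < m) {M : ℝ} (hM : 0 ≤ M) : ∃ c > 0, ∃ C > 0,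
    ∀ (P : Data) (ρ : ℝ), Regular P ρ m → -M * ‖P.delta‖ ≤ P.zc.im →
      ∃ Φ φ : ℝ → ℝ, Weight P c C Φ φ := by
  set K := coreRadius M with hK
  have hK1 : 1 ≤ K := one_le_coreRadius hM
  obtain ⟨C₀, hC₀, hcomp⟩ := exists_growth_comparison m hM
  obtain ⟨B₁, hB₁, hin⟩ := exists_inner_bound m (2 * K)
  obtain ⟨B₂, hB₂, hout⟩ := exists_outer_bound hm
  obtain ⟨B, hB, hrate⟩ := exists_rate_bound hm hK1
  set E := Real.exp (C₀ + B * (Real.pi / 2)) with hE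
  refine ⟨m / 8, by positivity, (B₁ * (1 + 2 * K) + B₂) * E, by positivity, ?_⟩
  intro P ρ h him
  have hd := h.norm_delta_pos
  obtain ⟨k, hk⟩ := hcomp P ρ h him
  set A : ℝ → ℝ := fun x => B * Real.arctan ((x - P.zc.re) / ‖P.delta‖) with hA
  set A' : ℝ → ℝ := fun x => B * (1 / (1 + ((x - P.zc.re) / ‖P.delta‖) ^ 2) * (1 / ‖P.delta‖))
    with hA'
  have hAle : ∀ x, |A x| ≤ B * (Real.pi / 2) := fun x => by
    rw [hA, abs_mul, abs_of_pos hB]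
    refine mul_le_mul_of_nonneg_left (abs_le.2 ?_) hB.le
    exact ⟨(Real.neg_pi_div_two_lt_arctan _).le, (Real.arctan_lt_pi_div_two _).le⟩
  -- both bounds follow from the comparison of `Φ` with the growth, or from boundedness of `Φ`
  have hbound : ∀ x ∈ Icc (0 : ℝ) 1, ∀ (y s : ℝ), (s = 1 ∨ s = -1) →
      (scaledDist P x ≤ 2 * K → y ≤ B₁) →
      (1 ≤ scaledDist P x → -P.zc.im ≤ aperture * ‖(x : ℂ) - P.zc‖ →
        y ≤ B₂ * bracket P x ^ (-(1 / 4) : ℝ) * Real.exp (s * growth P x)) →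
      y ≤ (B₁ * (1 + 2 * K) + B₂) * E * bracket P x ^ (-(1 / 4) : ℝ) *
        Real.exp (s * (Regular.growthInt P x + k + A x)) := by
    intro x hx y s hs hy1 hy2
    have hD := one_le_bracket P x
    have hDp : 0 < bracket P x ^ (-(1 / 4) : ℝ) := by have := bracket_pos P x; positivity
    have hAx := abs_le.1 (hAle x)
    rcases hk x (h.unit_subset hx) with ⟨h1, h2, h3⟩ | ⟨h1, h2⟩
    · have h4 : s * growth P x ≤ C₀ + B * (Real.pi / 2) +
          s * (Regular.growthInt P x + k + A x) := by
        have h3' := abs_le.1 h3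
        rcases hs with rfl | rfl <;> linarith [h3'.1, h3'.2, hAx.1, hAx.2]
      calc y ≤ B₂ * bracket P x ^ (-(1 / 4) : ℝ) * Real.exp (s * growth P x) := hy2 h2 h1
        _ ≤ B₂ * bracket P x ^ (-(1 / 4) : ℝ) * (E *
            Real.exp (s * (Regular.growthInt P x + k + A x))) := by
            rw [hE, ← Real.exp_add]
            gcongr
        _ = B₂ * (E * bracket P x ^ (-(1 / 4) : ℝ) *
            Real.exp (s * (Regular.growthInt P x + k + A x))) := by ring
        _ ≤ (B₁ * (1 + 2 * K) + B₂) * (E * bracket P x ^ (-(1 / 4) : ℝ) *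
            Real.exp (s * (Regular.growthInt P x + k + A x))) := by
            gcongr
            have : 0 ≤ B₁ * (1 + 2 * K) := by positivity
            linarith
        _ = _ := by ring
    · have h4 : 0 ≤ C₀ + B * (Real.pi / 2) + s * (Regular.growthInt P x + k + A x) := by
        have h2' := abs_le.1 h2
        rcases hs with rfl | rfl <;> linarith [h2'.1, h2'.2, hAx.1, hAx.2]
      have h5 : 1 ≤ (1 + 2 * K) * bracket P x ^ (-(1 / 4) : ℝ) := by
        have hDK : bracket P x ≤ 1 + 2 * K := (bracket_le P x).trans (by linarith)
        have h6 : (1 + 2 * K)⁻¹ ≤ bracket P x ^ (-(1 / 4) : ℝ) := by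
          calc (1 + 2 * K)⁻¹ ≤ (bracket P x)⁻¹ := inv_anti₀ (by linarith) hDK
            _ = bracket P x ^ (-1 : ℝ) := (Real.rpow_neg_one _).symm
            _ ≤ _ := Real.rpow_le_rpow_of_exponent_le hD (by norm_num)
        have h7 : (0 : ℝ) < 1 + 2 * K := by linarith
        rwa [inv_le_iff_one_le_mul₀' h7] at h6
      have h6 : 1 ≤ E * Real.exp (s * (Regular.growthInt P x + k + A x)) := by
        rw [hE, ← Real.exp_add]; exact Real.one_le_exp h4
      calc y ≤ B₁ * (1 * 1) := by rw [mul_one, mul_one]; exact hy1 h1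
        _ ≤ B₁ * (((1 + 2 * K) * bracket P x ^ (-(1 / 4) : ℝ)) *
            (E * Real.exp (s * (Regular.growthInt P x + k + A x)))) := by gcongr
        _ = (B₁ * (1 + 2 * K)) * (E * bracket P x ^ (-(1 / 4) : ℝ) *
            Real.exp (s * (Regular.growthInt P x + k + A x))) := by ring
        _ ≤ (B₁ * (1 + 2 * K) + B₂) * (E * bracket P x ^ (-(1 / 4) : ℝ) *
            Real.exp (s * (Regular.growthInt P x + k + A x))) := by gcongr; linarith
        _ = _ := by ring
  refine ⟨fun x => Regular.growthInt P x + k + A x, fun x => growthRate P x + A' x, ?_, ?_, ?_, ?_⟩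
  · intro x hx
    refine ((h.hasDerivAt_growthInt (h.unit_subset hx)).add_const k).add ?_
    exact (((((hasDerivAt_id x).sub_const P.zc.re).div_const ‖P.delta‖).arctan).const_mul B)
  · intro x hx
    have hxI := h.unit_subset hx
    have h1 := hrate (scaledDist P x) (bracket P x) (‖P.delta‖ * growthRate P x)
      (scaledDist_nonneg P x) (mul_nonneg hd.le (Regular.growthRate_nonneg x)) (one_le_bracket P x)
      (bracket_le P x) (fun hKt => by
        have := h.le_growthRate hxI (h.good_of_le hM him hKt)
        calc m / 2 * Real.sqrt (scaledDist P x) =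
            ‖P.delta‖ * (m / 2 / ‖P.delta‖ * Real.sqrt (scaledDist P x)) := by field_simp
          _ ≤ _ := by gcongr)
    have h2 : B / bracket P x ^ 2 ≤ ‖P.delta‖ * A' x := by
      have h3 : ‖P.delta‖ * A' x = B / (1 + ((x - P.zc.re) / ‖P.delta‖) ^ 2) := by
        rw [hA']; field_simp
      rw [h3, bracket_sq]
      have h4 : ((x - P.zc.re) / ‖P.delta‖) ^ 2 ≤ scaledDist P x ^ 2 := by
        rw [← sq_abs, abs_div, abs_norm, scaledDist]
        have := abs_re_le_norm ((x : ℂ) - P.zc)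
        simp only [sub_re, ofReal_re] at this
        gcongr
      gcongr
    rw [div_le_iff₀ hd]
    linarith
  · intro x hx
    have := hbound x hx ‖P.AiL x‖ (-1) (Or.inr rfl)
      (fun ht => (hin P ρ h x (h.unit_subset hx) ht).1)
      (fun ht hg => by
        have := (hout P ρ h x (h.unit_subset hx) ht hg).1
        rwa [neg_one_mul])
    rwa [neg_one_mul] at this
  · intro x hx
    have := hbound x hx ‖P.CiL x‖ 1 (Or.inl rfl)
      (fun ht => (hin P ρ h x (h.unit_subset hx) ht).2.1)
      (fun ht hg => by
        have := (hout P ρ h x (h.unit_subset hx) ht hg).2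
        rwa [one_mul])
    rwa [one_mul] at this

lemma continuous_bracket (P : Data) : Continuous (bracket P) := by
  unfold bracket scaledDist
  fun_prop

/-- The bracket is Lipschitz with constant `|δ|⁻¹`. -/
lemma exists_hasDerivAt_bracket {P : Data} (hd : 0 < ‖P.delta‖) (x : ℝ) :
    ∃ D' : ℝ, |D'| ≤ 1 / ‖P.delta‖ ∧ HasDerivAt (bracket P) D' x := by
  have hD := bracket_pos P x
  have e : bracket P = fun x : ℝ =>
      Real.sqrt (1 + ((x - P.zc.re) ^ 2 + P.zc.im ^ 2) / ‖P.delta‖ ^ 2) := by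
    funext x
    rw [bracket, scaledDist, div_pow, ← normSq_eq_norm_sq ((x : ℂ) - P.zc), normSq_apply]
    simp [sq]
  have hne : 1 + ((x - P.zc.re) ^ 2 + P.zc.im ^ 2) / ‖P.delta‖ ^ 2 ≠ 0 := by positivity
  have h1 : HasDerivAt (fun x : ℝ => 1 + ((x - P.zc.re) ^ 2 + P.zc.im ^ 2) / ‖P.delta‖ ^ 2)
      (2 * (x - P.zc.re) / ‖P.delta‖ ^ 2) x := by
    refine ((((((hasDerivAt_id x).sub_const P.zc.re).pow 2).add_const (P.zc.im ^ 2)).div_const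
      (‖P.delta‖ ^ 2)).const_add 1).congr_deriv ?_
    simp
  have h2 := h1.sqrt hne
  rw [e]
  refine ⟨_, ?_, h2⟩
  have e' : Real.sqrt (1 + ((x - P.zc.re) ^ 2 + P.zc.im ^ 2) / ‖P.delta‖ ^ 2) = bracket P x := by
    rw [e]
  rw [e']
  have h3 : |x - P.zc.re| ≤ ‖P.delta‖ * bracket P x := by
    have := abs_re_le_norm ((x : ℂ) - P.zc)
    simp only [sub_re, ofReal_re] at this
    have h4 := scaledDist_le_bracket P x
    rw [scaledDist, div_le_iff₀ hd] at h4
    linarith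
  rw [abs_div, abs_div, abs_mul, abs_of_pos (by positivity : 0 < ‖P.delta‖ ^ 2),
    abs_of_pos (by positivity : 0 < 2 * bracket P x), abs_of_pos (by norm_num : (0 : ℝ) < 2),
    div_div, div_le_div_iff₀ (by positivity) hd]
  nlinarith

namespace Weight

variable {P : Data} {c C : ℝ} {Φ φ : ℝ → ℝ} (w : Weight P c C Φ φ)

include w

lemma continuousOn : ContinuousOn Φ (Icc 0 1) := fun x hx =>
  (w.deriv x hx).continuousAt.continuousWithinAt

lemma continuousOn_rpow_mul_exp (κ s : ℝ) :
    ContinuousOn (fun x => bracket P x ^ κ * Real.exp (s * Φ x)) (Icc 0 1) := by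
  refine ContinuousOn.mul ?_ (Real.continuous_exp.comp_continuousOn
    (continuousOn_const.mul w.continuousOn))
  exact ((continuous_bracket P).rpow_const fun x => Or.inl (bracket_pos P x).ne').continuousOn

/-- Differential inequality behind the integral bounds: the sign `s` selects the growing or the
decaying exponential. -/
lemma exists_hasDerivAt (hd : 0 < ‖P.delta‖) {κ s : ℝ} (hκ : κ ∈ Icc (0 : ℝ) 1)
    (hs : s ^ 2 = 1) {x : ℝ} (hx : x ∈ Icc (0 : ℝ) 1) :
    ∃ H' : ℝ, HasDerivAt (fun x => s * (bracket P x ^ (-κ - 1 / 2) * Real.exp (s * Φ x))) H' x ∧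
      c / ‖P.delta‖ * (bracket P x ^ (-κ) * Real.exp (s * Φ x)) ≤ H' := by
  obtain ⟨D', hD', hder⟩ := exists_hasDerivAt_bracket hd x
  have hD := bracket_pos P x
  have h1 := (((hder.rpow_const (p := -κ - 1 / 2) (Or.inl hD.ne')).mul
    (((w.deriv x hx).const_mul s).exp)).const_mul s)
  refine ⟨_, h1, ?_⟩
  set D := bracket P x
  set E := Real.exp (s * Φ x)
  have e1 : D ^ (-κ - 1 / 2 - 1) = D ^ (-κ - 1 / 2) * D⁻¹ := by
    rw [Real.rpow_sub_one hD.ne', div_eq_mul_inv]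
  have e2 : D ^ (-κ) = D ^ (-κ - 1 / 2) * Real.sqrt D := by
    rw [Real.sqrt_eq_rpow, ← Real.rpow_add hD]; congr 1; ring
  have e3 : s * (D' * (-κ - 1 / 2) * D ^ (-κ - 1 / 2 - 1) * E + D ^ (-κ - 1 / 2) *
      (E * (s * φ x))) = D ^ (-κ - 1 / 2) * E * (φ x - s * D' * (κ + 1 / 2) * D⁻¹) := by
    rw [e1]
    linear_combination D ^ (-κ - 1 / 2) * E * φ x * hs
  rw [e3, e2]
  have hsabs : |s| = 1 := by
    rw [← sq_abs] at hs
    nlinarith [abs_nonneg s]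
  have h2 : s * D' * (κ + 1 / 2) * D⁻¹ ≤ 2 / D / ‖P.delta‖ := by
    refine (le_abs_self _).trans ?_
    rw [abs_mul, abs_mul, abs_mul, hsabs, one_mul, abs_inv, abs_of_pos hD,
      abs_of_nonneg (by linarith [hκ.1] : 0 ≤ κ + 1 / 2)]
    calc |D'| * (κ + 1 / 2) * D⁻¹ ≤ 1 / ‖P.delta‖ * 2 * D⁻¹ := by
          have h5 : 0 ≤ κ + 1 / 2 := by linarith [hκ.1]
          gcongr; linarith [hκ.2]
      _ = _ := by field_simp
  have h3 := w.le_rate x hx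
  have h4 : c / ‖P.delta‖ * Real.sqrt D ≤ φ x - s * D' * (κ + 1 / 2) * D⁻¹ := by
    rw [add_div] at h3
    have : c / ‖P.delta‖ * Real.sqrt D = c * Real.sqrt D / ‖P.delta‖ := by ring
    rw [this]; linarith
  calc _ = D ^ (-κ - 1 / 2) * E * (c / ‖P.delta‖ * Real.sqrt D) := by ring
    _ ≤ _ := mul_le_mul_of_nonneg_left h4 (by positivity)

lemma integral_le_sub (hc : 0 < c) (hd : 0 < ‖P.delta‖) {κ s : ℝ} (hκ : κ ∈ Icc (0 : ℝ) 1)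
    (hs : s ^ 2 = 1) {x y : ℝ} (hx : 0 ≤ x) (hxy : x ≤ y) (hy : y ≤ 1) :
    ∫ t in x..y, bracket P t ^ (-κ) * Real.exp (s * Φ t) ≤ ‖P.delta‖ / c *
      (s * (bracket P y ^ (-κ - 1 / 2) * Real.exp (s * Φ y)) -
        s * (bracket P x ^ (-κ - 1 / 2) * Real.exp (s * Φ x))) := by
  have hsub : Icc x y ⊆ Icc (0 : ℝ) 1 := Icc_subset_Icc hx hy
  choose! H' hH' hle using fun x (hx : x ∈ Icc (0 : ℝ) 1) => w.exists_hasDerivAt hd hκ hs hx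
  have h1 := intervalIntegral.integral_le_sub_of_hasDeriv_right_of_le hxy
    (g := fun x => s * (bracket P x ^ (-κ - 1 / 2) * Real.exp (s * Φ x))) (g' := H')
    (φ := fun x => c / ‖P.delta‖ * (bracket P x ^ (-κ) * Real.exp (s * Φ x)))
    (fun t ht => (hH' t (hsub ht)).continuousAt.continuousWithinAt)
    (fun t ht => (hH' t (hsub (Ioo_subset_Icc_self ht))).hasDerivWithinAt)
    ((continuousOn_const.mul ((w.continuousOn_rpow_mul_exp (-κ) s).mono hsub)).integrableOn_Icc)
    (fun t ht => hle t (hsub (Ioo_subset_Icc_self ht)))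
  rw [intervalIntegral.integral_const_mul] at h1
  rw [div_mul_eq_mul_div, le_div_iff₀ hc]
  rw [div_mul_eq_mul_div, div_le_iff₀ hd] at h1
  linarith

/-- Integration of the growing exponential from the left gains `|δ|` and half a power. -/
lemma integral_growing_le (hc : 0 < c) (hd : 0 < ‖P.delta‖) {κ : ℝ} (hκ : κ ∈ Icc (0 : ℝ) 1)
    {z : ℝ} (hz : z ∈ Icc (0 : ℝ) 1) :
    ∫ t in (0 : ℝ)..z, bracket P t ^ (-κ) * Real.exp (Φ t) ≤
      ‖P.delta‖ / c * (bracket P z ^ (-κ - 1 / 2) * Real.exp (Φ z)) := by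
  have h1 := w.integral_le_sub hc hd hκ (s := 1) (by norm_num) le_rfl hz.1 hz.2
  simp only [one_mul] at h1
  refine h1.trans (mul_le_mul_of_nonneg_left ?_ (by positivity))
  have := bracket_pos P 0
  have : 0 ≤ bracket P 0 ^ (-κ - 1 / 2) * Real.exp (Φ 0) := by positivity
  linarith

/-- Integration of the decaying exponential from the right gains `|δ|` and half a power. -/
lemma integral_decaying_le (hc : 0 < c) (hd : 0 < ‖P.delta‖) {κ : ℝ} (hκ : κ ∈ Icc (0 : ℝ) 1)
    {z : ℝ} (hz : z ∈ Icc (0 : ℝ) 1) :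
    ∫ t in z..(1 : ℝ), bracket P t ^ (-κ) * Real.exp (-Φ t) ≤
      ‖P.delta‖ / c * (bracket P z ^ (-κ - 1 / 2) * Real.exp (-Φ z)) := by
  have h1 := w.integral_le_sub hc hd hκ (s := -1) (by norm_num) hz.1 hz.2 le_rfl
  simp only [neg_one_mul] at h1
  refine h1.trans (mul_le_mul_of_nonneg_left ?_ (by positivity))
  have := bracket_pos P 1
  have : 0 ≤ bracket P 1 ^ (-κ - 1 / 2) * Real.exp (-Φ 1) := by positivity
  linarith

lemma norm_integral_growing_le (hc : 0 < c) (hd : 0 < ‖P.delta‖) {κ A : ℝ} (hA : 0 ≤ A)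
    (hκ : κ ∈ Icc (0 : ℝ) 1) {f : ℝ → ℂ}
    (hf : ∀ x ∈ Icc (0 : ℝ) 1, ‖f x‖ ≤ A * (bracket P x ^ (-κ) * Real.exp (Φ x)))
    {z : ℝ} (hz : z ∈ Icc (0 : ℝ) 1) :
    ‖∫ t in (0 : ℝ)..z, f t‖ ≤
      ‖P.delta‖ * (A / c) * (bracket P z ^ (-κ - 1 / 2) * Real.exp (Φ z)) := by
  have hsub : Icc 0 z ⊆ Icc (0 : ℝ) 1 := Icc_subset_Icc_right hz.2
  have h1 : ‖∫ t in (0 : ℝ)..z, f t‖ ≤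
      ∫ t in (0 : ℝ)..z, A * (bracket P t ^ (-κ) * Real.exp (Φ t)) := by
    refine intervalIntegral.norm_integral_le_of_norm_le hz.1
      (Eventually.of_forall fun t ht => hf t (hsub (Ioc_subset_Icc_self ht))) ?_
    refine ContinuousOn.intervalIntegrable ?_
    rw [uIcc_of_le hz.1]
    have := w.continuousOn_rpow_mul_exp (-κ) 1
    simp only [one_mul] at this
    exact continuousOn_const.mul (this.mono hsub)
  rw [intervalIntegral.integral_const_mul] at h1
  refine h1.trans ((mul_le_mul_of_nonneg_left (w.integral_growing_le hc hd hκ hz) hA).trans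
    (le_of_eq ?_))
  ring

lemma norm_integral_decaying_le (hc : 0 < c) (hd : 0 < ‖P.delta‖) {κ A : ℝ} (hA : 0 ≤ A)
    (hκ : κ ∈ Icc (0 : ℝ) 1) {f : ℝ → ℂ}
    (hf : ∀ x ∈ Icc (0 : ℝ) 1, ‖f x‖ ≤ A * (bracket P x ^ (-κ) * Real.exp (-Φ x)))
    {z : ℝ} (hz : z ∈ Icc (0 : ℝ) 1) :
    ‖∫ t in z..(1 : ℝ), f t‖ ≤
      ‖P.delta‖ * (A / c) * (bracket P z ^ (-κ - 1 / 2) * Real.exp (-Φ z)) := by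
  have hsub : Icc z 1 ⊆ Icc (0 : ℝ) 1 := Icc_subset_Icc_left hz.1
  have h1 : ‖∫ t in z..(1 : ℝ), f t‖ ≤
      ∫ t in z..(1 : ℝ), A * (bracket P t ^ (-κ) * Real.exp (-Φ t)) := by
    refine intervalIntegral.norm_integral_le_of_norm_le hz.2
      (Eventually.of_forall fun t ht => hf t (hsub (Ioc_subset_Icc_self ht))) ?_
    refine ContinuousOn.intervalIntegrable ?_
    rw [uIcc_of_le hz.2]
    have := w.continuousOn_rpow_mul_exp (-κ) (-1)
    simp only [neg_one_mul] at this
    exact continuousOn_const.mul (this.mono hsub)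
  rw [intervalIntegral.integral_const_mul] at h1
  refine h1.trans ((mul_le_mul_of_nonneg_left (w.integral_decaying_le hc hd hκ hz) hA).trans
    (le_of_eq ?_))
  ring

end Weight

/-! ### Bounds of the Green function -/

section Interval

variable {f g₁ g₂ : ℝ → ℂ}

lemma uIcc_subset_unit {x y : ℝ} (hx : x ∈ Icc (0 : ℝ) 1) (hy : y ∈ Icc (0 : ℝ) 1) :
    uIcc x y ⊆ Icc (0 : ℝ) 1 := ordConnected_Icc.uIcc_subset hx hy

lemma intervalIntegrable_unit (hf : ContinuousOn f (Icc 0 1)) {x y : ℝ} (hx : x ∈ Icc (0 : ℝ) 1)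
    (hy : y ∈ Icc (0 : ℝ) 1) : IntervalIntegrable f volume x y :=
  (hf.mono (uIcc_subset_unit hx hy)).intervalIntegrable

/-- The fundamental theorem of calculus on `[0, 1]`, with one-sided derivatives at the ends. -/
lemma hasDerivWithinAt_primitive (hf : ContinuousOn f (Icc 0 1)) {a z : ℝ}
    (ha : a ∈ Icc (0 : ℝ) 1) (hz : z ∈ Icc (0 : ℝ) 1) :
    HasDerivWithinAt (fun z => ∫ y in a..z, f y) (f z) (Icc 0 1) z := by
  set g : ℝ → ℂ := IccExtend zero_le_one ((Icc (0 : ℝ) 1).domRestrict f) with hg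
  have hgc : Continuous g := (continuousOn_iff_continuous_domRestrict.1 hf).Icc_extend'
  have hgf : ∀ x ∈ Icc (0 : ℝ) 1, g x = f x := fun x hx => by
    rw [hg, IccExtend_of_mem _ _ hx]; rfl
  have hd : HasDerivAt (fun z => ∫ y in a..z, g y) (g z) z :=
    intervalIntegral.integral_hasDerivAt_right (hgc.intervalIntegrable _ _)
      hgc.stronglyMeasurable.stronglyMeasurableAtFilter hgc.continuousAt
  rw [hgf z hz] at hd
  refine hd.hasDerivWithinAt.congr_of_mem (fun x hx => ?_) hz
  exact intervalIntegral.integral_congr fun t ht => (hgf t (uIcc_subset_unit ha hx ht)).symm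

lemma hasDerivWithinAt_primitive_left (hf : ContinuousOn f (Icc 0 1)) {b z : ℝ}
    (hb : b ∈ Icc (0 : ℝ) 1) (hz : z ∈ Icc (0 : ℝ) 1) :
    HasDerivWithinAt (fun z => ∫ y in z..b, f y) (-f z) (Icc 0 1) z := by
  refine (hasDerivWithinAt_primitive hf hb hz).neg.congr_of_mem (fun x _ => ?_) hz
  exact intervalIntegral.integral_symm _ _

lemma continuousOn_primitive (hf : ContinuousOn f (Icc 0 1)) {a : ℝ} (ha : a ∈ Icc (0 : ℝ) 1) :
    ContinuousOn (fun z => ∫ y in a..z, f y) (Icc 0 1) := fun _ hz =>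
  (hasDerivWithinAt_primitive hf ha hz).continuousWithinAt

/-- Splitting at the diagonal the integral of a kernel given by two formulas. -/
lemma integral_piecewise (h₁ : ContinuousOn g₁ (Icc 0 1)) (h₂ : ContinuousOn g₂ (Icc 0 1)) {z : ℝ}
    (hz : z ∈ Icc (0 : ℝ) 1) :
    IntervalIntegrable (fun x => if z < x then g₁ x else g₂ x) volume 0 1 ∧
    ∫ x in (0 : ℝ)..1, (if z < x then g₁ x else g₂ x) =
      (∫ x in z..(1 : ℝ), g₁ x) + ∫ x in (0 : ℝ)..z, g₂ x := by
  have h0 : (0 : ℝ) ∈ Icc (0 : ℝ) 1 := by simp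
  have h1 : (1 : ℝ) ∈ Icc (0 : ℝ) 1 := by simp
  have e₁ : EqOn g₁ (fun x => if z < x then g₁ x else g₂ x) (uIoc z 1) := fun x hx => by
    rw [uIoc_of_le hz.2] at hx; simp [hx.1]
  have e₂ : EqOn g₂ (fun x => if z < x then g₁ x else g₂ x) (uIoc 0 z) := fun x hx => by
    rw [uIoc_of_le hz.1] at hx; simp [hx.2]
  have i₁ := (intervalIntegrable_unit h₁ hz h1).congr e₁
  have i₂ := (intervalIntegrable_unit h₂ h0 hz).congr e₂
  refine ⟨i₂.trans i₁, ?_⟩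
  rw [← intervalIntegral.integral_add_adjacent_intervals i₂ i₁, add_comm]
  congr 1
  · exact intervalIntegral.integral_congr_ae (Eventually.of_forall fun x hx => (e₁ hx).symm)
  · exact intervalIntegral.integral_congr_ae (Eventually.of_forall fun x hx => (e₂ hx).symm)

end Interval

lemma X0.continuous_toFun (f : X0) : Continuous f.toFun := f.continuous.Icc_extend'

lemma X0.norm_toFun_le (f : X0) (x : ℝ) : ‖f.toFun x‖ ≤ ‖f‖ := f.norm_coe_le_norm _

lemma X0.toFun_coe (f : X0) (z : Icc (0 : ℝ) 1) : f.toFun z = f z := IccExtend_val _ _ _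

lemma bracket_rpow_le_one (P : Data) (x : ℝ) {κ : ℝ} (hκ : κ ≤ 0) : bracket P x ^ κ ≤ 1 :=
  Real.rpow_le_one_of_one_le_of_nonpos (one_le_bracket P x) hκ

/-- The distance scale `|δ| + dist (z_c, [0, 1])` of the logarithmic condition. -/
def logScale (P : Data) : ℝ := ‖P.delta‖ + Metric.infDist P.zc unitSeg

namespace Regular

variable {P : Data} {ρ m : ℝ} (h : Regular P ρ m)

include h

lemma continuousOn_comp_ofReal {F : ℂ → ℂ} (hF : ContinuousOn F (nbhd ρ)) :
    ContinuousOn (fun x : ℝ => F x) (Icc 0 1) :=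
  hF.comp continuous_ofReal.continuousOn fun _ hx => h.ofReal_mem (h.unit_subset hx)

lemma continuousOn_sqrtDot : ContinuousOn (fun x : ℝ => P.sqrtDot x) (Icc 0 1) :=
  h.continuousOn_comp_ofReal h.sqrtDot_diff.continuousOn

lemma continuousOn_AiL : ContinuousOn P.AiL (Icc 0 1) :=
  continuous_Ai.comp_continuousOn
    ((h.continuousOn_comp_ofReal h.eta_diff.continuousOn).div_const _)

lemma continuousOn_CiL : ContinuousOn P.CiL (Icc 0 1) :=
  continuous_Ci.comp_continuousOn
    ((h.continuousOn_comp_ofReal h.eta_diff.continuousOn).div_const _)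

lemma continuousOn_Ai1 : ContinuousOn P.Ai1 (Icc 0 1) :=
  continuousOn_const.mul (continuousOn_primitive
    (h.continuousOn_sqrtDot.mul h.continuousOn_AiL) (by simp))

lemma continuousOn_Ci1 : ContinuousOn P.Ci1 (Icc 0 1) :=
  continuousOn_const.mul (continuousOn_primitive
    (h.continuousOn_sqrtDot.mul h.continuousOn_CiL) (by simp))

lemma continuousOn_Ai2 : ContinuousOn P.Ai2 (Icc 0 1) :=
  continuousOn_const.mul (continuousOn_primitive h.continuousOn_Ai1 (by simp))

lemma continuousOn_Ci2 : ContinuousOn P.Ci2 (Icc 0 1) :=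
  continuousOn_const.mul (continuousOn_primitive h.continuousOn_Ci1 (by simp))

lemma continuousOn_a1 : ContinuousOn P.a1 (Icc 0 1) :=
  (h.continuousOn_CiL.mul h.continuousOn_Ai1).sub (h.continuousOn_AiL.mul h.continuousOn_Ci1)

lemma continuousOn_a2 : ContinuousOn P.a2 (Icc 0 1) :=
  (h.continuousOn_AiL.mul h.continuousOn_Ci2).sub (h.continuousOn_CiL.mul h.continuousOn_Ai2)

lemma norm_sqrtDot_le {x : ℝ} (hx : x ∈ Icc (0 : ℝ) 1) : ‖P.sqrtDot x‖ ≤ m⁻¹ :=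
  (h.sqrtDot_norm (h.ofReal_mem (h.unit_subset hx))).2

lemma norm_delta_cube_div : ‖P.delta ^ 3 / P.eps‖ ≤ m⁻¹ := by
  have : P.delta ^ 3 / P.eps = P.dUc⁻¹ := by
    rw [h.delta_cube]; field_simp [h.eps_ne_zero, h.dUc_ne_zero]
  rw [this, norm_inv]
  exact inv_anti₀ h.m_pos h.le_norm_dUc

variable {c C : ℝ} {Φ φ : ℝ → ℝ} (w : Weight P c C Φ φ) (hc : 0 < c) (hC : 0 < C)

include w hc hC

lemma norm_Ci1_le {z : ℝ} (hz : z ∈ Icc (0 : ℝ) 1) :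
    ‖P.Ci1 z‖ ≤ m⁻¹ * C / c * (bracket P z ^ (-(3 / 4) : ℝ) * Real.exp (Φ z)) := by
  have hd := h.norm_delta_pos
  have hm := h.m_pos
  have h1 := w.norm_integral_growing_le hc hd (κ := 1 / 4) (A := m⁻¹ * C) (by positivity)
    ⟨by norm_num, by norm_num⟩ (f := fun y => P.sqrtDot y * P.CiL y) (fun x hx => by
      rw [norm_mul, mul_assoc]
      refine mul_le_mul (h.norm_sqrtDot_le hx) ?_ (norm_nonneg _) (by positivity)
      rw [← mul_assoc]; exact w.Ci_le x hx) hz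
  rw [show (-(1 / 4) - 1 / 2 : ℝ) = -(3 / 4) by norm_num] at h1
  rw [Data.Ci1, norm_mul, norm_inv, inv_mul_le_iff₀ hd]
  linarith

lemma norm_Ai1_le {z : ℝ} (hz : z ∈ Icc (0 : ℝ) 1) :
    ‖P.Ai1 z‖ ≤ m⁻¹ * C / c * (bracket P z ^ (-(3 / 4) : ℝ) * Real.exp (-Φ z)) := by
  have hd := h.norm_delta_pos
  have hm := h.m_pos
  have h1 := w.norm_integral_decaying_le hc hd (κ := 1 / 4) (A := m⁻¹ * C) (by positivity)
    ⟨by norm_num, by norm_num⟩ (f := fun y => P.sqrtDot y * P.AiL y) (fun x hx => by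
      rw [norm_mul, mul_assoc]
      refine mul_le_mul (h.norm_sqrtDot_le hx) ?_ (norm_nonneg _) (by positivity)
      rw [← mul_assoc]; exact w.Ai_le x hx) hz
  rw [show (-(1 / 4) - 1 / 2 : ℝ) = -(3 / 4) by norm_num] at h1
  rw [Data.Ai1, norm_mul, norm_inv, inv_mul_le_iff₀ hd, intervalIntegral.integral_symm, norm_neg]
  linarith

lemma norm_Ci2_le {z : ℝ} (hz : z ∈ Icc (0 : ℝ) 1) :
    ‖P.Ci2 z‖ ≤ m⁻¹ * C / c ^ 2 * Real.exp (Φ z) := by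
  have hd := h.norm_delta_pos
  have hm := h.m_pos
  have h1 := w.norm_integral_growing_le hc hd (κ := 3 / 4) (A := m⁻¹ * C / c) (by positivity)
    ⟨by norm_num, by norm_num⟩ (f := P.Ci1) (fun x hx => h.norm_Ci1_le w hc hC hx) hz
  have h2 := bracket_rpow_le_one P z (κ := -(3 / 4) - 1 / 2) (by norm_num)
  rw [Data.Ci2, norm_mul, norm_inv, inv_mul_le_iff₀ hd]
  refine h1.trans ?_
  calc _ ≤ ‖P.delta‖ * (m⁻¹ * C / c / c) * (1 * Real.exp (Φ z)) := by gcongr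
    _ = _ := by field_simp

lemma norm_Ai2_le {z : ℝ} (hz : z ∈ Icc (0 : ℝ) 1) :
    ‖P.Ai2 z‖ ≤ m⁻¹ * C / c ^ 2 * Real.exp (-Φ z) := by
  have hd := h.norm_delta_pos
  have hm := h.m_pos
  have h1 := w.norm_integral_decaying_le hc hd (κ := 3 / 4) (A := m⁻¹ * C / c) (by positivity)
    ⟨by norm_num, by norm_num⟩ (f := P.Ai1) (fun x hx => h.norm_Ai1_le w hc hC hx) hz
  have h2 := bracket_rpow_le_one P z (κ := -(3 / 4) - 1 / 2) (by norm_num)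
  rw [Data.Ai2, norm_mul, norm_inv, inv_mul_le_iff₀ hd, intervalIntegral.integral_symm, norm_neg]
  refine h1.trans ?_
  calc _ ≤ ‖P.delta‖ * (m⁻¹ * C / c / c) * (1 * Real.exp (-Φ z)) := by gcongr
    _ = _ := by field_simp

/-- The exponentials of `Ai` and `Ci` cancel in `a₁`, which leaves a decay like the inverse
bracket. -/
lemma norm_a1_le {x : ℝ} (hx : x ∈ Icc (0 : ℝ) 1) :
    ‖P.a1 x‖ ≤ 2 * (m⁻¹ * C ^ 2 / c) / bracket P x := by
  have hm := h.m_pos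
  have hD := bracket_pos P x
  have hA := w.Ai_le x hx
  have hCi := w.Ci_le x hx
  have hA1 := h.norm_Ai1_le w hc hC hx
  have hC1 := h.norm_Ci1_le w hc hC hx
  have e1 : bracket P x ^ (-(1 / 4) : ℝ) * bracket P x ^ (-(3 / 4) : ℝ) = (bracket P x)⁻¹ := by
    rw [← Real.rpow_add hD, ← Real.rpow_neg_one]; norm_num
  have e2 : Real.exp (Φ x) * Real.exp (-Φ x) = 1 := by rw [← Real.exp_add]; simp
  rw [Data.a1]
  refine (norm_sub_le _ _).trans ?_
  rw [norm_mul, norm_mul]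
  calc _ ≤ (C * bracket P x ^ (-(1 / 4) : ℝ) * Real.exp (Φ x)) *
        (m⁻¹ * C / c * (bracket P x ^ (-(3 / 4) : ℝ) * Real.exp (-Φ x))) +
        (C * bracket P x ^ (-(1 / 4) : ℝ) * Real.exp (-Φ x)) *
        (m⁻¹ * C / c * (bracket P x ^ (-(3 / 4) : ℝ) * Real.exp (Φ x))) := by gcongr
    _ = 2 * (m⁻¹ * C ^ 2 / c) * (bracket P x ^ (-(1 / 4) : ℝ) * bracket P x ^ (-(3 / 4) : ℝ)) *
        (Real.exp (Φ x) * Real.exp (-Φ x)) := by ring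
    _ = _ := by rw [e1, e2]; ring

lemma norm_AiL_mul_Ci2_le {x z : ℝ} (hx : x ∈ Icc (0 : ℝ) 1) (hz : z ∈ Icc (0 : ℝ) 1)
    (hΦ : Φ z ≤ Φ x) : ‖P.AiL x * P.Ci2 z‖ ≤ m⁻¹ * C ^ 2 / c ^ 2 := by
  have hm := h.m_pos
  have h2 := bracket_rpow_le_one P x (κ := -(1 / 4)) (by norm_num)
  have h1 : ‖P.AiL x‖ ≤ C * Real.exp (-Φ x) := by
    refine (w.Ai_le x hx).trans ?_
    calc _ ≤ C * 1 * Real.exp (-Φ x) := by gcongr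
      _ = _ := by ring
  rw [norm_mul]
  calc _ ≤ (C * Real.exp (-Φ x)) * (m⁻¹ * C / c ^ 2 * Real.exp (Φ z)) :=
        mul_le_mul h1 (h.norm_Ci2_le w hc hC hz) (norm_nonneg _) (by positivity)
    _ = m⁻¹ * C ^ 2 / c ^ 2 * Real.exp (Φ z - Φ x) := by
        rw [sub_eq_add_neg, Real.exp_add]; ring
    _ ≤ m⁻¹ * C ^ 2 / c ^ 2 * 1 := by
        gcongr; rw [Real.exp_le_one_iff]; linarith
    _ = _ := mul_one _

lemma norm_CiL_mul_Ai2_le {x z : ℝ} (hx : x ∈ Icc (0 : ℝ) 1) (hz : z ∈ Icc (0 : ℝ) 1)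
    (hΦ : Φ x ≤ Φ z) : ‖P.CiL x * P.Ai2 z‖ ≤ m⁻¹ * C ^ 2 / c ^ 2 := by
  have hm := h.m_pos
  have h2 := bracket_rpow_le_one P x (κ := -(1 / 4)) (by norm_num)
  have h1 : ‖P.CiL x‖ ≤ C * Real.exp (Φ x) := by
    refine (w.Ci_le x hx).trans ?_
    calc _ ≤ C * 1 * Real.exp (Φ x) := by gcongr
      _ = _ := by ring
  rw [norm_mul]
  calc _ ≤ (C * Real.exp (Φ x)) * (m⁻¹ * C / c ^ 2 * Real.exp (-Φ z)) :=
        mul_le_mul h1 (h.norm_Ai2_le w hc hC hz) (norm_nonneg _) (by positivity)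
    _ = m⁻¹ * C ^ 2 / c ^ 2 * Real.exp (Φ x - Φ z) := by
        rw [sub_eq_add_neg, Real.exp_add]; ring
    _ ≤ m⁻¹ * C ^ 2 / c ^ 2 * 1 := by
        gcongr; rw [Real.exp_le_one_iff]; linarith
    _ = _ := mul_one _

omit h hC in
lemma monotoneOn_weight (hd : 0 < ‖P.delta‖) : MonotoneOn Φ (Icc 0 1) := by
  refine monotoneOn_of_deriv_nonneg (convex_Icc 0 1) w.continuousOn
    (fun x hx => (w.deriv x (interior_subset hx)).differentiableAt.differentiableWithinAt)
    fun x hx => ?_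
  rw [(w.deriv x (interior_subset hx)).deriv]
  refine le_trans ?_ (w.le_rate x (interior_subset hx))
  have := bracket_pos P x
  positivity

/-- The exponentials cancel in all terms, since `Φ` is monotone. What remains is bounded, except
for `a₁ (x) (z - z_c) / δ` with `z < x`: there `|z - z_c| ≤ |x - z_c| + 2 |z_c|`, and the last term
contributes a kernel whose integral is logarithmic. -/
lemma norm_G_le {x z : ℝ} (hx : x ∈ Icc (0 : ℝ) 1) (hz : z ∈ Icc (0 : ℝ) 1) :
    ‖P.G x z‖ ≤ (m⁻¹) ^ 2 * (3 * (m⁻¹ * C ^ 2 / c ^ 2) + 2 * (m⁻¹ * C ^ 2 / c)) *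
      (1 + 8 * (‖P.zc‖ / Real.sqrt (logScale P ^ 2 + (x - P.zc.re) ^ 2))) := by
  have hm := h.m_pos
  have hd := h.norm_delta_pos
  have hD := bracket_pos P x
  have hmono := monotoneOn_weight w hc hd
  have ha1 := h.norm_a1_le w hc hC hx
  set A₁ := m⁻¹ * C ^ 2 / c with hA₁
  set A₂ := m⁻¹ * C ^ 2 / c ^ 2 with hA₂
  have hA₁0 : 0 ≤ A₁ := by positivity
  have hA₂0 : 0 ≤ A₂ := by positivity
  have hinf : 0 ≤ Metric.infDist P.zc unitSeg := Metric.infDist_nonneg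
  set L := Real.sqrt (logScale P ^ 2 + (x - P.zc.re) ^ 2) with hL
  have hLS : 0 < logScale P := by rw [logScale]; linarith
  have hLpos : 0 < L := by positivity
  have ht : ‖(x : ℂ) - P.zc‖ ≤ ‖P.delta‖ * bracket P x := by
    have h4 := scaledDist_le_bracket P x
    rw [scaledDist, div_le_iff₀ hd] at h4
    linarith
  have hdD : ‖P.delta‖ ≤ ‖P.delta‖ * bracket P x := by nlinarith [one_le_bracket P x]
  -- the three distances that enter `L` are at most `|δ|` brackets
  have hLle : L ≤ 4 * (‖P.delta‖ * bracket P x) := by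
    have h1 : L ≤ logScale P + |x - P.zc.re| := by
      rw [hL, Real.sqrt_le_left (by positivity), ← sq_abs (x - P.zc.re)]
      nlinarith [abs_nonneg (x - P.zc.re)]
    have h2 : Metric.infDist P.zc unitSeg ≤ ‖(x : ℂ) - P.zc‖ := by
      rw [norm_sub_rev, ← dist_eq_norm]
      exact Metric.infDist_le_dist_of_mem ⟨x, hx, rfl⟩
    have h3 : |x - P.zc.re| ≤ ‖(x : ℂ) - P.zc‖ := by
      have := abs_re_le_norm ((x : ℂ) - P.zc)
      simpa using this
    rw [logScale] at h1
    linarith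
  have hker : 0 ≤ 8 * (‖P.zc‖ / L) := by positivity
  rw [Data.G, norm_mul, norm_mul, norm_neg, sq, mul_assoc (m⁻¹ * m⁻¹)]
  refine mul_le_mul (mul_le_mul h.norm_delta_cube_div (h.norm_sqrtDot_le hx) (norm_nonneg _)
    (by positivity)) ?_ (norm_nonneg _) (by positivity)
  split_ifs with hzx
  · have h1 := h.norm_AiL_mul_Ci2_le w hc hC hx hz (hmono hz hx hzx.le)
    have h2 : ‖P.a1 x * ((z - P.zc) / P.delta)‖ ≤ 2 * A₁ * (1 + 8 * (‖P.zc‖ / L)) := by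
      have h3 : ‖(z : ℂ) - P.zc‖ ≤ ‖P.delta‖ * bracket P x + 2 * ‖P.zc‖ := by
        have g1 : ‖(z : ℂ) - P.zc‖ ≤ z + ‖P.zc‖ := by
          refine (norm_sub_le _ _).trans ?_
          rw [norm_real, Real.norm_of_nonneg hz.1]
        have g2 : x ≤ ‖(x : ℂ) - P.zc‖ + ‖P.zc‖ := by
          have := norm_le_norm_sub_add (x : ℂ) P.zc
          rwa [norm_real, Real.norm_of_nonneg hx.1] at this
        linarith
      rw [norm_mul, norm_div]
      calc _ ≤ 2 * A₁ / bracket P x * ((‖P.delta‖ * bracket P x + 2 * ‖P.zc‖) / ‖P.delta‖) := by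
            gcongr
        _ = 2 * A₁ * (1 + 8 * (‖P.zc‖ / (4 * (‖P.delta‖ * bracket P x)))) := by
            field_simp; ring
        _ ≤ _ := by gcongr
    refine (norm_add_le _ _).trans ?_
    nlinarith [mul_nonneg hA₂0 hker]
  · rw [not_lt] at hzx
    have h1 := h.norm_CiL_mul_Ai2_le w hc hC hx hz (hmono hx hz hzx)
    have h2 : ‖P.a2 x‖ ≤ A₂ + A₂ := (norm_sub_le _ _).trans (add_le_add
      (h.norm_AiL_mul_Ci2_le w hc hC hx hx le_rfl) (h.norm_CiL_mul_Ai2_le w hc hC hx hx le_rfl))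
    have h3 : ‖P.a1 x * ((x - P.zc) / P.delta)‖ ≤ 2 * A₁ := by
      rw [norm_mul, norm_div]
      calc _ ≤ 2 * A₁ / bracket P x * ((‖P.delta‖ * bracket P x) / ‖P.delta‖) := by gcongr
        _ = 2 * A₁ := by field_simp
    refine (norm_add₃_le).trans ?_
    nlinarith [mul_nonneg hA₂0 hker, mul_nonneg hA₁0 hker]

end Regular

/-- The logarithmic integral, through its primitive `arsinh`. -/
lemma integral_inv_sqrt_le {d a : ℝ} (hd : 0 < d) (hd2 : d ≤ 2) (ha : |a| ≤ 1) :
    ∫ x in (0 : ℝ)..1, 1 / Real.sqrt (d ^ 2 + (x - a) ^ 2) ≤ 2 * (5 + Real.log (1 / d)) := by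
  have hder : ∀ x ∈ uIcc (0 : ℝ) 1, HasDerivAt (fun x => Real.arsinh ((x - a) / d))
      (1 / Real.sqrt (d ^ 2 + (x - a) ^ 2)) x := by
    intro x _
    refine (((hasDerivAt_id x).sub_const a).div_const d).arsinh.congr_deriv ?_
    have : d ^ 2 + (x - a) ^ 2 = d ^ 2 * (1 + ((x - a) / d) ^ 2) := by field_simp
    rw [this, Real.sqrt_mul (by positivity), Real.sqrt_sq hd.le]
    simp only [id, smul_eq_mul]
    field_simp
  have hcont : Continuous fun x : ℝ => 1 / Real.sqrt (d ^ 2 + (x - a) ^ 2) :=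
    continuous_const.div (by fun_prop) fun x => by positivity
  rw [intervalIntegral.integral_eq_sub_of_hasDerivAt hder (hcont.intervalIntegrable _ _)]
  have ha' := abs_le.1 ha
  have hmono : ∀ y : ℝ, y ≤ 2 → Real.arsinh (y / d) ≤ 5 + Real.log (1 / d) := by
    intro y hy
    have h1 : Real.arsinh (y / d) ≤ Real.arsinh (2 / d) := Real.arsinh_le_arsinh.2 (by gcongr)
    refine h1.trans ?_
    have h2 : Real.sqrt (1 + (2 / d) ^ 2) ≤ 1 + 2 / d := by
      have : 0 ≤ 2 / d := by positivity
      rw [Real.sqrt_le_left (by positivity)]; nlinarith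
    have h3 : 2 / d + Real.sqrt (1 + (2 / d) ^ 2) ≤ 6 * (1 / d) := by
      have : 1 ≤ 2 / d := by rw [le_div_iff₀ hd]; linarith
      have e : 6 * (1 / d) = 3 * (2 / d) := by ring
      rw [e]; linarith
    have h4 : 0 < 2 / d + Real.sqrt (1 + (2 / d) ^ 2) := by positivity
    rw [Real.arsinh]
    refine (Real.log_le_log h4 h3).trans ?_
    rw [Real.log_mul (by norm_num) (by positivity)]
    have := Real.log_le_sub_one_of_pos (by norm_num : (0 : ℝ) < 6)
    linarith
  have h1 := hmono (1 - a) (by linarith)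
  have h2 := hmono a (by linarith)
  have h3 : Real.arsinh ((0 - a) / d) = -Real.arsinh (a / d) := by
    rw [← Real.arsinh_neg]; congr 1; ring
  rw [h3]; linarith

/-! ### The differential equation -/

/-- The derivative of `ż^{1/2} A (δ⁻¹ η)`, where `dA` stands for the derivative of `A`. -/
def dLift (P : Data) (A dA : ℂ → ℂ) (z : ℂ) : ℂ :=
  deriv P.sqrtDot z * A (P.eta z / P.delta) +
    P.sqrtDot z * (dA (P.eta z / P.delta) * (Regular.dEta P z / P.delta))

/-- The zeroth order coefficient of the equation solved exactly by `ż^{1/2} Ai (δ⁻¹ η)`. -/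
def liftCoeff (P : Data) (z : ℝ) : ℂ :=
  iteratedDeriv 2 P.sqrtDot z / P.sqrtDot z + (P.U z - P.c) / P.eps

/-- `∫_z^1 ẋ^{1/2} Ai (X) f`. -/
def tailAi (P : Data) (f : X0) (z : ℝ) : ℂ :=
  ∫ x in z..(1 : ℝ), P.sqrtDot x * P.AiL x * f.toFun x

/-- `∫_0^z ẋ^{1/2} Ci (X) f`. -/
def headCi (P : Data) (f : X0) (z : ℝ) : ℂ :=
  ∫ x in (0 : ℝ)..z, P.sqrtDot x * P.CiL x * f.toFun x

/-- `∫_z^1 ẋ^{1/2} a₁ f`. -/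
def tailSlope (P : Data) (f : X0) (z : ℝ) : ℂ :=
  ∫ x in z..(1 : ℝ), P.sqrtDot x * P.a1 x * f.toFun x

/-- `∫_0^z ẋ^{1/2} (a₂ + a₁ (x - z_c) / δ) f`. -/
def headConst (P : Data) (f : X0) (z : ℝ) : ℂ :=
  ∫ x in (0 : ℝ)..z, P.sqrtDot x * (P.a2 x + P.a1 x * ((x - P.zc) / P.delta)) * f.toFun x

/-- The derivatives of orders `0, …, 4` of the approximate solution; the value `0` at higher orders
is a placeholder without meaning. -/
def solverDeriv (P : Data) (f : X0) : ℕ → ℝ → ℂ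
  | 0, z => -(P.delta ^ 3 / P.eps) * (P.Ci2 z * tailAi P f z +
      (z - P.zc) / P.delta * tailSlope P f z + P.Ai2 z * headCi P f z + headConst P f z)
  | 1, z => -(P.delta ^ 2 / P.eps) *
      (P.Ci1 z * tailAi P f z + tailSlope P f z + P.Ai1 z * headCi P f z)
  | 2, z => -(P.delta / P.eps) *
      (P.sqrtDot z * P.CiL z * tailAi P f z + P.sqrtDot z * P.AiL z * headCi P f z)
  | 3, z => -(P.delta / P.eps) *
      (dLift P Ci dCi z * tailAi P f z + dLift P Ai dAi z * headCi P f z)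
  | 4, z => liftCoeff P z * (-(P.delta / P.eps) *
      (P.sqrtDot z * P.CiL z * tailAi P f z + P.sqrtDot z * P.AiL z * headCi P f z)) +
      f.toFun z / P.eps
  | _, _ => 0

lemma iteratedDerivWithin_eqOn {φ : ℝ → ℂ} {g : ℕ → ℝ → ℂ} {s : Set ℝ} (hs : UniqueDiffOn ℝ s)
    {n : ℕ} (h0 : EqOn φ (g 0) s)
    (hg : ∀ k < n, ∀ z ∈ s, HasDerivWithinAt (g k) (g (k + 1) z) s z) :
    ∀ k ≤ n, EqOn (iteratedDerivWithin k φ s) (g k) s := by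
  intro k
  induction k with
  | zero => intro _; simpa using h0
  | succ k ih =>
    intro hk z hz
    rw [iteratedDerivWithin_succ, derivWithin_congr (ih (by omega)) (ih (by omega) hz)]
    exact (hg k (by omega) z hz).derivWithin (hs z hz)

lemma contDiffOn_of_hasDerivWithinAt {φ : ℝ → ℂ} {g : ℕ → ℝ → ℂ} {s : Set ℝ}
    (hs : UniqueDiffOn ℝ s) {n : ℕ} (h0 : EqOn φ (g 0) s)
    (hg : ∀ k < n, ∀ z ∈ s, HasDerivWithinAt (g k) (g (k + 1) z) s z)
    (hn : ContinuousOn (g n) s) : ContDiffOn ℝ n φ s := by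
  have key := iteratedDerivWithin_eqOn hs h0 hg
  have hd : ∀ k < n, DifferentiableOn ℝ (g k) s := fun k hk z hz =>
    (hg k hk z hz).differentiableWithinAt
  refine (contDiffOn_iff_continuousOn_differentiableOn_deriv (n := (n : ℕ∞)) hs).2
    ⟨fun k hk => ?_, fun k hk => ?_⟩
  · have hk' : k ≤ n := by exact_mod_cast hk
    refine ContinuousOn.congr ?_ (key k hk')
    rcases hk'.lt_or_eq with h | rfl
    · exact (hd k h).continuousOn
    · exact hn
  · have hk' : k < n := by exact_mod_cast hk
    exact (hd k hk').congr (key k hk'.le)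

namespace Regular

variable {P : Data} {ρ m : ℝ} (h : Regular P ρ m)

include h

lemma sqrtDot_ne_zero {z : ℂ} (hz : z ∈ nbhd ρ) : P.sqrtDot z ≠ 0 := by
  intro h0
  have := h.sqrtDot_sq hz
  simp [h0] at this

lemma hasDerivAt_sqrtDot {z : ℂ} (hz : z ∈ nbhd ρ) :
    HasDerivAt P.sqrtDot (deriv P.sqrtDot z) z :=
  (h.sqrtDot_diff.differentiableAt (isOpen_nbhd.mem_nhds hz)).hasDerivAt

lemma hasDerivAt_deriv_sqrtDot {z : ℂ} (hz : z ∈ nbhd ρ) :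
    HasDerivAt (deriv P.sqrtDot) (iteratedDeriv 2 P.sqrtDot z) z := by
  have := ((h.sqrtDot_diff.deriv isOpen_nbhd).differentiableAt
    (isOpen_nbhd.mem_nhds hz)).hasDerivAt
  rwa [iteratedDeriv_succ, iteratedDeriv_one]

/-- The derivative of `ż^{-1} ż = 1` in the form that removes the first order term from Langer's
equation. -/
lemma two_mul_deriv_sqrtDot {z : ℂ} (hz : z ∈ nbhd ρ) :
    2 * deriv P.sqrtDot z * dEta P z + P.sqrtDot z * deriv (dEta P) z = 0 := by
  have hn := isOpen_nbhd.mem_nhds hz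
  have hE := (h.dEta_diff.differentiableAt hn).hasDerivAt
  have h1 := ((h.hasDerivAt_sqrtDot hz).pow 2).mul hE
  have h2 : HasDerivAt (P.sqrtDot ^ 2 * dEta P) 0 z :=
    (hasDerivAt_const z (1 : ℂ)).congr_of_eventuallyEq (by
      filter_upwards [hn] with w hw using h.sqrtDot_sq hw)
  have h3 := h1.unique h2
  simp only [Pi.pow_apply] at h3
  refine mul_left_cancel₀ (h.sqrtDot_ne_zero hz) ?_
  rw [mul_zero, ← h3]
  push_cast
  ring

lemma eta_mul_dEta_sq_div {z : ℂ} (hz : z ∈ nbhd ρ) :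
    P.eta z * dEta P z ^ 2 / P.delta ^ 3 = (P.U z - P.c) / P.eps := by
  rw [h.eta_mul_dEta_sq hz, sub_mul_quot, h.delta_cube]
  have := h.eps_ne_zero
  have := h.dUc_ne_zero
  field_simp

lemma hasDerivAt_lift {A dA : ℂ → ℂ} (hA : ∀ z, HasDerivAt A (dA z) z) {x : ℝ}
    (hx : x ∈ Icc (0 : ℝ) 1) :
    HasDerivAt (fun x : ℝ => P.sqrtDot x * A (P.eta x / P.delta)) (dLift P A dA x) x := by
  have hz := h.ofReal_mem (h.unit_subset hx)
  exact ((h.hasDerivAt_sqrtDot hz).mul ((hA _).comp (x : ℂ)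
    ((h.hasDerivAt_eta hz).div_const P.delta))).comp_ofReal

/-- Langer's transformation: `ż^{1/2} A (δ⁻¹ η)` solves a perturbation of the Airy equation. -/
lemma hasDerivAt_dLift {A dA : ℂ → ℂ} (hA : ∀ z, HasDerivAt A (dA z) z)
    (hdA : ∀ z, HasDerivAt dA (z * A z) z) {x : ℝ} (hx : x ∈ Icc (0 : ℝ) 1) :
    HasDerivAt (fun x : ℝ => dLift P A dA x)
      (liftCoeff P x * (P.sqrtDot x * A (P.eta x / P.delta))) x := by
  have hz := h.ofReal_mem (h.unit_subset hx)
  have hη := (h.hasDerivAt_eta hz).div_const P.delta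
  have hE := (h.dEta_diff.differentiableAt (isOpen_nbhd.mem_nhds hz)).hasDerivAt
  have h1 := (((h.hasDerivAt_deriv_sqrtDot hz).mul ((hA _).comp (x : ℂ) hη)).add
    ((h.hasDerivAt_sqrtDot hz).mul (((hdA _).comp (x : ℂ) hη).mul
      (hE.div_const P.delta)))).comp_ofReal
  refine h1.congr_deriv ?_
  have e1 := h.two_mul_deriv_sqrtDot hz
  have e2 := h.eta_mul_dEta_sq_div hz
  have hs := h.sqrtDot_ne_zero hz
  have hδ := h.delta_ne_zero
  rw [liftCoeff, ← e2]
  simp only [Function.comp_apply, Pi.mul_apply]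
  field_simp
  linear_combination P.delta ^ 2 * dA (P.eta x / P.delta) * e1

/-- The Wronskian that produces the jump of the third derivative of the Green function. -/
lemma wronskian_lift {x : ℝ} (hx : x ∈ Icc (0 : ℝ) 1) :
    P.sqrtDot x * P.AiL x * dLift P Ci dCi x - dLift P Ai dAi x * (P.sqrtDot x * P.CiL x) =
      1 / P.delta := by
  have e1 := h.sqrtDot_sq (h.ofReal_mem (h.unit_subset hx))
  have e2 := wronskian_eq_one (P.eta x / P.delta)
  have hδ := h.delta_ne_zero
  simp only [dLift, Data.AiL, Data.CiL]
  field_simp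
  linear_combination e1 + P.sqrtDot x ^ 2 * dEta P x * e2

section Solver

variable (f : X0)

lemma continuousOn_AiL_mul : ContinuousOn (fun x : ℝ => P.sqrtDot x * P.AiL x * f.toFun x)
    (Icc 0 1) :=
  (h.continuousOn_sqrtDot.mul h.continuousOn_AiL).mul f.continuous_toFun.continuousOn

lemma continuousOn_CiL_mul : ContinuousOn (fun x : ℝ => P.sqrtDot x * P.CiL x * f.toFun x)
    (Icc 0 1) :=
  (h.continuousOn_sqrtDot.mul h.continuousOn_CiL).mul f.continuous_toFun.continuousOn

lemma continuousOn_a1_mul : ContinuousOn (fun x : ℝ => P.sqrtDot x * P.a1 x * f.toFun x)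
    (Icc 0 1) :=
  (h.continuousOn_sqrtDot.mul h.continuousOn_a1).mul f.continuous_toFun.continuousOn

lemma continuousOn_const_mul : ContinuousOn
    (fun x : ℝ => P.sqrtDot x * (P.a2 x + P.a1 x * ((x - P.zc) / P.delta)) * f.toFun x)
    (Icc 0 1) :=
  (h.continuousOn_sqrtDot.mul (h.continuousOn_a2.add (h.continuousOn_a1.mul
    (by fun_prop)))).mul f.continuous_toFun.continuousOn

/-- The boundary terms at `x = z` cancel in the first two derivatives by the choice of `a₂` and
`a₁`, in the third one by symmetry, and in the fourth one they add up to `f / ε` by the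
Wronskian. -/
lemma hasDerivWithinAt_solverDeriv {k : ℕ} (hk : k < 4) {z : ℝ} (hz : z ∈ Icc (0 : ℝ) 1) :
    HasDerivWithinAt (solverDeriv P f k) (solverDeriv P f (k + 1) z) (Icc 0 1) z := by
  have h0 : (0 : ℝ) ∈ Icc (0 : ℝ) 1 := by simp
  have h1 : (1 : ℝ) ∈ Icc (0 : ℝ) 1 := by simp
  have hδ := h.delta_ne_zero
  have hε := h.eps_ne_zero
  have dA : HasDerivWithinAt (tailAi P f) _ (Icc 0 1) z :=
    hasDerivWithinAt_primitive_left (h.continuousOn_AiL_mul f) h1 hz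
  have dC : HasDerivWithinAt (headCi P f) _ (Icc 0 1) z :=
    hasDerivWithinAt_primitive (h.continuousOn_CiL_mul f) h0 hz
  have dS : HasDerivWithinAt (tailSlope P f) _ (Icc 0 1) z :=
    hasDerivWithinAt_primitive_left (h.continuousOn_a1_mul f) h1 hz
  have dK : HasDerivWithinAt (headConst P f) _ (Icc 0 1) z :=
    hasDerivWithinAt_primitive (h.continuousOn_const_mul f) h0 hz
  have dA1 : HasDerivWithinAt P.Ai1 _ (Icc 0 1) z := (hasDerivWithinAt_primitive
    (h.continuousOn_sqrtDot.mul h.continuousOn_AiL) h1 hz).const_mul P.delta⁻¹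
  have dC1 : HasDerivWithinAt P.Ci1 _ (Icc 0 1) z := (hasDerivWithinAt_primitive
    (h.continuousOn_sqrtDot.mul h.continuousOn_CiL) h0 hz).const_mul P.delta⁻¹
  have dA2 : HasDerivWithinAt P.Ai2 _ (Icc 0 1) z :=
    (hasDerivWithinAt_primitive h.continuousOn_Ai1 h1 hz).const_mul P.delta⁻¹
  have dC2 : HasDerivWithinAt P.Ci2 _ (Icc 0 1) z :=
    (hasDerivWithinAt_primitive h.continuousOn_Ci1 h0 hz).const_mul P.delta⁻¹
  have du : HasDerivWithinAt (fun x : ℝ => P.sqrtDot x * P.AiL x) _ (Icc 0 1) z :=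
    (h.hasDerivAt_lift hasDerivAt_Ai hz).hasDerivWithinAt
  have dv : HasDerivWithinAt (fun x : ℝ => P.sqrtDot x * P.CiL x) _ (Icc 0 1) z :=
    (h.hasDerivAt_lift hasDerivAt_Ci hz).hasDerivWithinAt
  have ddu := (h.hasDerivAt_dLift hasDerivAt_Ai hasDerivAt_dAi hz).hasDerivWithinAt (s := Icc 0 1)
  have ddv := (h.hasDerivAt_dLift hasDerivAt_Ci hasDerivAt_dCi hz).hasDerivWithinAt (s := Icc 0 1)
  have dl : HasDerivWithinAt (fun x : ℝ => ((x : ℂ) - P.zc) / P.delta) (1 / P.delta)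
      (Icc 0 1) z :=
    (((hasDerivAt_id (z : ℂ)).sub_const P.zc).div_const P.delta).comp_ofReal.hasDerivWithinAt
  interval_cases k
  · refine (((((dC2.mul dA).add (dl.mul dS)).add (dA2.mul dC)).add dK).const_mul
      (-(P.delta ^ 3 / P.eps))).congr_deriv ?_
    simp only [solverDeriv, Data.a1, Data.a2]
    field_simp
    ring
  · refine ((((dC1.mul dA).add dS).add (dA1.mul dC)).const_mul
      (-(P.delta ^ 2 / P.eps))).congr_deriv ?_
    simp only [solverDeriv, Data.a1, Pi.mul_apply]
    field_simp
    ring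
  · refine (((dv.mul dA).add (du.mul dC)).const_mul (-(P.delta / P.eps))).congr_deriv ?_
    simp only [solverDeriv]
    ring
  · refine (((ddv.mul dA).add (ddu.mul dC)).const_mul (-(P.delta / P.eps))).congr_deriv ?_
    have e := h.wronskian_lift hz
    simp only [solverDeriv]
    rw [div_eq_mul_inv (f.toFun z),
      show f.toFun z * P.eps⁻¹ = P.delta / P.eps * f.toFun z * (1 / P.delta) by field_simp, ← e]
    simp only [Data.AiL, Data.CiL]
    ring

lemma continuousOn_liftCoeff : ContinuousOn (liftCoeff P) (Icc 0 1) := by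
  have h2 : ContinuousOn (fun z => iteratedDeriv 2 P.sqrtDot z) (nbhd ρ) := by
    refine ContinuousOn.congr ((h.sqrtDot_diff.deriv isOpen_nbhd).deriv isOpen_nbhd).continuousOn
      fun z _ => ?_
    rw [iteratedDeriv_succ, iteratedDeriv_one]
  exact (h.continuousOn_comp_ofReal (F := fun z => iteratedDeriv 2 P.sqrtDot z / P.sqrtDot z +
    (P.U z - P.c) / P.eps) ((h2.div h.sqrtDot_diff.continuousOn fun z hz =>
      h.sqrtDot_ne_zero hz).add ((h.diff.continuousOn.sub continuousOn_const).div_const _)))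

lemma continuousOn_solverDeriv_four : ContinuousOn (solverDeriv P f 4) (Icc 0 1) := by
  have h2 : ContinuousOn (solverDeriv P f 2) (Icc 0 1) := fun z hz =>
    (h.hasDerivWithinAt_solverDeriv f (by norm_num) hz).continuousWithinAt
  exact (h.continuousOn_liftCoeff.mul h2).add (f.continuous_toFun.continuousOn.div_const _)

lemma airySolver_eq {z : ℝ} (hz : z ∈ Icc (0 : ℝ) 1) :
    IntervalIntegrable (fun x => P.G x z * f.toFun x) volume 0 1 ∧
    P.airySolver f z = solverDeriv P f 0 z := by
  have hA := (h.continuousOn_AiL_mul f)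
  have hC := (h.continuousOn_CiL_mul f)
  have hS := (h.continuousOn_a1_mul f)
  have hK := (h.continuousOn_const_mul f)
  have h0 : (0 : ℝ) ∈ Icc (0 : ℝ) 1 := by simp
  have h1 : (1 : ℝ) ∈ Icc (0 : ℝ) 1 := by simp
  have key := integral_piecewise
    (g₁ := fun x => -(P.delta ^ 3 / P.eps) * (P.Ci2 z * (P.sqrtDot x * P.AiL x * f.toFun x) +
      (z - P.zc) / P.delta * (P.sqrtDot x * P.a1 x * f.toFun x)))
    (g₂ := fun x : ℝ => -(P.delta ^ 3 / P.eps) * (P.Ai2 z * (P.sqrtDot x * P.CiL x * f.toFun x) +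
      P.sqrtDot x * (P.a2 x + P.a1 x * ((x - P.zc) / P.delta)) * f.toFun x))
    (continuousOn_const.mul ((continuousOn_const.mul hA).add (continuousOn_const.mul hS)))
    (continuousOn_const.mul ((continuousOn_const.mul hC).add hK)) hz
  have e : (fun x => P.G x z * f.toFun x) = fun x : ℝ => if z < x then
      -(P.delta ^ 3 / P.eps) * (P.Ci2 z * (P.sqrtDot x * P.AiL x * f.toFun x) +
      (z - P.zc) / P.delta * (P.sqrtDot x * P.a1 x * f.toFun x)) else
      -(P.delta ^ 3 / P.eps) * (P.Ai2 z * (P.sqrtDot x * P.CiL x * f.toFun x) +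
      P.sqrtDot x * (P.a2 x + P.a1 x * ((x - P.zc) / P.delta)) * f.toFun x) := by
    funext x
    rw [Data.G]
    split_ifs <;> ring
  rw [Data.airySolver, e]
  refine ⟨key.1, key.2.trans ?_⟩
  simp only [intervalIntegral.integral_const_mul]
  rw [intervalIntegral.integral_add ((intervalIntegrable_unit hA hz h1).const_mul _)
      ((intervalIntegrable_unit hS hz h1).const_mul _),
    intervalIntegral.integral_add ((intervalIntegrable_unit hC h0 hz).const_mul _)
      (intervalIntegrable_unit hK h0 hz)]
  simp only [intervalIntegral.integral_const_mul, solverDeriv, tailAi, tailSlope, headCi, headConst]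
  ring

lemma airyErr_eq {z : ℝ} (hz : z ∈ Icc (0 : ℝ) 1) :
    IntervalIntegrable (fun x => P.errA x z * f.toFun x) volume 0 1 ∧
    P.airyErr f z = P.eps * (iteratedDeriv 2 P.sqrtDot z / P.sqrtDot z - 2 * (P.α : ℂ) ^ 2) *
      solverDeriv P f 2 z := by
  have hA := (h.continuousOn_AiL_mul f)
  have hC := (h.continuousOn_CiL_mul f)
  set k := P.eps * (iteratedDeriv 2 P.sqrtDot z / P.sqrtDot z - 2 * (P.α : ℂ) ^ 2) with hk
  have key := integral_piecewise
    (g₁ := fun x => k * (-(P.delta / P.eps) * P.sqrtDot z * P.CiL z) *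
      (P.sqrtDot x * P.AiL x * f.toFun x))
    (g₂ := fun x => k * (-(P.delta / P.eps) * P.sqrtDot z * P.AiL z) *
      (P.sqrtDot x * P.CiL x * f.toFun x))
    (continuousOn_const.mul hA) (continuousOn_const.mul hC) hz
  have e : (fun x => P.errA x z * f.toFun x) = fun x : ℝ => if z < x then
      k * (-(P.delta / P.eps) * P.sqrtDot z * P.CiL z) * (P.sqrtDot x * P.AiL x * f.toFun x) else
      k * (-(P.delta / P.eps) * P.sqrtDot z * P.AiL z) *
        (P.sqrtDot x * P.CiL x * f.toFun x) := by
    funext x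
    rw [Data.errA, ← hk, Data.ddG]
    split_ifs <;> ring
  rw [Data.airyErr, e]
  refine ⟨key.1, key.2.trans ?_⟩
  simp only [intervalIntegral.integral_const_mul, solverDeriv, tailAi, headCi]
  ring

/-- In `Airy (φ) - f` only the term `-2 ε α² φ''` and the Langer potential
`ε (ż^{1/2})'' / ż^{1/2} φ''` are left, and they make up the error operator. -/
lemma airySolves {φ g : X0} (hφ : ∀ z : Icc (0 : ℝ) 1, φ z = P.airySolver f z)
    (hg : ∀ z : Icc (0 : ℝ) 1, g z = P.airyErr f z) : P.AirySolves φ (f + g) := by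
  have hs : UniqueDiffOn ℝ (Icc (0 : ℝ) 1) := uniqueDiffOn_Icc zero_lt_one
  have e0 : EqOn φ.toFun (solverDeriv P f 0) (Icc 0 1) := fun z hz => by
    rw [← (h.airySolver_eq f hz).2]
    exact (φ.toFun_coe ⟨z, hz⟩).trans (hφ ⟨z, hz⟩)
  have hd : ∀ k < 4, ∀ z ∈ Icc (0 : ℝ) 1,
      HasDerivWithinAt (solverDeriv P f k) (solverDeriv P f (k + 1) z) (Icc 0 1) z :=
    fun k hk z hz => h.hasDerivWithinAt_solverDeriv f hk hz
  refine ⟨contDiffOn_of_hasDerivWithinAt hs e0 hd (h.continuousOn_solverDeriv_four f),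
    fun z => ?_⟩
  have key := iteratedDerivWithin_eqOn hs e0 hd
  rw [Data.airyOp, key 4 le_rfl z.2, key 2 (by norm_num) z.2, ContinuousMap.add_apply, hg z,
    (h.airyErr_eq f z.2).2]
  have hε := h.eps_ne_zero
  simp only [solverDeriv, liftCoeff, f.toFun_coe]
  field_simp
  ring

end Solver

end Regular

/-! ### The operators -/

namespace Regular

variable {P : Data} {ρ m : ℝ} (h : Regular P ρ m)

include h

section Bounds

variable {c C : ℝ} {Φ φ : ℝ → ℝ} (w : Weight P c C Φ φ) (hc : 0 < c) (hC : 0 < C)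

include w hc hC

/-- Here the logarithmic condition on `z_c` enters: it bounds the integral of the singular part of
the kernel. -/
lemma norm_airySolver_le {M : ℝ} (hzc : ‖P.zc‖ ≤ 1) (hδ : ‖P.delta‖ ≤ 1)
    (hlog : ‖P.zc‖ * Real.log (1 / logScale P) ≤ M) (f : X0) {z : ℝ} (hz : z ∈ Icc (0 : ℝ) 1) :
    ‖P.airySolver f z‖ ≤ (m⁻¹) ^ 2 * (3 * (m⁻¹ * C ^ 2 / c ^ 2) + 2 * (m⁻¹ * C ^ 2 / c)) *
      (1 + 16 * (5 + M)) * ‖f‖ := by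
  have hm := h.m_pos
  set A := (m⁻¹) ^ 2 * (3 * (m⁻¹ * C ^ 2 / c ^ 2) + 2 * (m⁻¹ * C ^ 2 / c)) with hA
  have hA0 : 0 ≤ A := by positivity
  have hinf0 : 0 ≤ Metric.infDist P.zc unitSeg := Metric.infDist_nonneg
  have hinf1 : Metric.infDist P.zc unitSeg ≤ 1 := by
    refine (Metric.infDist_le_dist_of_mem
      (show (0 : ℂ) ∈ unitSeg from ⟨0, by simp, by simp⟩)).trans ?_
    simpa using hzc
  have hd : 0 < logScale P := by have := h.norm_delta_pos; rw [logScale]; linarith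
  have hd2 : logScale P ≤ 2 := by rw [logScale]; linarith
  have hint := integral_inv_sqrt_le hd hd2 ((abs_re_le_norm P.zc).trans hzc)
  have hcont : Continuous fun x : ℝ =>
      1 / Real.sqrt (logScale P ^ 2 + (x - P.zc.re) ^ 2) :=
    continuous_const.div (by fun_prop) fun x => by positivity
  have hcont2 : Continuous fun x : ℝ => A * (1 + 8 * ‖P.zc‖ *
      (1 / Real.sqrt (logScale P ^ 2 + (x - P.zc.re) ^ 2))) * ‖f‖ :=
    (continuous_const.mul (continuous_const.add (continuous_const.mul hcont))).mul
      continuous_const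
  have key : ‖∫ x in (0 : ℝ)..1, P.G x z * f.toFun x‖ ≤ _ :=
    intervalIntegral.norm_integral_le_of_norm_le zero_le_one
      (Eventually.of_forall fun x hx => by
        rw [norm_mul]
        refine mul_le_mul ((h.norm_G_le w hc hC (Ioc_subset_Icc_self hx) hz).trans_eq ?_)
          (f.norm_toFun_le x) (norm_nonneg _) (by positivity)
        ring) (hcont2.intervalIntegrable 0 1)
  refine key.trans ?_
  rw [intervalIntegral.integral_mul_const, intervalIntegral.integral_const_mul,
    intervalIntegral.integral_add (by simp) ((hcont.intervalIntegrable _ _).const_mul _),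
    intervalIntegral.integral_const_mul, intervalIntegral.integral_const]
  have : ‖P.zc‖ * (∫ x in (0 : ℝ)..1, 1 / Real.sqrt (logScale P ^ 2 + (x - P.zc.re) ^ 2)) ≤
      2 * (5 + M) := by
    have := mul_le_mul_of_nonneg_left hint (norm_nonneg P.zc)
    nlinarith
  gcongr A * ?_ * ‖f‖
  simp only [sub_zero, smul_eq_mul, mul_one]
  linarith

/-- One factor `|δ|` is the normalization of `∂_z² G`, the other one the width of its
concentration. -/
lemma norm_airyErr_le {M : ℝ} (hα : P.α ≤ M) (f : X0) {z : ℝ} (hz : z ∈ Icc (0 : ℝ) 1) :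
    ‖P.airyErr f z‖ ≤ (16 / (ρ ^ 2 * m ^ 2) + 2 * M ^ 2) * (2 * ((m⁻¹) ^ 2 * C ^ 2 / c)) *
      ‖P.delta‖ ^ 2 * ‖f‖ := by
  have hm := h.m_pos
  have hd := h.norm_delta_pos
  have hα0 := h.α_pos
  have hε := h.eps_ne_zero
  have hB : 0 ≤ m⁻¹ * C * ‖f‖ := by positivity
  have hs := h.norm_sqrtDot_le hz
  have e : Real.exp (-Φ z) * Real.exp (Φ z) = 1 := by rw [← Real.exp_add]; simp
  have b1 := bracket_rpow_le_one P z (κ := -(1 / 4)) (by norm_num)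
  have b2 := bracket_rpow_le_one P z (κ := -(1 / 4) - 1 / 2) (by norm_num)
  have p1 : 0 < bracket P z ^ (-(1 / 4) : ℝ) := Real.rpow_pos_of_pos (bracket_pos P z) _
  have hAi : ‖tailAi P f z‖ ≤ ‖P.delta‖ * (m⁻¹ * C * ‖f‖ / c) * Real.exp (-Φ z) := by
    have := w.norm_integral_decaying_le hc hd (κ := 1 / 4) hB ⟨by norm_num, by norm_num⟩
      (f := fun x => P.sqrtDot x * P.AiL x * f.toFun x) (fun x hx => by
        rw [norm_mul, norm_mul]
        have := mul_le_mul (mul_le_mul (h.norm_sqrtDot_le hx) (w.Ai_le x hx) (norm_nonneg _)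
          (by positivity)) (f.norm_toFun_le x) (norm_nonneg _)
          (by have := bracket_pos P x; positivity)
        linarith) hz
    refine this.trans (mul_le_mul_of_nonneg_left ?_ (by positivity))
    exact mul_le_of_le_one_left (Real.exp_pos _).le b2
  have hCi : ‖headCi P f z‖ ≤ ‖P.delta‖ * (m⁻¹ * C * ‖f‖ / c) * Real.exp (Φ z) := by
    have := w.norm_integral_growing_le hc hd (κ := 1 / 4) hB ⟨by norm_num, by norm_num⟩
      (f := fun x => P.sqrtDot x * P.CiL x * f.toFun x) (fun x hx => by
        rw [norm_mul, norm_mul]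
        have := mul_le_mul (mul_le_mul (h.norm_sqrtDot_le hx) (w.Ci_le x hx) (norm_nonneg _)
          (by positivity)) (f.norm_toFun_le x) (norm_nonneg _)
          (by have := bracket_pos P x; positivity)
        linarith) hz
    refine this.trans (mul_le_mul_of_nonneg_left ?_ (by positivity))
    exact mul_le_of_le_one_left (Real.exp_pos _).le b2
  have hA' : ‖P.AiL z‖ ≤ C * Real.exp (-Φ z) := (w.Ai_le z hz).trans
    (mul_le_mul_of_nonneg_right (mul_le_of_le_one_right hC.le b1) (Real.exp_pos _).le)
  have hC' : ‖P.CiL z‖ ≤ C * Real.exp (Φ z) := (w.Ci_le z hz).trans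
    (mul_le_mul_of_nonneg_right (mul_le_of_le_one_right hC.le b1) (Real.exp_pos _).le)
  have hpot : ‖iteratedDeriv 2 P.sqrtDot z / P.sqrtDot z - 2 * (P.α : ℂ) ^ 2‖ ≤
      16 / (ρ ^ 2 * m ^ 2) + 2 * M ^ 2 := by
    refine (norm_sub_le _ _).trans (add_le_add (h.sqrtDot_potential_le hz) ?_)
    rw [norm_mul, norm_pow, norm_real, Real.norm_of_nonneg hα0.le, RCLike.norm_ofNat]
    gcongr
  have hsum : ‖P.sqrtDot z * P.CiL z * tailAi P f z + P.sqrtDot z * P.AiL z * headCi P f z‖ ≤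
      2 * ((m⁻¹) ^ 2 * C ^ 2 / c) * ‖P.delta‖ * ‖f‖ := by
    refine (norm_add_le _ _).trans ?_
    rw [norm_mul, norm_mul, norm_mul, norm_mul]
    calc _ ≤ m⁻¹ * (C * Real.exp (Φ z)) *
          (‖P.delta‖ * (m⁻¹ * C * ‖f‖ / c) * Real.exp (-Φ z)) +
          m⁻¹ * (C * Real.exp (-Φ z)) *
          (‖P.delta‖ * (m⁻¹ * C * ‖f‖ / c) * Real.exp (Φ z)) := by gcongr
      _ = 2 * ((m⁻¹) ^ 2 * C ^ 2 / c) * ‖P.delta‖ * ‖f‖ *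
          (Real.exp (-Φ z) * Real.exp (Φ z)) := by ring
      _ = _ := by rw [e, mul_one]
  have e2 : P.airyErr f z = -P.delta *
      (iteratedDeriv 2 P.sqrtDot z / P.sqrtDot z - 2 * (P.α : ℂ) ^ 2) *
      (P.sqrtDot z * P.CiL z * tailAi P f z + P.sqrtDot z * P.AiL z * headCi P f z) := by
    rw [(h.airyErr_eq f hz).2]
    simp only [solverDeriv]
    field_simp
  rw [e2, norm_mul, norm_mul, norm_neg]
  calc _ ≤ ‖P.delta‖ * (16 / (ρ ^ 2 * m ^ 2) + 2 * M ^ 2) *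
        (2 * ((m⁻¹) ^ 2 * C ^ 2 / c) * ‖P.delta‖ * ‖f‖) := by gcongr
    _ = _ := by ring

end Bounds

lemma continuousOn_airySolver (f : X0) : ContinuousOn (P.airySolver f) (Icc 0 1) :=
  ContinuousOn.congr (fun _ hz =>
    (h.hasDerivWithinAt_solverDeriv f (k := 0) (by norm_num) hz).continuousWithinAt)
    fun _ hz => (h.airySolver_eq f hz).2

lemma continuousOn_airyErr (f : X0) : ContinuousOn (P.airyErr f) (Icc 0 1) := by
  have h2 : ContinuousOn (solverDeriv P f 2) (Icc 0 1) := fun z hz =>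
    (h.hasDerivWithinAt_solverDeriv f (k := 2) (by norm_num) hz).continuousWithinAt
  have h3 := (((h.continuousOn_liftCoeff.sub (h.continuousOn_comp_ofReal
    ((h.diff.continuousOn.sub (continuousOn_const (c := P.c))).div_const P.eps))).sub
      (continuousOn_const (c := 2 * (P.α : ℂ) ^ 2))).const_mul P.eps).mul h2
  refine h3.congr fun z hz => ?_
  rw [(h.airyErr_eq f hz).2]
  simp [liftCoeff]

omit h in
/-- A linear operator on `X₀` given by an integral kernel. -/
lemma exists_kernelOperator {K : ℝ → ℝ → ℂ} {B : ℝ}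
    (hint : ∀ (f : X0), ∀ z ∈ Icc (0 : ℝ) 1,
      IntervalIntegrable (fun x => K x z * f.toFun x) volume 0 1)
    (hcont : ∀ f : X0, ContinuousOn (fun z => ∫ x in (0 : ℝ)..1, K x z * f.toFun x) (Icc 0 1))
    (hB : ∀ (f : X0), ∀ z ∈ Icc (0 : ℝ) 1, ‖∫ x in (0 : ℝ)..1, K x z * f.toFun x‖ ≤ B * ‖f‖) :
    ∃ S : X0 →L[ℂ] X0, (∀ (f : X0) (z : Icc (0 : ℝ) 1),
      S f z = ∫ x in (0 : ℝ)..1, K x z * f.toFun x) ∧ ∀ f, ‖S f‖ ≤ B * ‖f‖ := by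
  let S₀ : X0 →ₗ[ℂ] X0 :=
    { toFun := fun f => ⟨fun z => ∫ x in (0 : ℝ)..1, K x z * f.toFun x,
        continuousOn_iff_continuous_domRestrict.1 (hcont f)⟩
      map_add' := fun f g => by
        ext z
        change ∫ x in (0 : ℝ)..1, K x z * (f.toFun x + g.toFun x) = _
        simp only [mul_add]
        exact intervalIntegral.integral_add (hint f z z.2) (hint g z z.2)
      map_smul' := fun a f => by
        ext z
        change ∫ x in (0 : ℝ)..1, K x z * (a * f.toFun x) =
          a * ∫ x in (0 : ℝ)..1, K x z * f.toFun x
        rw [← intervalIntegral.integral_const_mul]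
        exact intervalIntegral.integral_congr fun x _ => mul_left_comm _ _ _ }
  have hS : ∀ f, ‖S₀ f‖ ≤ B * ‖f‖ := fun f =>
    (ContinuousMap.norm_le_of_nonempty _).2 fun z => hB f z z.2
  exact ⟨S₀.mkContinuous B hS, fun _ _ => rfl, hS⟩

end Regular

/-- An approximate solver `S` with an error operator `E` of norm at most `1/2` is corrected by the
Neumann series of `(1 + E)⁻¹`. -/
lemma exists_hasSum_neumann {V : Type*} [NormedAddCommGroup V] [NormedSpace ℂ V]
    [CompleteSpace V] (S E : V →L[ℂ] V) {B : ℝ} (hB : 0 ≤ B)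
    (hS : ∀ f, ‖S f‖ ≤ B * ‖f‖) (hE : ∀ f, ‖E f‖ ≤ 1 / 2 * ‖f‖) :
    ∃ T : V →L[ℂ] V, (∀ f, HasSum (fun n : ℕ => S (((-E) ^ n) f)) (T f)) ∧
      (∀ f, ∃ g, T f = S g ∧ g + E g = f) ∧ ∀ f, ‖T f‖ ≤ 2 * B * ‖f‖ := by
  have hn : ‖-E‖ ≤ 1 / 2 := by
    rw [norm_neg]; exact E.opNorm_le_bound (by norm_num) hE
  have hlt : ‖-E‖ < 1 := hn.trans_lt (by norm_num)
  have hsum : Summable fun n : ℕ => (-E) ^ n := summable_geometric_of_norm_lt_one hlt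
  set N := ∑' n : ℕ, (-E) ^ n with hN
  have hN1 : (1 - -E) * N = 1 := mul_neg_geom_series (-E) hlt
  have hsolve : ∀ f, N f + E (N f) = f := fun f => by
    have := congrArg (fun L : V →L[ℂ] V => L f) hN1
    simpa using this
  refine ⟨S.comp N, fun f => ?_, fun f => ⟨N f, rfl, hsolve f⟩, fun f => ?_⟩
  · exact (hsum.hasSum.mapL (ContinuousLinearMap.apply ℂ V f)).mapL S
  · have h1 : ‖N f‖ ≤ ‖f‖ + 1 / 2 * ‖N f‖ := by
      have h2 : N f = f - E (N f) := eq_sub_of_add_eq (hsolve f)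
      calc ‖N f‖ = ‖f - E (N f)‖ := by rw [← h2]
        _ ≤ ‖f‖ + ‖E (N f)‖ := norm_sub_le _ _
        _ ≤ _ := by gcongr; exact hE _
    calc ‖S (N f)‖ ≤ B * ‖N f‖ := hS _
      _ ≤ B * (2 * ‖f‖) := by gcongr; linarith
      _ = _ := by ring

end OrrSommerfeld

end

theorem proposition4p1
    (U : ℂ → ℂ)
    (hU : AnalyticOnNhd ℂ U ((fun x : ℝ => (x : ℂ)) '' Set.Icc (0 : ℝ) 1))
    (hreal : ∀ x ∈ Set.Icc (0 : ℝ) 1, (U x).im = 0)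
    (hU' : 0 < (deriv U 0).re)
    (hcrit : ∀ x ∈ Set.Ioc (0 : ℝ) 1, U x ≠ U 0) :
    ∃ r > (0 : ℝ), ∀ M : ℝ, ∃ δ₀ > (0 : ℝ), ∃ C > (0 : ℝ),
      ∀ P : OrrSommerfeld.Data, P.U = U → 0 < P.α → P.α ≤ M → 0 < P.R → ‖P.zc‖ < r →
        ‖P.delta‖ ≤ δ₀ →
        -M * ‖P.delta‖ ≤ P.zc.im →
        ‖P.zc‖ * Real.log (1 / (‖P.delta‖ +
          Metric.infDist P.zc ((fun x : ℝ => (x : ℂ)) '' Set.Icc (0 : ℝ) 1))) ≤ M →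
        -- the approximate solver, its error operator, and the exact solver
        ∃ S E T : OrrSommerfeld.X0 →L[ℂ] OrrSommerfeld.X0,
          (∀ (f : OrrSommerfeld.X0) (z : Set.Icc (0 : ℝ) 1), S f z = P.airySolver f z) ∧
          (∀ (f : OrrSommerfeld.X0) (z : Set.Icc (0 : ℝ) 1), E f z = P.airyErr f z) ∧
          (∀ f : OrrSommerfeld.X0, P.AirySolves (S f) (f + E f)) ∧
          (∀ f : OrrSommerfeld.X0, ‖S f‖ ≤ C * ‖f‖) ∧
          (∀ f : OrrSommerfeld.X0, ‖E f‖ ≤ C * ‖P.delta‖ ^ 2 * ‖f‖) ∧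
          (∀ f : OrrSommerfeld.X0, HasSum (fun n : ℕ => S (((-E) ^ n) f)) (T f)) ∧
          (∀ f : OrrSommerfeld.X0, P.AirySolves (T f) f) ∧
          (∀ f : OrrSommerfeld.X0, ‖T f‖ ≤ C * ‖f‖) := by
  obtain ⟨ρ, m, hρ, hρ1, hm, hreg⟩ := OrrSommerfeld.exists_regular U hU hreal hU' hcrit
  refine ⟨ρ, hρ, fun M => ?_⟩
  -- for `M ≤ 0` no data satisfy `0 < α ≤ M`
  rcases le_or_gt M 0 with hM | hM
  · exact ⟨1, one_pos, 1, one_pos, fun P _ h1 h2 => absurd (h1.trans_le h2) hM.not_gt⟩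
  obtain ⟨c, hc, K, hK, hweight⟩ := OrrSommerfeld.exists_weight hm hM.le
  set B := (m⁻¹) ^ 2 * (3 * (m⁻¹ * K ^ 2 / c ^ 2) + 2 * (m⁻¹ * K ^ 2 / c)) *
    (1 + 16 * (5 + M)) with hB
  set B' := (16 / (ρ ^ 2 * m ^ 2) + 2 * M ^ 2) * (2 * ((m⁻¹) ^ 2 * K ^ 2 / c)) with hB'
  have hB0 : 0 < B := by positivity
  have hB'0 : 0 < B' := by positivity
  -- `|δ| ≤ 1` and `B' |δ| ≤ 1/2` make the norm of the error operator at most `1/2`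
  refine ⟨min 1 (1 / (2 * B')), by positivity, 2 * B + B', by positivity,
    fun P hPU hα hαM hR hzc hδ him hlog => ?_⟩
  have h := hreg P hPU hα hR hzc
  obtain ⟨Φ, φ, w⟩ := hweight P ρ h him
  have hδ1 : ‖P.delta‖ ≤ 1 := hδ.trans (min_le_left _ _)
  have hδ2 : ‖P.delta‖ ≤ 1 / (2 * B') := hδ.trans (min_le_right _ _)
  have hsmall : B' * ‖P.delta‖ ^ 2 ≤ 1 / 2 := by
    calc B' * ‖P.delta‖ ^ 2 ≤ B' * ‖P.delta‖ := by
          gcongr; exact pow_le_of_le_one (norm_nonneg _) hδ1 two_ne_zero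
      _ ≤ B' * (1 / (2 * B')) := by gcongr
      _ = 1 / 2 := by field_simp
  obtain ⟨S, hS, hSB⟩ := OrrSommerfeld.Regular.exists_kernelOperator
    (fun f z hz => (h.airySolver_eq f hz).1) h.continuousOn_airySolver
    (fun f z hz => h.norm_airySolver_le w hc hK (hzc.le.trans hρ1) hδ1 hlog f hz)
  obtain ⟨E, hE, hEB⟩ := OrrSommerfeld.Regular.exists_kernelOperator
    (fun f z hz => (h.airyErr_eq f hz).1) h.continuousOn_airyErr
    (fun f z hz => h.norm_airyErr_le w hc hK hαM f hz)
  obtain ⟨T, hT, hTS, hTB⟩ := OrrSommerfeld.exists_hasSum_neumann S E hB0.le hSB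
    fun f => (hEB f).trans (by gcongr)
  refine ⟨S, E, T, hS, hE, fun f => h.airySolves f (hS f) (hE f), fun f => (hSB f).trans ?_,
    fun f => (hEB f).trans ?_, hT, fun f => ?_, fun f => (hTB f).trans ?_⟩
  · gcongr; linarith
  · gcongr; linarith
  · obtain ⟨g, hg, hgf⟩ := hTS f
    rw [hg]
    have := h.airySolves g (hS g) (hE g)
    rwa [hgf] at this
  · gcongr; linarith
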